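/- **Proposition (large-$s$ asymptotics of the Lyapunov exponent).** For $p,s>0$ let $a_1,a_2,\dots$ be independent random variables, each with the gamma density $\gamma_{p,s}(a)=\frac{1}{s^p\Gamma(p)}a^{p-1}e^{-a/s}$, $a\ge 0$. For $\alpha\in[-\pi/2,\pi/2]$ put $$ \mathcal A_n(\alpha)=\begin{pmatrix}0&1\\1&a_n e^{i\alpha}\end{pmatrix},\qquad \mathcal M_n(\alpha)=\mathcal A_1(\alpha)\mathcal A_2(\alpha)\cdots\mathcal A_n(\alpha), $$ and let $\lambda_{p,s}(\alpha)$ denote the Lyapunov exponent, i.e. the constant such that $\lambda_{p,s}(\alpha)=\lim_{n\to\infty}\frac1n\ln|\mathcal M_n(\alpha)|$ almost surely, where $|\cdot|$ is the operator norm for the Euclidean norm on $\mathbb C^2$; this constant exists. Let $\psi=\Gamma'/\Gamma$. Then, for every fixed $p>0$ and $\alpha\in[-\pi/2,\pi/2]$, $$ \lambda_{p,s}(\alpha)=\ln s+\psi(p)+R_{p,s}(\alpha)\qquad(s>0), $$ where, as $s\to\infty$, $$ R_{p,s}(\alpha)= \begin{cases} 2\cos(2p\alpha)\,\dfrac{\Gamma(1-p)}{\Gamma(1+p)}\,\dfrac{\ln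 s}{s^{2p}}+O\!\left(\dfrac1{s^{2p}}\right), & 0<p<1,\\[2mm] 2\cos(2\alpha)\,\dfrac{(\ln s)^2}{s^2}+O\!\left(\dfrac{\ln s}{s^2}\right), & p=1,\\[2mm] \dfrac{\cos(2\alpha)}{(p-1)^2}\,\dfrac1{s^2}+O(E(s)), & p>1, \end{cases} \qquad E(s)= \begin{cases} \ln s/s^{2p}, & 1<p<2,\\ (\ln s)^2/s^4, & p=2,\\ 1/s^4, & p>2. \end{cases} $$ -/

import Mathlib

open MeasureTheory ProbabilityTheory Filter Topology Asymptotics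

noncomputable section

/-- The matrix `[[0, 1], [1, a * exp (i α)]]`. -/
def rayMatrix (α a : ℝ) : Matrix (Fin 2) (Fin 2) ℂ :=
  !![0, 1; 1, (a : ℂ) * Complex.exp (Complex.I * (α : ℂ))]

/-- The product `A₁ A₂ ⋯ Aₙ`, in this order; the sequence `a` is indexed from `0`, so that the
`k`-th factor is built from `a (k - 1)`. -/
def rayProduct (α : ℝ) (a : ℕ → ℝ) : ℕ → Matrix (Fin 2) (Fin 2) ℂ
  | 0 => 1
  | n + 1 => rayProduct α a n * rayMatrix α (a n)

/-- The operator norm of a matrix with respect to the Euclidean norm on `ℂ²`. -/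
def euclideanOpNorm (M : Matrix (Fin 2) (Fin 2) ℂ) : ℝ :=
  ‖Matrix.toEuclideanCLM (n := Fin 2) (𝕜 := ℂ) M‖

/-- The law of a sequence of independent random variables, each with the gamma density
`a ^ (p - 1) * exp (-a / s) / (s ^ p * Γ(p))` on `a ≥ 0`
(Mathlib's second parameter is the rate, that is, the inverse of the scale `s`). -/
def gammaSequenceLaw (p s : ℝ) : Measure (ℕ → ℝ) :=
  Measure.infinitePi fun _ : ℕ => gammaMeasure p s⁻¹

/-- `L` is the Lyapunov exponent `lim (1/n) ln |A₁ ⋯ Aₙ|` (almost sure limit) of the product of the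
random matrices `rayMatrix α aₙ`, where the `aₙ` are independent and gamma-distributed
with parameters `p` and `s`. -/
def IsLyapunovExponent (p s α L : ℝ) : Prop :=
  ∀ᵐ a ∂(gammaSequenceLaw p s),
    Tendsto (fun n : ℕ => (1 / (n : ℝ)) * Real.log (euclideanOpNorm (rayProduct α a n)))
      atTop (𝓝 L)

/-- There is at most one Lyapunov exponent. -/
theorem IsLyapunovExponent.unique {p s α L L' : ℝ} (hp : 0 < p) (hs : 0 < s)
    (h : IsLyapunovExponent p s α L) (h' : IsLyapunovExponent p s α L') : L = L' := by
  have : ∀ _ : ℕ, IsProbabilityMeasure (gammaMeasure p s⁻¹) := fun _ =>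
    isProbabilityMeasure_gammaMeasure hp (inv_pos.2 hs)
  have hP : IsProbabilityMeasure (gammaSequenceLaw p s) := by
    unfold gammaSequenceLaw; infer_instance
  obtain ⟨a, h1, h2⟩ := (Filter.Eventually.and h h').exists
  exact tendsto_nhds_unique h1 h2

/-- The digamma function `ψ = Γ' / Γ` at a real argument. -/
def realDigamma (p : ℝ) : ℝ := (Complex.digamma (p : ℂ)).re

/-- The order of the error when `p > 1`. -/
def errorOrder (p s : ℝ) : ℝ :=
  if p < 2 then Real.log s / s ^ (2 * p)
  else if p = 2 then (Real.log s) ^ 2 / s ^ 4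
  else 1 / s ^ 4

end

/-! The matrices are symmetric, so the transposed product applied to `(1, z)` drives the ratio of
coordinates by `Z ↦ a e^{iα} + 1/Z`, and the logarithm of the modulus of the first coordinate is `∑
log |Z_k|`. Suppose `H` on `Re z > 0` differs from `log (1 + |z|)` by a bounded amount and satisfies
the Poisson equation `E H(a e^{iα} + 1/z) = H(z) + λ - log |z|`. Then `log |x_n| + H(Z_n) - H(z) -
nλ`, with `x_n` the first coordinate, is a sum of centred increments with exponential moments. By
Chernoff and Borel–Cantelli it is `o(n)`, so `λ` is the Lyapunov exponent
(`isLyapunovExponent_of_poisson`).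

The solution comes from the case where everything is real. For `x > 0` the density `u^{p-1} e^{-x(u
+ 1/u)}` is preserved by `U ↦ Q + 1/U` with `Q` gamma of rate `x` (`lintegral_gamma_gig`), and
averaging `log (1 + zU)` against it solves the Poisson equation. With `Q = a r / x`, `a` of fixed
rate `r`, both sides are holomorphic in `x`, so the identity persists for complex `x`
(`integral_logInt_gammaMeasure`). Taking `r = 1/s` and `x = e^{-iα}/s` makes `a r / x = a e^{iα}`.
No invariant measure of the complex chain is needed, and `λ` is the real part of the logarithmic
derivative of `K_p(2x)` in the order `p`. Two further points are needed. For `α = ±π/2` the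
parameter lies on the imaginary axis, which is reached by rewriting the integrals along the rays `u
= 1 + r/x`, where they converge up to the boundary (`integral_logExt_gammaMeasure`). And one divides
by `K_p(2x)`, which is legitimate because `|K_p(2x)| ≥ K_p(2|x|)` (`norm_besselInt_norm_le`,
`besselExt_ne_zero`).

For the asymptotics, put `S_a = x^a · 2K_a(2x)` and let `L_a` be its derivative in `a`. At the
origin `S_a → Γ(a)` and `L_a → Γ'(a)` for `a > 0`, and both families satisfy `F_a' = -2x F_{a-1}`.
Hence `D_a = L_a - ψ(p) S_a` obeys the same relation and `D_p` vanishes at `0`, so an expansion of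
`D_{p-1}`, or of `D_{p-2}` when `p > 1`, integrates to one of `D_p`. Negative indices are reached
through `K_{-a} = K_a`. The remainder is the real part of `D_p / S_p` at `x = e^{-iα}/s`; the three
regimes correspond to the sign of `p - 1` (`scaledDiff_div_isBigO_of_lt_one`,
`scaledDiff_div_isBigO_one`, `scaledDiff_div_isBigO_of_one_lt`). -/

/-! ### Holomorphic functions on the right half plane -/

/-- The open right half plane. -/
def rightHalfPlane : Set ℂ := {x | 0 < x.re}

theorem mem_rightHalfPlane {x : ℂ} : x ∈ rightHalfPlane ↔ 0 < x.re := Iff.rfl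

theorem isOpen_rightHalfPlane : IsOpen rightHalfPlane :=
  isOpen_lt continuous_const Complex.continuous_re

theorem convex_rightHalfPlane : Convex ℝ rightHalfPlane :=
  convex_halfSpace_re_gt 0

/-- The identity theorem, with agreement tested on the points `1 + 1/(n+1)` accumulating at `1`.
Every passage from real to complex parameters below goes through this. -/
theorem eqOn_rightHalfPlane {f g : ℂ → ℂ} (hf : DifferentiableOn ℂ f rightHalfPlane)
    (hg : DifferentiableOn ℂ g rightHalfPlane) (h : ∀ x : ℝ, 0 < x → f x = g x) :
    Set.EqOn f g rightHalfPlane := by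
  have hmem : (1 : ℂ) ∈ rightHalfPlane := by simp [mem_rightHalfPlane]
  refine (hf.analyticOnNhd isOpen_rightHalfPlane).eqOn_of_preconnected_of_frequently_eq
    (hg.analyticOnNhd isOpen_rightHalfPlane) convex_rightHalfPlane.isPreconnected hmem ?_
  have hT : Tendsto (fun n : ℕ => ((1 + 1 / ((n : ℝ) + 1) : ℝ) : ℂ)) atTop (𝓝[≠] 1) := by
    refine tendsto_nhdsWithin_iff.2 ⟨?_, Eventually.of_forall fun n => ?_⟩
    · have := (tendsto_const_nhds (x := (1 : ℝ))).add (tendsto_one_div_add_atTop_nhds_zero_nat (𝕜 := ℝ))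
      rw [add_zero] at this
      exact (Complex.continuous_ofReal.tendsto 1).comp this
    · have : (0 : ℝ) < 1 / ((n : ℝ) + 1) := by positivity
      intro hc
      have := congrArg Complex.re hc
      simp only [Complex.ofReal_re, Complex.one_re] at this
      linarith
  exact hT.frequently (Eventually.of_forall fun n => h _ (by positivity)).frequently

/-- Only the integrand itself has to be dominated: Cauchy's estimate turns a local bound on `F` into
one on its derivative in `x`. -/
theorem differentiableOn_integral_of_locally_dominated {Y : Type*} [MeasurableSpace Y]
    {μ : Measure Y} {U : Set ℂ} (hU : IsOpen U) {F : ℂ → Y → ℂ}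
    (hF : ∀ᵐ y ∂μ, DifferentiableOn ℂ (fun x => F x y) U)
    (hm : ∀ x ∈ U, AEStronglyMeasurable (F x) μ)
    (hb : ∀ x₀ ∈ U, ∃ (ε : ℝ) (bound : Y → ℝ), 0 < ε ∧ Integrable bound μ ∧
      ∀ᵐ y ∂μ, ∀ x ∈ Metric.ball x₀ ε, ‖F x y‖ ≤ bound y) :
    DifferentiableOn ℂ (fun x => ∫ y, F x y ∂μ) U := by
  intro x₀ hx₀
  obtain ⟨ε, bound, hε, hbi, hbd⟩ := hb x₀ hx₀
  obtain ⟨ε', hε', hball⟩ := Metric.isOpen_iff.1 hU x₀ hx₀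
  set R : ℝ := min ε ε' / 2 with hR
  have hRpos : 0 < R := by positivity
  have hR1 : 2 * R ≤ ε := by rw [hR]; linarith [min_le_left ε ε']
  have hR2 : 2 * R ≤ ε' := by rw [hR]; linarith [min_le_right ε ε']
  have hsub : ∀ x ∈ Metric.ball x₀ R, Metric.closedBall x (R / 2) ⊆ Metric.ball x₀ (2 * R) := by
    intro x hx y hy
    rw [Metric.mem_ball] at *
    rw [Metric.mem_closedBall] at hy
    linarith [dist_triangle y x x₀]
  have hUx : ∀ x ∈ Metric.ball x₀ (2 * R), x ∈ U := fun x hx => hball (Metric.ball_subset_ball hR2 hx)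
  have key := hasDerivAt_integral_of_dominated_loc_of_deriv_le (μ := μ) (F := F) (x₀ := x₀)
    (s := Metric.ball x₀ R) (bound := fun y => bound y / (R / 2))
    (F' := fun x y => deriv (fun x => F x y) x)
    (Metric.ball_mem_nhds _ hRpos) ?_ ?_ ?_ ?_ ?_ ?_
  · exact key.2.differentiableAt.differentiableWithinAt
  · filter_upwards [hU.mem_nhds hx₀] with x hx using hm x hx
  · refine hbi.mono' (hm x₀ hx₀) ?_
    filter_upwards [hbd] with y hy using hy x₀ (Metric.mem_ball_self hε)
  -- The derivative at `x₀` is measurable in `y` as an almost everywhere limit of difference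
  -- quotients along a fixed sequence.
  · have hT : Tendsto (fun n : ℕ => x₀ + ((R * (1 / ((n : ℝ) + 1)) : ℝ) : ℂ)) atTop (𝓝[≠] x₀) := by
      refine tendsto_nhdsWithin_iff.2 ⟨?_, Eventually.of_forall fun n => ?_⟩
      · have := (tendsto_one_div_add_atTop_nhds_zero_nat (𝕜 := ℝ)).const_mul R
        rw [mul_zero] at this
        have := ((Complex.continuous_ofReal.tendsto 0).comp this).const_add x₀
        simpa using this
      · have : (0 : ℝ) < R * (1 / ((n : ℝ) + 1)) := by positivity
        intro hc
        have := congrArg Complex.re hc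
        simp only [Complex.add_re, Complex.ofReal_re] at this
        linarith
    refine aestronglyMeasurable_of_tendsto_ae (f := fun (n : ℕ) y => slope (fun x => F x y) x₀
        (x₀ + ((R * (1 / ((n : ℝ) + 1)) : ℝ) : ℂ))) atTop ?_ ?_
    · intro n
      simp only [slope_def_field, div_eq_mul_inv]
      refine ((hm _ (hUx _ ?_)).sub (hm _ hx₀)).mul_const _
      rw [Metric.mem_ball, dist_eq_norm, add_sub_cancel_left, ← div_eq_mul_inv, Complex.norm_real,
        Real.norm_of_nonneg (by positivity)]
      have : (1 : ℝ) / ((n : ℝ) + 1) ≤ 1 := by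
        rw [div_le_one (by positivity)]; linarith [n.cast_nonneg (α := ℝ)]
      have := mul_le_mul_of_nonneg_left this hRpos.le
      linarith
    · filter_upwards [hF] with y hy
      exact (hasDerivAt_iff_tendsto_slope.1
        (hy.differentiableAt (hU.mem_nhds hx₀)).hasDerivAt).comp hT
  -- Cauchy's estimate on the circle of radius `R / 2` about `x`, which stays inside the ball of
  -- radius `2R` about `x₀`.
  · filter_upwards [hF, hbd] with y hy hy' x hx
    refine Complex.norm_deriv_le_of_forall_mem_sphere_norm_le (by positivity) ?_ ?_
    · refine (DifferentiableOn.diffContOnCl ?_)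
      rw [closure_ball _ (by positivity)]
      exact hy.mono fun w hw => hUx _ (hsub x hx hw)
    · intro w hw
      exact hy' w (Metric.ball_subset_ball hR1 (hsub x hx (Metric.sphere_subset_closedBall hw)))
  · exact hbi.div_const _
  · filter_upwards [hF] with y hy x hx
    exact (hy.differentiableAt (hU.mem_nhds
      (hUx x (Metric.ball_subset_ball (by linarith) hx)))).hasDerivAt

/-! ### Integrals against `exp (-2 x cosh t)` -/

/-- Functions on the line of at most exponential growth. -/
def ExpBounded (f : ℝ → ℂ) : Prop := ∃ C c : ℝ, ∀ t, ‖f t‖ ≤ C * Real.exp (c * |t|)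

theorem ExpBounded.mul {f g : ℝ → ℂ} (hf : ExpBounded f) (hg : ExpBounded g) :
    ExpBounded fun t => f t * g t := by
  obtain ⟨C, c, h⟩ := hf
  obtain ⟨D, d, h'⟩ := hg
  refine ⟨C * D, c + d, fun t => ?_⟩
  calc ‖f t * g t‖ = ‖f t‖ * ‖g t‖ := norm_mul _ _
    _ ≤ (C * Real.exp (c * |t|)) * (D * Real.exp (d * |t|)) :=
        mul_le_mul (h t) (h' t) (norm_nonneg _) ((norm_nonneg _).trans (h t))
    _ = _ := by rw [add_mul, Real.exp_add]; ring

theorem ExpBounded.add {f g : ℝ → ℂ} (hf : ExpBounded f) (hg : ExpBounded g) :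
    ExpBounded fun t => f t + g t := by
  obtain ⟨C, c, h⟩ := hf
  obtain ⟨D, d, h'⟩ := hg
  have hC : 0 ≤ C := by simpa using (norm_nonneg _).trans (h 0)
  have hD : 0 ≤ D := by simpa using (norm_nonneg _).trans (h' 0)
  refine ⟨C + D, max c d, fun t => (norm_add_le _ _).trans ?_⟩
  rw [add_mul]
  refine add_le_add ((h t).trans ?_) ((h' t).trans ?_)
  · gcongr; exact le_max_left _ _
  · gcongr; exact le_max_right _ _

theorem expBounded_const (a : ℂ) : ExpBounded fun _ => a :=
  ⟨‖a‖, 0, fun t => by simp⟩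

theorem expBounded_exp (a : ℝ) : ExpBounded fun t => Complex.exp (a * t) := by
  refine ⟨1, |a|, fun t => ?_⟩
  rw [Complex.norm_exp, one_mul]
  gcongr
  rw [← Complex.ofReal_mul, Complex.ofReal_re, ← abs_mul]
  exact le_abs_self _

theorem expBounded_ofReal : ExpBounded fun t => (t : ℂ) := by
  refine ⟨1, 1, fun t => ?_⟩
  rw [Complex.norm_real, one_mul, one_mul, Real.norm_eq_abs]
  linarith [Real.add_one_le_exp |t|]

theorem expBounded_cosh : ExpBounded fun t => Complex.cosh t := by
  have h := ((expBounded_exp 1).add (expBounded_exp (-1))).mul (expBounded_const (1 / 2))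
  refine h.imp fun C h => h.imp fun c h t => ?_
  convert h t using 2
  simp [Complex.cosh]; ring

theorem expBounded_sinh : ExpBounded fun t => Complex.sinh t := by
  have h := ((expBounded_exp 1).add ((expBounded_const (-1)).mul (expBounded_exp (-1)))).mul
    (expBounded_const (1 / 2))
  refine h.imp fun C h => h.imp fun c h t => ?_
  convert h t using 2
  simp [Complex.sinh]; ring

theorem Real.one_add_sq_div_two_le_cosh (t : ℝ) : 1 + t ^ 2 / 2 ≤ Real.cosh t := by
  have h : ∀ t : ℝ, 0 ≤ t → 1 + t ^ 2 / 2 ≤ Real.cosh t := by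
    intro t ht
    have h1 := Real.cosh_two_mul (t / 2)
    have h2 : t / 2 ≤ Real.sinh (t / 2) := Real.self_le_sinh_iff.2 (by linarith)
    have h3 := Real.cosh_sq (t / 2)
    rw [show 2 * (t / 2) = t by ring] at h1
    nlinarith [sq_nonneg (Real.sinh (t / 2) - t / 2)]
  rcases le_total 0 t with ht | ht
  · exact h t ht
  · simpa using h (-t) (by linarith)

theorem norm_exp_neg_two_mul_cosh (x : ℂ) (t : ℝ) :
    ‖Complex.exp (-2 * x * Complex.cosh t)‖ = Real.exp (-2 * x.re * Real.cosh t) := by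
  rw [Complex.norm_exp, ← Complex.ofReal_cosh, Complex.re_mul_ofReal]
  simp

/-- Since `cosh t ≥ 1 + t²/2`, the integrand lies below a Gaussian times an exponential. -/
theorem integrable_exp_mul_abs_sub_cosh (c : ℝ) {ξ : ℝ} (hξ : 0 < ξ) :
    Integrable fun t : ℝ => Real.exp (c * |t|) * Real.exp (-2 * ξ * Real.cosh t) := by
  have h : ∀ d : ℝ, Integrable fun t : ℝ => Real.exp (-ξ * t ^ 2 + d * t) := by
    intro d
    have := (integrable_cexp_quadratic (b := ξ) (by simpa using hξ) d 0).re
    refine this.congr (Eventually.of_forall fun t => ?_)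
    have : (-(ξ : ℂ) * (t : ℂ) ^ 2 + d * t + 0) = ((-ξ * t ^ 2 + d * t : ℝ) : ℂ) := by
      push_cast; ring
    change (Complex.exp (-(ξ : ℂ) * (t : ℂ) ^ 2 + d * t + 0)).re = _
    rw [this, Complex.exp_ofReal_re]
  refine ((h c).add (h (-c))).mono' (by fun_prop) (Eventually.of_forall fun t => ?_)
  rw [Real.norm_of_nonneg (by positivity), ← Real.exp_add]
  have h1 := Real.one_add_sq_div_two_le_cosh t
  have h2 : c * |t| + -2 * ξ * Real.cosh t ≤ -ξ * t ^ 2 + c * |t| := by nlinarith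
  refine (Real.exp_le_exp.2 h2).trans ?_
  rcases abs_cases t with ⟨h, -⟩ | ⟨h, -⟩ <;> rw [h]
  · exact le_add_of_nonneg_right (by positivity)
  · simp only [Pi.add_apply]
    rw [show c * -t = -c * t by ring]
    exact le_add_of_nonneg_left (by positivity)

theorem ExpBounded.integrable {f : ℝ → ℂ} (hf : ExpBounded f) (hm : AEStronglyMeasurable f volume)
    {x : ℂ} (hx : 0 < x.re) :
    Integrable fun t : ℝ => f t * Complex.exp (-2 * x * Complex.cosh t) := by
  obtain ⟨C, c, h⟩ := hf
  refine ((integrable_exp_mul_abs_sub_cosh c hx).const_mul C).mono'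
    (hm.mul (by fun_prop)) (Eventually.of_forall fun t => ?_)
  rw [norm_mul, norm_exp_neg_two_mul_cosh, ← mul_assoc]
  exact mul_le_mul_of_nonneg_right (h t) (Real.exp_pos _).le

/-- The integral of `f t * exp (-2 x cosh t)` over the line. -/
noncomputable def coshLaplace (f : ℝ → ℂ) (x : ℂ) : ℂ :=
  ∫ t : ℝ, f t * Complex.exp (-2 * x * Complex.cosh t)

theorem hasDerivAt_coshLaplace {f : ℝ → ℂ} (hf : ExpBounded f)
    (hm : AEStronglyMeasurable f volume) {x : ℂ} (hx : 0 < x.re) :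
    HasDerivAt (coshLaplace f) (coshLaplace (fun t => -2 * Complex.cosh t * f t) x) x := by
  obtain ⟨C, c, h⟩ := ((expBounded_const (-2)).mul expBounded_cosh).mul hf
  refine (hasDerivAt_integral_of_dominated_loc_of_deriv_le (μ := volume)
    (F := fun x t => f t * Complex.exp (-2 * x * Complex.cosh t))
    (F' := fun x t => -2 * Complex.cosh t * f t * Complex.exp (-2 * x * Complex.cosh t))
    (bound := fun t => C * (Real.exp (c * |t|) * Real.exp (-2 * (x.re / 2) * Real.cosh t)))
    (s := {y | x.re / 2 < y.re}) ?_ ?_ ?_ ?_ ?_ ?_ ?_).2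
  · exact (isOpen_lt continuous_const Complex.continuous_re).mem_nhds (by simp; linarith)
  · exact Eventually.of_forall fun y => hm.mul (by fun_prop)
  · exact hf.integrable hm hx
  · exact ((by fun_prop : AEStronglyMeasurable (fun t : ℝ => -2 * Complex.cosh t) volume).mul hm).mul
      (by fun_prop)
  · refine Eventually.of_forall fun t y hy => ?_
    simp only [Set.mem_ofPred_eq] at hy
    rw [norm_mul, norm_exp_neg_two_mul_cosh, ← mul_assoc]
    refine mul_le_mul (h t) (Real.exp_le_exp.2 ?_) (Real.exp_pos _).le ((norm_nonneg _).trans (h t))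
    nlinarith [Real.one_le_cosh t]
  · exact (integrable_exp_mul_abs_sub_cosh c (by linarith)).const_mul C
  · refine Eventually.of_forall fun t y hy => ?_
    have h1 : HasDerivAt (fun y : ℂ => -2 * y * Complex.cosh t) (-2 * Complex.cosh t) y := by
      simpa using ((hasDerivAt_id y).const_mul (-2 : ℂ)).mul_const (Complex.cosh t)
    refine (h1.cexp.const_mul (f t)).congr_deriv ?_
    ring

theorem differentiableOn_coshLaplace {f : ℝ → ℂ} (hf : ExpBounded f)
    (hm : AEStronglyMeasurable f volume) :
    DifferentiableOn ℂ (coshLaplace f) rightHalfPlane := fun _ hx =>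
  (hasDerivAt_coshLaplace hf hm hx).differentiableAt.differentiableWithinAt

/-- Integration by parts. -/
theorem coshLaplace_deriv {f f' : ℝ → ℂ} (hf : ExpBounded f) (hf' : ExpBounded f')
    (hd : ∀ t, HasDerivAt f (f' t) t) (hm' : AEStronglyMeasurable f' volume) {x : ℂ}
    (hx : 0 < x.re) :
    coshLaplace f' x = coshLaplace (fun t => 2 * x * Complex.sinh t * f t) x := by
  have hm : AEStronglyMeasurable f volume :=
    (continuous_iff_continuousAt.2 fun t => (hd t).continuousAt).aestronglyMeasurable
  have hm2 : AEStronglyMeasurable (fun t : ℝ => 2 * x * Complex.sinh t * f t) volume :=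
    (by fun_prop : AEStronglyMeasurable (fun t : ℝ => 2 * x * Complex.sinh t) volume).mul hm
  have hb2 : ExpBounded (fun t : ℝ => 2 * x * Complex.sinh t * f t) :=
    ((expBounded_const (2 * x)).mul expBounded_sinh).mul hf
  have i1 := hf'.integrable hm' hx
  have i2 := hb2.integrable hm2 hx
  have h0 := integral_eq_zero_of_hasDerivAt_of_integrable
    (f := fun t : ℝ => f t * Complex.exp (-2 * x * Complex.cosh t))
    (f' := fun t : ℝ => f' t * Complex.exp (-2 * x * Complex.cosh t) -
      2 * x * Complex.sinh t * f t * Complex.exp (-2 * x * Complex.cosh t)) ?_ (i1.sub i2)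
    (hf.integrable hm hx)
  · rw [integral_sub i1 i2] at h0
    exact sub_eq_zero.1 h0
  · intro t
    have h1 : HasDerivAt (fun t : ℝ => -2 * x * Complex.cosh t) (-2 * x * Complex.sinh t) t :=
      ((Complex.hasDerivAt_cosh t).comp_ofReal).const_mul _
    refine ((hd t).mul h1.cexp).congr_deriv ?_
    ring

theorem coshLaplace_add {f g : ℝ → ℂ} (hf : ExpBounded f) (hg : ExpBounded g)
    (hmf : AEStronglyMeasurable f volume) (hmg : AEStronglyMeasurable g volume) {x : ℂ}
    (hx : 0 < x.re) :
    coshLaplace (fun t => f t + g t) x = coshLaplace f x + coshLaplace g x := by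
  unfold coshLaplace
  rw [← integral_add (hf.integrable hmf hx) (hg.integrable hmg hx)]
  simp only [add_mul]

theorem coshLaplace_const_mul (a : ℂ) (f : ℝ → ℂ) (x : ℂ) :
    coshLaplace (fun t => a * f t) x = a * coshLaplace f x := by
  unfold coshLaplace
  rw [← integral_const_mul]
  simp only [mul_assoc]

theorem coshLaplace_comp_neg (f : ℝ → ℂ) (x : ℂ) :
    coshLaplace (fun t => f (-t)) x = coshLaplace f x := by
  unfold coshLaplace
  rw [← integral_neg_eq_self]
  simp

/-! ### Integrals along rays -/

/-- The integrand of `rayIntegral`. -/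
noncomputable def rayIntegrand (φ : ℂ → ℂ) (x : ℂ) (r : ℝ) : ℂ :=
  x⁻¹ * φ (1 + r / x) * Complex.exp (-x - r - x / (1 + r / x))

/-- The integral of `φ u * exp (-x (u + u⁻¹))` along the ray `u = 1 + r / x`, `r > 0`. -/
noncomputable def rayIntegral (φ : ℂ → ℂ) (x : ℂ) : ℂ :=
  ∫ r in Set.Ioi (0 : ℝ), rayIntegrand φ x r

theorem one_le_re_one_add_div {x : ℂ} (hx : 0 ≤ x.re) {r : ℝ} (hr : 0 ≤ r) :
    1 ≤ (1 + (r : ℂ) / x).re := by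
  have : 0 ≤ ((r : ℂ) / x).re := by
    rw [div_eq_mul_inv, Complex.re_ofReal_mul, Complex.inv_re]
    have := Complex.normSq_nonneg x
    positivity
  simpa using this

theorem norm_one_add_div_le (x : ℂ) {r : ℝ} (hr : 0 ≤ r) :
    ‖1 + (r : ℂ) / x‖ ≤ 1 + r / ‖x‖ := by
  refine (norm_add_le _ _).trans ?_
  rw [norm_one, norm_div, Complex.norm_real, Real.norm_of_nonneg hr]

theorem one_le_norm_of_one_le_re {u : ℂ} (hu : 1 ≤ u.re) : 1 ≤ ‖u‖ :=
  hu.trans ((le_abs_self _).trans (Complex.abs_re_le_norm u))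

/-- The point `u = 1 + r/x` satisfies `|u| ≥ 1`, so `x/u` costs at most `|x|` and the decay `e^{-r}`
survives. It does so on the imaginary axis too, where `exp (-2 x cosh t)` no longer decays; this is
the reason for using rays. -/
theorem norm_exp_ray_le {x : ℂ} (hx : 0 ≤ x.re) {r : ℝ} (hr : 0 ≤ r) :
    ‖Complex.exp (-x - r - x / (1 + r / x))‖ ≤ Real.exp (‖x‖ - r) := by
  rw [Complex.norm_exp]
  refine Real.exp_le_exp.2 ?_
  have h1 := one_le_norm_of_one_le_re (one_le_re_one_add_div hx hr)
  have h2 : ‖x / (1 + r / x)‖ ≤ ‖x‖ := by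
    rw [norm_div]
    exact div_le_self (norm_nonneg _) h1
  have h3 := (abs_le.1 ((Complex.abs_re_le_norm _).trans h2)).1
  simp only [Complex.sub_re, Complex.neg_re, Complex.ofReal_re]
  linarith

theorem norm_rayIntegrand_le {φ : ℂ → ℂ} {C : ℝ} {N : ℕ}
    (hφ : ∀ u : ℂ, 1 ≤ u.re → ‖φ u‖ ≤ C * ‖u‖ ^ N) {x : ℂ} (hx : 0 ≤ x.re) {r : ℝ} (hr : 0 ≤ r) :
    ‖rayIntegrand φ x r‖ ≤ C * (‖x‖⁻¹ * (1 + r / ‖x‖) ^ N * Real.exp (‖x‖ - r)) := by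
  have hC : 0 ≤ C := by simpa using (norm_nonneg _).trans (hφ 1 (by simp))
  have h1 := hφ _ (one_le_re_one_add_div hx hr)
  have h2 := pow_le_pow_left₀ (norm_nonneg _) (norm_one_add_div_le x hr) N
  rw [rayIntegrand, norm_mul, norm_mul, norm_inv]
  calc ‖x‖⁻¹ * ‖φ (1 + r / x)‖ * ‖Complex.exp (-x - r - x / (1 + r / x))‖
      ≤ ‖x‖⁻¹ * (C * (1 + r / ‖x‖) ^ N) * Real.exp (‖x‖ - r) := by
        gcongr
        · exact h1.trans (mul_le_mul_of_nonneg_left h2 hC)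
        · exact norm_exp_ray_le hx hr
    _ = _ := by ring

/-- Half of the exponential decay pays for the polynomial: `y^N / N! ≤ e^y` is used at `y = (c/2)(1
+ r/c) = c/2 + r/2`. -/
theorem integrableOn_one_add_mul_pow_mul_exp {c : ℝ} (hc : 0 < c) (N : ℕ) :
    IntegrableOn (fun r : ℝ => (1 + r / c) ^ N * Real.exp (-r)) (Set.Ioi 0) := by
  have h := (integrableOn_exp_mul_Ioi (a := -(1 / 2 : ℝ)) (by norm_num) 0).const_mul
    (N.factorial * (c / 2)⁻¹ ^ N * Real.exp (c / 2))
  refine h.mono' (by fun_prop) ?_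
  filter_upwards [ae_restrict_mem measurableSet_Ioi] with r hr
  have hr : 0 < r := hr
  rw [Real.norm_of_nonneg (by positivity)]
  have h1 := Real.pow_div_factorial_le_exp (x := c / 2 * (1 + r / c)) (by positivity) N
  have h2 : (1 + r / c) ^ N = (c / 2 * (1 + r / c)) ^ N / N.factorial *
      (N.factorial * (c / 2)⁻¹ ^ N) := by
    have h3 : (c / 2) ^ N * (c / 2)⁻¹ ^ N = 1 := by
      rw [← mul_pow, mul_inv_cancel₀ (by positivity), one_pow]
    have h4 : (N.factorial : ℝ) ≠ 0 := by positivity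
    rw [mul_pow, div_mul_eq_mul_div, eq_div_iff h4]
    linear_combination (-(1 + r / c) ^ N * N.factorial) * h3
  rw [h2]
  calc _ ≤ Real.exp (c / 2 * (1 + r / c)) * (N.factorial * (c / 2)⁻¹ ^ N) * Real.exp (-r) := by
        gcongr
    _ = (N.factorial * (c / 2)⁻¹ ^ N) * (Real.exp (c / 2 * (1 + r / c)) * Real.exp (-r)) := by ring
    _ = (N.factorial * (c / 2)⁻¹ ^ N) * (Real.exp (c / 2) * Real.exp (-(1 / 2) * r)) := by
        rw [← Real.exp_add, ← Real.exp_add]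
        congr 2
        field_simp
        ring
    _ = _ := by ring

theorem continuousOn_rayIntegrand {φ : ℂ → ℂ} (hφ : ContinuousOn φ {u | 1 ≤ u.re}) {x : ℂ}
    (hx : 0 ≤ x.re) : ContinuousOn (rayIntegrand φ x) (Set.Ioi 0) := by
  have h1 : ContinuousOn (fun r : ℝ => φ (1 + r / x)) (Set.Ioi 0) :=
    hφ.comp (by fun_prop) fun r hr => one_le_re_one_add_div hx (le_of_lt hr)
  have h2 : ContinuousOn (fun r : ℝ => x / (1 + r / x)) (Set.Ioi 0) := by
    refine ContinuousOn.div (by fun_prop) (by fun_prop) fun r hr => ?_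
    have := one_le_norm_of_one_le_re (one_le_re_one_add_div hx (le_of_lt hr))
    exact norm_pos_iff.1 (by linarith)
  unfold rayIntegrand
  exact (continuousOn_const.mul h1).mul (ContinuousOn.cexp (ContinuousOn.sub (by fun_prop) h2))

theorem aestronglyMeasurable_rayIntegrand {φ : ℂ → ℂ} (hφ : ContinuousOn φ {u | 1 ≤ u.re}) {x : ℂ}
    (hx : 0 ≤ x.re) : AEStronglyMeasurable (rayIntegrand φ x) (volume.restrict (Set.Ioi 0)) :=
  (continuousOn_rayIntegrand hφ hx).aestronglyMeasurable measurableSet_Ioi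

theorem integrableOn_ray_bound {x : ℂ} (hx : x ≠ 0) (N : ℕ) :
    IntegrableOn (fun r : ℝ => ‖x‖⁻¹ * (1 + r / ‖x‖) ^ N * Real.exp (‖x‖ - r)) (Set.Ioi 0) := by
  refine ((integrableOn_one_add_mul_pow_mul_exp (norm_pos_iff.2 hx) N).const_mul
    (‖x‖⁻¹ * Real.exp ‖x‖)).congr (Eventually.of_forall fun r => ?_)
  simp only [sub_eq_add_neg, Real.exp_add]
  ring

theorem integrableOn_rayIntegrand {φ : ℂ → ℂ} (hc : ContinuousOn φ {u | 1 ≤ u.re}) {C : ℝ} {N : ℕ}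
    (hφ : ∀ u : ℂ, 1 ≤ u.re → ‖φ u‖ ≤ C * ‖u‖ ^ N) {x : ℂ} (hx : 0 ≤ x.re) (hx0 : x ≠ 0) :
    IntegrableOn (rayIntegrand φ x) (Set.Ioi 0) := by
  refine ((integrableOn_ray_bound hx0 N).const_mul C).mono'
    (aestronglyMeasurable_rayIntegrand hc hx) ?_
  filter_upwards [ae_restrict_mem measurableSet_Ioi] with r hr
  exact norm_rayIntegrand_le hφ hx (le_of_lt hr)

/-- The integral of the weight that dominates the integrand of `rayIntegral`. -/
noncomputable def rayWeight (x : ℂ) (N : ℕ) : ℝ :=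
  ∫ r in Set.Ioi (0 : ℝ), ‖x‖⁻¹ * (1 + r / ‖x‖) ^ N * Real.exp (‖x‖ - r)

theorem norm_rayIntegral_le {φ : ℂ → ℂ} {C : ℝ} {N : ℕ}
    (hφ : ∀ u : ℂ, 1 ≤ u.re → ‖φ u‖ ≤ C * ‖u‖ ^ N) {x : ℂ} (hx : 0 ≤ x.re) (hx0 : x ≠ 0) :
    ‖rayIntegral φ x‖ ≤ C * rayWeight x N := by
  rw [rayWeight, ← integral_const_mul]
  refine norm_integral_le_of_norm_le ((integrableOn_ray_bound hx0 N).const_mul C) ?_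
  filter_upwards [ae_restrict_mem measurableSet_Ioi] with r hr
  exact norm_rayIntegrand_le hφ hx (le_of_lt hr)

theorem ray_bound_mono {m M y C r : ℝ} {N : ℕ} (hC : 0 ≤ C) (hr : 0 ≤ r) (hm : 0 < m) (h1 : m ≤ y)
    (h2 : y ≤ M) : C * (y⁻¹ * (1 + r / y) ^ N * Real.exp (y - r)) ≤
      C * (m⁻¹ * Real.exp M) * ((1 + r / m) ^ N * Real.exp (-r)) := by
  have hy : 0 < y := hm.trans_le h1
  calc C * (y⁻¹ * (1 + r / y) ^ N * Real.exp (y - r))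
      ≤ C * (m⁻¹ * (1 + r / m) ^ N * Real.exp (M - r)) := by gcongr
    _ = _ := by rw [sub_eq_add_neg, Real.exp_add]; ring

/-- Dominated convergence, the majorant being uniform while `‖x‖` stays between `‖x₀‖ / 2` and `2
‖x₀‖`. The function `φ` may move as well, because `logRay` carries the variable `z`. -/
theorem tendsto_rayIntegral {ι : Type*} {l : Filter ι} [l.IsCountablyGenerated] {φ : ι → ℂ → ℂ}
    {x : ι → ℂ} {φ₀ : ℂ → ℂ} {x₀ : ℂ} {C : ℝ} {N : ℕ} (hx : Tendsto x l (𝓝 x₀)) (hx₀ : x₀ ≠ 0)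
    (hre : ∀ᶠ i in l, 0 ≤ (x i).re)
    (hφ : ∀ᶠ i in l, ∀ u : ℂ, 1 ≤ u.re → ‖φ i u‖ ≤ C * ‖u‖ ^ N)
    (hc : ∀ᶠ i in l, ContinuousOn (φ i) {u | 1 ≤ u.re}) (hre₀ : 0 ≤ x₀.re)
    (hlim : ∀ r : ℝ, 0 < r → Tendsto (fun i => φ i (1 + r / x i)) l (𝓝 (φ₀ (1 + r / x₀)))) :
    Tendsto (fun i => rayIntegral (φ i) (x i)) l (𝓝 (rayIntegral φ₀ x₀)) := by
  have hn : 0 < ‖x₀‖ := norm_pos_iff.2 hx₀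
  have hnt := hx.norm
  have h1 : ∀ᶠ i in l, ‖x₀‖ / 2 ≤ ‖x i‖ := hnt.eventually (eventually_ge_nhds (by linarith))
  have h2 : ∀ᶠ i in l, ‖x i‖ ≤ 2 * ‖x₀‖ := hnt.eventually (eventually_le_nhds (by linarith))
  refine tendsto_integral_filter_of_dominated_convergence
    (fun r => C * ((‖x₀‖ / 2)⁻¹ * Real.exp (2 * ‖x₀‖)) *
      ((1 + r / (‖x₀‖ / 2)) ^ N * Real.exp (-r))) ?_ ?_ ?_ ?_
  · filter_upwards [hre, hc] with i hi hci using aestronglyMeasurable_rayIntegrand hci hi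
  · filter_upwards [hre, hφ, h1, h2] with i hi hφi h1 h2
    filter_upwards [ae_restrict_mem measurableSet_Ioi] with r hr
    have hC : 0 ≤ C := by simpa using (norm_nonneg _).trans (hφi 1 (by simp))
    exact (norm_rayIntegrand_le hφi hi (le_of_lt hr)).trans
      (ray_bound_mono hC (le_of_lt hr) (by linarith) h1 h2)
  · exact (integrableOn_one_add_mul_pow_mul_exp (by linarith) N).const_mul _
  · filter_upwards [ae_restrict_mem measurableSet_Ioi] with r hr
    have hr : 0 < r := hr
    have hw : 1 + (r : ℂ) / x₀ ≠ 0 := by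
      have := one_le_norm_of_one_le_re (one_le_re_one_add_div hre₀ hr.le)
      exact norm_pos_iff.1 (by linarith)
    have h3 : Tendsto (fun i => 1 + (r : ℂ) / x i) l (𝓝 (1 + (r : ℂ) / x₀)) :=
      tendsto_const_nhds.add (tendsto_const_nhds.div hx hx₀)
    unfold rayIntegrand
    exact ((hx.inv₀ hx₀).mul (hlim r hr)).mul
      ((Complex.continuous_exp.tendsto _).comp (((hx.neg).sub tendsto_const_nhds).sub (hx.div h3 hw)))

theorem differentiableOn_rayIntegral {φ : ℂ → ℂ} (hd : DifferentiableOn ℂ φ rightHalfPlane)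
    {C : ℝ} {N : ℕ} (hφ : ∀ u : ℂ, 1 ≤ u.re → ‖φ u‖ ≤ C * ‖u‖ ^ N) :
    DifferentiableOn ℂ (rayIntegral φ) rightHalfPlane := by
  have hC : 0 ≤ C := by simpa using (norm_nonneg _).trans (hφ 1 (by simp))
  have hmem : ∀ u : ℂ, 1 ≤ u.re → u ∈ rightHalfPlane := fun u hu => by
    rw [mem_rightHalfPlane]; linarith
  have hne : ∀ x ∈ rightHalfPlane, x ≠ 0 := by
    rintro x hx rfl
    simp [mem_rightHalfPlane] at hx
  refine differentiableOn_integral_of_locally_dominated isOpen_rightHalfPlane ?_ ?_ ?_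
  · filter_upwards [ae_restrict_mem measurableSet_Ioi] with r hr
    have hr : 0 < r := hr
    have h1 : DifferentiableOn ℂ (fun x : ℂ => 1 + (r : ℂ) / x) rightHalfPlane :=
      (differentiableOn_const _).add ((differentiableOn_const _).div differentiableOn_id hne)
    have h2 : ∀ x ∈ rightHalfPlane, 1 ≤ (1 + (r : ℂ) / x).re := fun x hx =>
      one_le_re_one_add_div (le_of_lt hx) hr.le
    unfold rayIntegrand
    refine ((differentiableOn_inv.mono fun x hx => ?_).mul
      (hd.comp h1 fun x hx => hmem _ (h2 x hx))).mul (DifferentiableOn.cexp ?_)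
    · exact hne x hx
    · refine DifferentiableOn.sub (by fun_prop) (differentiableOn_id.div h1 fun x hx => ?_)
      intro h0
      have := h2 x hx
      simp [h0] at this
      linarith
  · exact fun x hx => aestronglyMeasurable_rayIntegrand
      (hd.continuousOn.mono fun u hu => hmem u hu) (le_of_lt hx)
  · intro x₀ hx₀
    have hx₀' : 0 < x₀.re := hx₀
    have hle : x₀.re ≤ ‖x₀‖ := (le_abs_self _).trans (Complex.abs_re_le_norm _)
    refine ⟨x₀.re / 2, fun r => C * ((x₀.re / 2)⁻¹ * Real.exp (2 * ‖x₀‖)) *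
      ((1 + r / (x₀.re / 2)) ^ N * Real.exp (-r)), by linarith,
      (integrableOn_one_add_mul_pow_mul_exp (by linarith) N).const_mul _, ?_⟩
    filter_upwards [ae_restrict_mem measurableSet_Ioi] with r hr x hx
    rw [mem_ball_iff_norm] at hx
    have h1 : x₀.re - x.re ≤ ‖x - x₀‖ := by
      have := (abs_le.1 (Complex.abs_re_le_norm (x - x₀))).1
      simp at this
      linarith
    have h2 : ‖x‖ ≤ ‖x - x₀‖ + ‖x₀‖ := by simpa using norm_add_le (x - x₀) x₀
    have h3 : x.re ≤ ‖x‖ := (le_abs_self _).trans (Complex.abs_re_le_norm _)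
    exact (norm_rayIntegrand_le hφ (by linarith) (le_of_lt hr)).trans
      (ray_bound_mono hC (le_of_lt hr) (by linarith) (by linarith) (by linarith))

/-- For real `x` the ray is the half line `u > 1`; the substitution is `r = x (e^t - 1)`, that is `u
= e^t`. -/
theorem rayIntegral_ofReal (φ : ℂ → ℂ) {x : ℝ} (hx : 0 < x) :
    rayIntegral φ x = ∫ t in Set.Ioi (0 : ℝ),
      Complex.exp t * φ (Complex.exp t) * Complex.exp (-2 * x * Complex.cosh t) := by
  have himg : (fun t : ℝ => x * (Real.exp t - 1)) '' Set.Ioi 0 = Set.Ioi 0 := by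
    ext r
    simp only [Set.mem_image, Set.mem_Ioi]
    constructor
    · rintro ⟨t, ht, rfl⟩
      have := Real.add_one_lt_exp ht.ne'
      exact mul_pos hx (by linarith)
    · intro hr
      refine ⟨Real.log (1 + r / x), Real.log_pos ?_, ?_⟩
      · have : 0 < r / x := by positivity
        linarith
      · rw [Real.exp_log (by positivity)]
        field_simp
        ring
  have key := integral_image_eq_integral_abs_deriv_smul (measurableSet_Ioi (a := (0 : ℝ)))
    (f := fun t => x * (Real.exp t - 1)) (f' := fun t => x * Real.exp t) ?_ ?_
    (rayIntegrand φ x)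
  · rw [himg] at key
    rw [rayIntegral, key]
    refine setIntegral_congr_fun (measurableSet_Ioi (a := (0 : ℝ))) fun t _ => ?_
    have hx' : (x : ℂ) ≠ 0 := by exact_mod_cast hx.ne'
    have h1 : 1 + ((x * (Real.exp t - 1) : ℝ) : ℂ) / x = Complex.exp t := by
      push_cast
      field_simp
      ring
    simp only [rayIntegrand]
    rw [h1, abs_of_pos (by positivity), Complex.real_smul]
    push_cast
    have h2 : -(x : ℂ) - x * (Complex.exp t - 1) - x / Complex.exp t = -2 * x * Complex.cosh t := by
      rw [Complex.cosh, Complex.exp_neg]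
      ring
    rw [h2]
    field_simp
  · intro t _
    exact (((Real.hasDerivAt_exp t).sub_const 1).const_mul x).hasDerivWithinAt
  · intro t _ t' _ h
    simpa [hx.ne'] using h

/-- Fold the line onto `t > 0` and substitute `u = e^t`: this settles real `x`. Both sides are
holomorphic, so the identity theorem replaces a contour deformation. -/
theorem coshLaplace_eq_rayIntegral {f : ℝ → ℂ} (hf : ExpBounded f)
    (hm : AEStronglyMeasurable f volume) {φ : ℂ → ℂ} (hd : DifferentiableOn ℂ φ rightHalfPlane)
    {C : ℝ} {N : ℕ} (hφ : ∀ u : ℂ, 1 ≤ u.re → ‖φ u‖ ≤ C * ‖u‖ ^ N)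
    (h : ∀ t : ℝ, 0 < t → f t + f (-t) = Complex.exp t * φ (Complex.exp t)) {x : ℂ}
    (hx : 0 < x.re) : coshLaplace f x = rayIntegral φ x := by
  refine eqOn_rightHalfPlane (differentiableOn_coshLaplace hf hm)
    (differentiableOn_rayIntegral hd hφ) (fun x hx => ?_) hx
  have hi := hf.integrable hm (x := x) (by simpa using hx)
  have e1 : ∫ t in Set.Iic (0 : ℝ), f t * Complex.exp (-2 * x * Complex.cosh t) =
      ∫ t in Set.Ioi (0 : ℝ), f (-t) * Complex.exp (-2 * x * Complex.cosh t) := by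
    have := integral_comp_neg_Ioi (0 : ℝ) fun t : ℝ => f t * Complex.exp (-2 * x * Complex.cosh t)
    simpa using this.symm
  have i2 : IntegrableOn (fun t : ℝ => f (-t) * Complex.exp (-2 * x * Complex.cosh t))
      (Set.Ioi 0) := by
    have := hi.comp_neg
    simp only [Complex.ofReal_neg, Complex.cosh_neg] at this
    exact this.integrableOn
  rw [rayIntegral_ofReal φ hx, coshLaplace,
    ← integral_add_compl (measurableSet_Ioi (a := (0 : ℝ))) hi, Set.compl_Ioi, e1,
    ← integral_add hi.integrableOn i2]
  refine setIntegral_congr_fun measurableSet_Ioi fun t ht => ?_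
  rw [← h t ht]
  ring

/-! ### Bessel integrals -/

/-- Twice the modified Bessel function of the second kind of order `a` at `2 x`. -/
noncomputable def besselInt (a : ℝ) : ℂ → ℂ := coshLaplace fun t => Complex.exp (a * t)

/-- The derivative of `besselInt` with respect to the order. -/
noncomputable def besselLogInt (a : ℝ) : ℂ → ℂ := coshLaplace fun t => t * Complex.exp (a * t)

/-- For `w > 0` a translation by `log w` shows that `∫ exp (-|c| (w e^t + w⁻¹ e^{-t})) dt` does not
depend on `w`. By holomorphy it is constant on the half plane, and `w = c / |c|` has inverse `conj c
/ |c|`. -/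
theorem integral_exp_neg_mul_add_conj {c : ℂ} (hc : 0 < c.re) :
    ∫ t : ℝ, Complex.exp (-(c * Complex.exp t + (starRingEnd ℂ) c * Complex.exp (-t))) =
      besselInt 0 ‖c‖ := by
  have hc0 : c ≠ 0 := by rintro rfl; simp at hc
  have hn : 0 < ‖c‖ := norm_pos_iff.2 hc0
  have hnC : (‖c‖ : ℂ) ≠ 0 := by exact_mod_cast hn.ne'
  have hne : ∀ w ∈ rightHalfPlane, w ≠ 0 := by
    rintro w hw rfl
    simp [mem_rightHalfPlane] at hw
  have hb0 : besselInt 0 ‖c‖ = ∫ t : ℝ, Complex.exp (-(‖c‖ * (Complex.exp t + Complex.exp (-t)))) := by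
    simp only [besselInt, coshLaplace, Complex.ofReal_zero, zero_mul, Complex.exp_zero, one_mul]
    refine integral_congr_ae (Eventually.of_forall fun t => ?_)
    simp only [Complex.cosh]
    congr 1
    ring
  have hD : DifferentiableOn ℂ (fun w : ℂ => ∫ t : ℝ,
      Complex.exp (-(‖c‖ * (w * Complex.exp t + w⁻¹ * Complex.exp (-t))))) rightHalfPlane := by
    refine differentiableOn_integral_of_locally_dominated isOpen_rightHalfPlane ?_ ?_ ?_
    · refine Eventually.of_forall fun t => DifferentiableOn.cexp ?_
      refine DifferentiableOn.neg (DifferentiableOn.const_mul (DifferentiableOn.add (by fun_prop)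
        (DifferentiableOn.mul_const (differentiableOn_inv.mono fun w hw => hne w hw) _)) _)
    · intro w _
      exact (by fun_prop : Measurable _).aestronglyMeasurable
    · intro w₀ hw₀
      have h1 : Tendsto (fun w : ℂ => w.re) (𝓝 w₀) (𝓝 w₀.re) := Complex.continuous_re.tendsto _
      have h2 : Tendsto (fun w : ℂ => w⁻¹.re) (𝓝 w₀) (𝓝 w₀⁻¹.re) :=
        (Complex.continuous_re.tendsto _).comp (tendsto_inv₀ (hne _ hw₀))
      have hw₀' : 0 < w₀.re := hw₀
      have h3 : 0 < w₀⁻¹.re := by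
        rw [Complex.inv_re]
        exact div_pos hw₀' (Complex.normSq_pos.2 (hne _ hw₀))
      -- Near `w₀` both `Re w` and `Re w⁻¹` exceed `m`, so the exponent is controlled at both ends
      -- of the line.
      set m := min w₀.re w₀⁻¹.re / 2 with hm
      have hmpos : 0 < m := by positivity
      have e1 : m < w₀.re := by rw [hm]; linarith [min_le_left w₀.re w₀⁻¹.re]
      have e2 : m < w₀⁻¹.re := by rw [hm]; linarith [min_le_right w₀.re w₀⁻¹.re]
      obtain ⟨ε, hε, hball⟩ := Metric.mem_nhds_iff.1
        ((h1.eventually (lt_mem_nhds e1)).and (h2.eventually (lt_mem_nhds e2)))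
      refine ⟨ε, fun t => Real.exp (0 * |t|) * Real.exp (-2 * (‖c‖ * m) * Real.cosh t), hε,
        integrable_exp_mul_abs_sub_cosh 0 (by positivity), Eventually.of_forall fun t w hw => ?_⟩
      obtain ⟨h4, h5⟩ := hball hw
      simp only [Complex.norm_exp, zero_mul, Real.exp_zero, one_mul]
      refine Real.exp_le_exp.2 ?_
      rw [← Complex.ofReal_neg, ← Complex.ofReal_exp, ← Complex.ofReal_exp, Complex.neg_re,
        Complex.re_ofReal_mul, Complex.add_re, Complex.re_mul_ofReal, Complex.re_mul_ofReal,
        Real.cosh_eq]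
      have h6 : m * (Real.exp t + Real.exp (-t)) ≤
          w.re * Real.exp t + w⁻¹.re * Real.exp (-t) := by
        rw [mul_add]
        gcongr
      nlinarith
  have key := eqOn_rightHalfPlane hD (differentiableOn_const (besselInt 0 ‖c‖)) ?_
    (x := c / ‖c‖) (by
      rw [mem_rightHalfPlane, Complex.div_ofReal_re]
      positivity)
  · simp only at key
    rw [← key]
    refine integral_congr_ae (Eventually.of_forall fun t => ?_)
    simp only
    congr 2
    have h2 : (‖c‖ : ℂ) * (c / ‖c‖)⁻¹ = (starRingEnd ℂ) c := by
      have := Complex.mul_conj' c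
      field_simp
      exact this.symm
    have h1 : (‖c‖ : ℂ) * (c / ‖c‖) = c := by field_simp
    linear_combination (-Complex.exp t) * h1 - Complex.exp (-t) * h2
  · intro y hy
    rw [hb0]
    have := integral_add_right_eq_self (μ := volume) (fun t : ℝ =>
      Complex.exp (-(‖c‖ * (Complex.exp t + Complex.exp (-t))))) (Real.log y)
    rw [← this]
    refine integral_congr_ae (Eventually.of_forall fun t => ?_)
    simp only
    congr 3
    have h1 : Complex.exp (Real.log y) = y := by
      rw [← Complex.ofReal_exp, Real.exp_log hy]
    push_cast at h1 ⊢
    rw [neg_add, Complex.exp_add, Complex.exp_add, Complex.exp_neg (Complex.ofReal (Real.log y)), h1]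
    ring

theorem besselInt_zero_ofReal (y : ℝ) :
    besselInt 0 y = ((∫ t : ℝ, Real.exp (-2 * y * Real.cosh t) : ℝ) : ℂ) := by
  rw [← integral_complex_ofReal]
  simp only [besselInt, coshLaplace]
  refine integral_congr_ae (Eventually.of_forall fun t => ?_)
  simp

theorem integrable_exp_neg_cosh {y : ℝ} (hy : 0 < y) :
    Integrable fun t : ℝ => Real.exp (-2 * y * Real.cosh t) := by
  simpa using integrable_exp_mul_abs_sub_cosh 0 hy

theorem integral_exp_neg_cosh_anti {y z : ℝ} (hy : 0 < y) (hyz : y ≤ z) :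
    ∫ t : ℝ, Real.exp (-2 * z * Real.cosh t) ≤ ∫ t : ℝ, Real.exp (-2 * y * Real.cosh t) := by
  refine integral_mono (integrable_exp_neg_cosh (hy.trans_le hyz)) (integrable_exp_neg_cosh hy)
    fun t => Real.exp_le_exp.2 ?_
  nlinarith [Real.one_le_cosh t]

/-- Write `|K|²` as `conj K · K`, a double integral in `t` and `t + e`, with `t ↦ -t` applied in the
conjugate factor. The order `p` then only enters through `e^{pe}`, and the inner integral over `t`
is the one of `integral_exp_neg_mul_add_conj`. The result has a positive integrand depending on `x`
through a single modulus. -/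
theorem besselInt_mul_conj (p : ℝ) {x : ℂ} (hx : 0 < x.re) :
    Integrable (fun e : ℝ => Real.exp (p * e) * ∫ t : ℝ, Real.exp (-2 *
      ‖x * Complex.exp (e / 2) + (starRingEnd ℂ) x * Complex.exp (-(e / 2))‖ * Real.cosh t)) ∧
    ‖besselInt p x‖ ^ 2 = ∫ e : ℝ, Real.exp (p * e) * ∫ t : ℝ, Real.exp (-2 *
      ‖x * Complex.exp (e / 2) + (starRingEnd ℂ) x * Complex.exp (-(e / 2))‖ * Real.cosh t) := by
  set f : ℝ → ℂ := fun t => Complex.exp (p * t) * Complex.exp (-2 * x * Complex.cosh t) with hf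
  set g : ℝ → ℂ := fun t => Complex.exp ((-p : ℝ) * t) *
    Complex.exp (-2 * (starRingEnd ℂ) x * Complex.cosh t) with hg
  have fi : Integrable f := (expBounded_exp p).integrable (by fun_prop) hx
  have gi : Integrable g := (expBounded_exp (-p)).integrable (by fun_prop) (by simpa using hx)
  have If : ∫ t, f t = besselInt p x := rfl
  have Ig : ∫ t, g t = (starRingEnd ℂ) (besselInt p x) := by
    rw [besselInt, ← coshLaplace_comp_neg, coshLaplace, ← integral_conj]
    refine integral_congr_ae (Eventually.of_forall fun t => ?_)
    simp only [hg, map_mul, ← Complex.exp_conj, ← Complex.cosh_conj, Complex.conj_ofReal, map_neg, Complex.conj_ofNat]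
    simp
  have hP := gi.mul_prod fi
  have mp := measurePreserving_prod_add (G := ℝ) volume volume
  have hPS := mp.integrable_comp_of_integrable hP
  have hPe := hPS.swap
  have inner : ∀ e : ℝ, (∫ t : ℝ, g t * f (t + e)) = ((Real.exp (p * e) * ∫ t : ℝ, Real.exp (-2 *
      ‖x * Complex.exp (e / 2) + (starRingEnd ℂ) x * Complex.exp (-(e / 2))‖ * Real.cosh t) : ℝ) : ℂ) := by
    intro e
    set γ := x * Complex.exp (e / 2) + (starRingEnd ℂ) x * Complex.exp (-(e / 2)) with hγ
    have hγre : 0 < γ.re := by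
      have e1 : Complex.exp (e / 2) = ((Real.exp (e / 2) : ℝ) : ℂ) := by push_cast; rfl
      have e2 : Complex.exp (-(e / 2)) = ((Real.exp (-(e / 2)) : ℝ) : ℂ) := by push_cast; rfl
      rw [hγ, e1, e2, Complex.add_re, Complex.re_mul_ofReal, Complex.re_mul_ofReal, Complex.conj_re]
      positivity
    -- Shifting `t` by `-e/2` symmetrises the exponent into `γ e^t + conj γ e^{-t}`.
    rw [Complex.ofReal_mul, ← besselInt_zero_ofReal, ← integral_exp_neg_mul_add_conj hγre,
      ← integral_const_mul, ← integral_add_right_eq_self (μ := volume) _ (-(e / 2))]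
    refine integral_congr_ae (Eventually.of_forall fun t => ?_)
    have h1 : Complex.exp (t : ℂ) ≠ 0 := Complex.exp_ne_zero _
    have h2 : Complex.exp ((e : ℂ) / 2) ≠ 0 := Complex.exp_ne_zero _
    simp only [hf, hg, hγ, map_add, map_mul, Complex.conj_conj, ← Complex.exp_conj, map_neg,
      map_div₀, Complex.conj_ofReal, Complex.conj_ofNat]
    rw [Complex.ofReal_exp, ← Complex.exp_add, ← Complex.exp_add, ← Complex.exp_add,
      ← Complex.exp_add]
    congr 1
    simp only [Complex.cosh]
    have h3 : Complex.exp (e : ℂ) = Complex.exp (e / 2) * Complex.exp (e / 2) := by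
      rw [← Complex.exp_add]; ring_nf
    push_cast
    simp only [neg_add, Complex.exp_add, Complex.exp_neg, h3]
    field_simp
    ring
  constructor
  · have := hPe.integral_prod_left.re
    refine this.congr (Eventually.of_forall fun e => ?_)
    have := inner e
    simp only [Function.comp, Prod.swap]
    rw [this]
    exact Complex.ofReal_re _
  · have h1 : ∫ z : ℝ × ℝ, g z.1 * f z.2 ∂(volume.prod volume) =
        (starRingEnd ℂ) (besselInt p x) * besselInt p x := by
      rw [integral_prod_mul, If, Ig]
    have h2 : ∫ z, ((fun z : ℝ × ℝ => g z.1 * f z.2) ∘ fun z : ℝ × ℝ => (z.1, z.1 + z.2)) z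
          ∂(volume.prod volume) =
        ∫ z : ℝ × ℝ, g z.1 * f z.2 ∂(volume.prod volume) :=
      mp.integral_comp (MeasurableEquiv.shearAddRight ℝ).measurableEmbedding
        (fun z : ℝ × ℝ => g z.1 * f z.2)
    rw [integral_prod_symm _ hPS, h1, Complex.conj_mul'] at h2
    simp only [Function.comp, inner] at h2
    rw [integral_complex_ofReal] at h2
    exact_mod_cast h2.symm

/-- In the positive representation of `|K|²` the modulus `|x e^{e/2} + conj x e^{-e/2}|` is at most
`|x| (e^{e/2} + e^{-e/2})`, its value for the real argument `|x|`, and the inner integral is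
decreasing in it. This excludes zeros of the Bessel integral, also in the limit `Re x → 0`. -/
theorem norm_besselInt_norm_le (p : ℝ) {x : ℂ} (hx : 0 < x.re) :
    ‖besselInt p ‖x‖‖ ≤ ‖besselInt p x‖ := by
  have hx0 : x ≠ 0 := by rintro rfl; simp at hx
  have hn : 0 < ‖x‖ := norm_pos_iff.2 hx0
  obtain ⟨i1, e1⟩ := besselInt_mul_conj p (x := (‖x‖ : ℂ)) (by simpa using hx0)
  obtain ⟨i2, e2⟩ := besselInt_mul_conj p hx
  refine le_of_sq_le_sq ?_ (norm_nonneg _)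
  rw [e1, e2]
  refine integral_mono i1 i2 fun e => ?_
  refine mul_le_mul_of_nonneg_left (integral_exp_neg_cosh_anti ?_ ?_) (Real.exp_pos _).le
  · have q1 : Complex.exp (e / 2) = ((Real.exp (e / 2) : ℝ) : ℂ) := by push_cast; rfl
    have q2 : Complex.exp (-(e / 2)) = ((Real.exp (-(e / 2)) : ℝ) : ℂ) := by push_cast; rfl
    refine norm_pos_iff.2 fun h => ?_
    have := congrArg Complex.re h
    rw [q1, q2, Complex.add_re, Complex.re_mul_ofReal, Complex.re_mul_ofReal, Complex.conj_re] at this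
    simp only [Complex.zero_re] at this
    have : 0 < x.re * Real.exp (e / 2) + x.re * Real.exp (-(e / 2)) := by positivity
    linarith
  · have q1 : Complex.exp (e / 2) = ((Real.exp (e / 2) : ℝ) : ℂ) := by push_cast; rfl
    have q2 : Complex.exp (-(e / 2)) = ((Real.exp (-(e / 2)) : ℝ) : ℂ) := by push_cast; rfl
    rw [q1, q2, Complex.conj_ofReal, ← mul_add, ← Complex.ofReal_add, ← Complex.ofReal_mul,
      Complex.norm_real, Real.norm_of_nonneg (by positivity)]
    refine (norm_add_le _ _).trans_eq ?_
    rw [norm_mul, norm_mul, Complex.norm_conj, Complex.norm_real, Complex.norm_real,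
      Real.norm_of_nonneg (by positivity), Real.norm_of_nonneg (by positivity)]
    ring

/-! ### A distributional identity for generalised inverse Gaussian and gamma densities -/

theorem lintegral_Ioi_zero_eq_lintegral_exp {c : ℝ} (hc : 0 < c) (b : ℝ) (g : ℝ → ENNReal) :
    ∫⁻ q in Set.Ioi (0 : ℝ), g q =
      ∫⁻ t in Set.Ioi b, ENNReal.ofReal (c * Real.exp t) * g (c * (Real.exp t - Real.exp b)) := by
  have himg : (fun t : ℝ => c * (Real.exp t - Real.exp b)) '' Set.Ioi b = Set.Ioi 0 := by
    ext r
    simp only [Set.mem_image, Set.mem_Ioi]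
    constructor
    · rintro ⟨t, ht, rfl⟩
      exact mul_pos hc (sub_pos.2 (Real.exp_lt_exp.2 ht))
    · intro hr
      have h1 : 0 < Real.exp b + r / c := by positivity
      refine ⟨Real.log (Real.exp b + r / c), ?_, ?_⟩
      · rw [Real.lt_log_iff_exp_lt h1]
        linarith [div_pos hr hc]
      · rw [Real.exp_log h1]
        field_simp
        ring
  have key := lintegral_image_eq_lintegral_abs_deriv_mul (measurableSet_Ioi (a := b))
    (f := fun t => c * (Real.exp t - Real.exp b)) (f' := fun t => c * Real.exp t)
    (fun t _ => (((Real.hasDerivAt_exp t).sub_const _).const_mul c).hasDerivWithinAt)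
    (fun t _ t' _ h => by simpa [hc.ne'] using h) g
  rw [himg] at key
  rw [key]
  refine setLIntegral_congr_fun measurableSet_Ioi fun t _ => ?_
  rw [abs_of_pos (by positivity)]

theorem gammaPDFReal_scale {p r x q : ℝ} (hr : 0 < r) (hx : 0 < x) (hq : 0 ≤ q) :
    x / r * gammaPDFReal p r (x / r * q) = gammaPDFReal p x q := by
  have h0 : 0 < x / r := by positivity
  rw [gammaPDFReal, gammaPDFReal, if_pos (by positivity), if_pos hq,
    Real.mul_rpow h0.le hq, show r * (x / r * q) = x * q by field_simp]
  have h1 : (x / r) ^ (p - 1) * (x / r) = (x / r) ^ p := by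
    rw [← Real.rpow_add_one h0.ne']; ring_nf
  have h2 : r ^ p * (x / r) ^ p = x ^ p := by
    rw [← Real.mul_rpow hr.le h0.le]
    congr 1
    field_simp
  rw [← h2, ← h1]
  ring

theorem lintegral_gammaMeasure (p r : ℝ) {g : ℝ → ENNReal} (hg : Measurable g) :
    ∫⁻ a, g a ∂gammaMeasure p r = ∫⁻ a in Set.Ioi (0 : ℝ), gammaPDF p r a * g a := by
  have mpdf : Measurable (gammaPDF p r) := (measurable_gammaPDFReal p r).ennreal_ofReal
  rw [gammaMeasure, lintegral_withDensity_eq_lintegral_mul _ mpdf hg]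
  rw [← lintegral_add_compl _ (measurableSet_Ici (a := (0 : ℝ))), Set.compl_Ici,
    setLIntegral_congr_fun (g := fun _ => 0) measurableSet_Iio, lintegral_zero, add_zero,
    setLIntegral_congr Ioi_ae_eq_Ici.symm]
  · rfl
  · intro a ha
    simp [gammaPDF_of_neg (Set.mem_Iio.1 ha)]

/-- The density, in the logarithmic scale, of the (unnormalised) generalised inverse Gaussian
law. -/
noncomputable def gigDensity (p x t : ℝ) : ℝ := Real.exp (p * t) * Real.exp (-2 * x * Real.cosh t)

theorem gigDensity_pos (p x t : ℝ) : 0 < gigDensity p x t := by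
  unfold gigDensity; positivity

theorem measurable_gigDensity (p x : ℝ) : Measurable (gigDensity p x) := by
  unfold gigDensity; fun_prop

/-- Detailed balance: given `t`, the law of `τ` with `e^τ = Q + e^{-t}`, `Q` gamma of rate `x`, has
density `e^τ γ(e^τ - e^{-t})`, and this kernel is reversible for `gigDensity`. The computation rests
on `e^τ - e^{-t} = e^{τ-t} (e^t - e^{-τ})`. -/
theorem gigDensity_mul_gammaPDFReal {p x t τ : ℝ} (h : -t < τ) :
    gigDensity p x t * (Real.exp τ * gammaPDFReal p x (Real.exp τ - Real.exp (-t))) =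
      gigDensity p x τ * (Real.exp t * gammaPDFReal p x (Real.exp t - Real.exp (-τ))) := by
  have h1 : 0 < Real.exp τ - Real.exp (-t) := sub_pos.2 (Real.exp_lt_exp.2 h)
  have h2 : 0 < Real.exp t - Real.exp (-τ) := sub_pos.2 (Real.exp_lt_exp.2 (by linarith))
  have h3 : Real.exp τ - Real.exp (-t) = Real.exp (τ - t) * (Real.exp t - Real.exp (-τ)) := by
    rw [mul_sub, ← Real.exp_add, ← Real.exp_add]
    congr 2 <;> ring
  unfold gigDensity gammaPDFReal
  rw [if_pos h1.le, if_pos h2.le]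
  have h4 : (Real.exp τ - Real.exp (-t)) ^ (p - 1) =
      Real.exp ((τ - t) * (p - 1)) * (Real.exp t - Real.exp (-τ)) ^ (p - 1) := by
    rw [h3, Real.mul_rpow (Real.exp_pos _).le h2.le, ← Real.exp_mul]
  rw [h4, Real.cosh_eq, Real.cosh_eq]
  have h5 : ∀ A B C D E F G : ℝ, A + B + C + D + E = F + G → Real.exp A * Real.exp B *
      (Real.exp C * (Real.exp D * Real.exp E)) = Real.exp F * Real.exp G := by
    intro A B C D E F G h
    rw [← Real.exp_add, ← Real.exp_add, ← Real.exp_add, ← Real.exp_add, ← Real.exp_add, ← h]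
    congr 1; ring
  have h6 : Real.exp (p * t) * Real.exp (-2 * x * ((Real.exp t + Real.exp (-t)) / 2)) *
      (Real.exp τ * (Real.exp ((τ - t) * (p - 1)) *
        Real.exp (-(x * (Real.exp τ - Real.exp (-t)))))) =
      Real.exp (p * τ + t) * Real.exp (-2 * x * ((Real.exp τ + Real.exp (-τ)) / 2) +
        -(x * (Real.exp t - Real.exp (-τ)))) := h5 _ _ _ _ _ _ _ (by ring)
  rw [Real.exp_add, Real.exp_add] at h6
  linear_combination (x ^ p / Real.Gamma p * (Real.exp t - Real.exp (-τ)) ^ (p - 1)) * h6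

/-- Invariance follows from detailed balance by integrating out `t`, over which the reversed kernel
has mass one. The gamma law keeps the rate `r` and the variable is rescaled by `r / x`: in this form
`x` enters only through integrands and can later be made complex. -/
theorem lintegral_gamma_gig {p r x : ℝ} (hp : 0 < p) (hr : 0 < r) (hx : 0 < x) {f : ℝ → ENNReal}
    (hf : Measurable f) :
    ∫⁻ a, (∫⁻ t, f (a * r / x + Real.exp (-t)) * ENNReal.ofReal (gigDensity p x t))
        ∂gammaMeasure p r =
      ∫⁻ t, f (Real.exp t) * ENNReal.ofReal (gigDensity p x t) := by
  have mg := (measurable_gigDensity p x).ennreal_ofReal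
  have mpdf : Measurable (gammaPDF p r) := (measurable_gammaPDFReal p r).ennreal_ofReal
  have mpdf' : Measurable (gammaPDF p x) := (measurable_gammaPDFReal p x).ennreal_ofReal
  have m1 : Measurable fun z : ℝ × ℝ =>
      f (z.1 * r / x + Real.exp (-z.2)) * ENNReal.ofReal (gigDensity p x z.2) :=
    (hf.comp (by fun_prop)).mul (mg.comp measurable_snd)
  rw [lintegral_gammaMeasure p r m1.lintegral_prod_right']
  have s1 : ∀ a : ℝ, gammaPDF p r a * ∫⁻ t, f (a * r / x + Real.exp (-t)) *
      ENNReal.ofReal (gigDensity p x t) = ∫⁻ t, gammaPDF p r a * (f (a * r / x + Real.exp (-t)) *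
      ENNReal.ofReal (gigDensity p x t)) := fun a =>
    (lintegral_const_mul _ (m1.comp (by fun_prop : Measurable fun t : ℝ => (a, t)))).symm
  simp only [s1]
  rw [lintegral_lintegral_swap ((mpdf.comp measurable_fst).mul m1).aemeasurable]
  have s2 : ∀ t : ℝ, ∫⁻ a in Set.Ioi (0 : ℝ), gammaPDF p r a * (f (a * r / x + Real.exp (-t)) *
      ENNReal.ofReal (gigDensity p x t)) = ∫⁻ τ, (Set.Ioi 0).indicator (fun _ => 1) (t + τ) *
      (f (Real.exp τ) * ENNReal.ofReal (gigDensity p x τ * (Real.exp t *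
        gammaPDFReal p x (Real.exp t - Real.exp (-τ))))) := by
    intro t
    rw [lintegral_Ioi_zero_eq_lintegral_exp (c := x / r) (by positivity) (-t),
      ← lintegral_indicator measurableSet_Ioi]
    refine lintegral_congr fun τ => ?_
    by_cases h : -t < τ
    · rw [Set.indicator_of_mem (by simpa using h), Set.indicator_of_mem
        (show t + τ ∈ Set.Ioi (0 : ℝ) by simp; linarith), one_mul]
      have h1 : 0 < Real.exp τ - Real.exp (-t) := sub_pos.2 (Real.exp_lt_exp.2 h)
      have h2 : x / r * (Real.exp τ - Real.exp (-t)) * r / x + Real.exp (-t) = Real.exp τ := by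
        field_simp
        ring
      rw [h2, ← gigDensity_mul_gammaPDFReal h, gammaPDF, ← gammaPDFReal_scale hr hx h1.le,
        ENNReal.ofReal_mul (gigDensity_pos p x t).le,
        show Real.exp τ * (x / r * gammaPDFReal p r (x / r * (Real.exp τ - Real.exp (-t)))) =
        (x / r * Real.exp τ) * gammaPDFReal p r (x / r * (Real.exp τ - Real.exp (-t))) by ring,
        ENNReal.ofReal_mul (p := x / r * Real.exp τ) (by positivity)]
      ring
    · rw [Set.indicator_of_notMem (by simpa using h), Set.indicator_of_notMem
        (show t + τ ∉ Set.Ioi (0 : ℝ) by simp; linarith), zero_mul]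
  simp only [s2]
  have m2 : Measurable fun z : ℝ × ℝ => (Set.Ioi (0 : ℝ)).indicator (fun _ => (1 : ENNReal))
      (z.1 + z.2) * (f (Real.exp z.2) * ENNReal.ofReal (gigDensity p x z.2 * (Real.exp z.1 *
        gammaPDFReal p x (Real.exp z.1 - Real.exp (-z.2))))) := by
    refine Measurable.mul ?_ (Measurable.mul (hf.comp (by fun_prop)) ?_)
    · exact (measurable_const.indicator measurableSet_Ioi).comp (by fun_prop)
    · exact (((measurable_gigDensity p x).comp measurable_snd).mul (Measurable.mul (by fun_prop)
        ((measurable_gammaPDFReal p x).comp (by fun_prop)))).ennreal_ofReal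
  rw [lintegral_lintegral_swap m2.aemeasurable]
  refine lintegral_congr fun τ => ?_
  have s3 : ∫⁻ q in Set.Ioi (0 : ℝ), gammaPDF p x q = 1 := by
    have := lintegral_gammaMeasure p x (g := fun _ => 1) measurable_const
    have hP := isProbabilityMeasure_gammaMeasure hp hx
    simpa using this.symm
  rw [lintegral_Ioi_zero_eq_lintegral_exp (c := 1) one_pos (-τ)] at s3
  calc _ = ∫⁻ t in Set.Ioi (-τ), (f (Real.exp τ) * ENNReal.ofReal (gigDensity p x τ)) *
        (ENNReal.ofReal (1 * Real.exp t) * gammaPDF p x (1 * (Real.exp t - Real.exp (-τ)))) := by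
        rw [← lintegral_indicator measurableSet_Ioi]
        refine lintegral_congr fun t => ?_
        by_cases h : -τ < t
        · rw [Set.indicator_of_mem (show t + τ ∈ Set.Ioi (0 : ℝ) by simp; linarith),
            Set.indicator_of_mem (by simpa using h), one_mul, one_mul, one_mul, gammaPDF,
            ENNReal.ofReal_mul (gigDensity_pos p x τ).le, ENNReal.ofReal_mul (Real.exp_pos _).le]
          ring
        · rw [Set.indicator_of_notMem (show t + τ ∉ Set.Ioi (0 : ℝ) by simp; linarith),
            Set.indicator_of_notMem (by simpa using h), zero_mul]
    _ = _ := by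
        rw [lintegral_const_mul, s3, mul_one]
        exact Measurable.mul (by fun_prop) (mpdf'.comp (by fun_prop))

/-- Proved as an equality of image measures, so no integrability of `f` has to be checked. -/
theorem integral_gamma_gig {p r x : ℝ} (hp : 0 < p) (hr : 0 < r) (hx : 0 < x) {f : ℝ → ℂ}
    (hf : Measurable f) :
    ∫ z : ℝ × ℝ, f (z.1 * r / x + Real.exp (-z.2)) * gigDensity p x z.2
        ∂((gammaMeasure p r).prod volume) =
      ∫ t, f (Real.exp t) * gigDensity p x t := by
  have hP := isProbabilityMeasure_gammaMeasure hp hr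
  have mg := (measurable_gigDensity p x).ennreal_ofReal
  set ρ : Measure ℝ := volume.withDensity fun t => ENNReal.ofReal (gigDensity p x t) with hρ
  have hsf : SFinite ρ := by rw [hρ]; infer_instance
  have hmap : ((gammaMeasure p r).prod ρ).map (fun z => z.1 * r / x + Real.exp (-z.2)) =
      ρ.map Real.exp := by
    refine Measure.ext_of_lintegral _ fun g hg => ?_
    rw [lintegral_map hg (by fun_prop), lintegral_map hg (by fun_prop),
      lintegral_prod (fun z : ℝ × ℝ => g (z.1 * r / x + Real.exp (-z.2)))
        (hg.comp (by fun_prop)).aemeasurable, hρ,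
      lintegral_withDensity_eq_lintegral_mul _ mg (g := fun t => g (Real.exp t))
        (hg.comp (by fun_prop))]
    have := lintegral_gamma_gig hp hr hx hg
    simp only [Pi.mul_apply, mul_comm (ENNReal.ofReal _)]
    rw [← this]
    refine lintegral_congr fun a => ?_
    rw [lintegral_withDensity_eq_lintegral_mul _ mg (g := fun t => g (a * r / x + Real.exp (-t)))
      (hg.comp (by fun_prop))]
    simp only [Pi.mul_apply, mul_comm (ENNReal.ofReal _)]
  have h1 := integral_map (μ := (gammaMeasure p r).prod ρ)
    (φ := fun z => z.1 * r / x + Real.exp (-z.2)) (by fun_prop) hf.aestronglyMeasurable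
  have h2 := integral_map (μ := ρ) (φ := Real.exp) (by fun_prop) hf.aestronglyMeasurable
  rw [hmap, h2, hρ, prod_withDensity_right mg,
    integral_withDensity_eq_integral_toReal_smul mg (by simp),
    integral_withDensity_eq_integral_toReal_smul
      (f := fun z : ℝ × ℝ => ENNReal.ofReal (gigDensity p x z.2))
      (mg.comp measurable_snd) (by simp)] at h1
  simp only [ENNReal.toReal_ofReal (gigDensity_pos p x _).le, Complex.real_smul,
    mul_comm (Complex.ofReal (gigDensity p x _))] at h1
  exact h1.symm

theorem ae_gammaMeasure_pos (p r : ℝ) : ∀ᵐ a ∂gammaMeasure p r, 0 < a := by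
  rw [ae_iff, ← lintegral_indicator_one (by measurability), lintegral_gammaMeasure]
  · rw [setLIntegral_congr_fun (g := fun _ => 0) measurableSet_Ioi, lintegral_zero]
    intro a ha
    have : a ∉ {a : ℝ | ¬ 0 < a} := by simpa using ha
    simp only [Set.indicator_of_notMem this, mul_zero]
  · exact measurable_const.indicator (by measurability)

theorem integrable_pow_gammaMeasure {p r : ℝ} (hp : 0 < p) (hr : 0 < r) (n : ℕ) :
    Integrable (fun a : ℝ => a ^ n) (gammaMeasure p r) := by
  have mpdf : Measurable (gammaPDF p r) := (measurable_gammaPDFReal p r).ennreal_ofReal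
  rw [gammaMeasure, integrable_withDensity_iff mpdf (by simp [gammaPDF])]
  have h := (integrableOn_rpow_mul_exp_neg_mul_rpow (p := 1) (s := p - 1 + n) (b := r)
    (by linarith [n.cast_nonneg (α := ℝ)]) one_pos hr).const_mul (r ^ p / Real.Gamma p)
  refine ((integrable_indicator_iff measurableSet_Ioi).2 h).congr ?_
  filter_upwards [compl_mem_ae_iff.2 (measure_singleton (0 : ℝ))] with a ha
  rcases lt_or_gt_of_ne ha with ha | ha
  · rw [Set.indicator_of_notMem (by simpa using ha.le), gammaPDF_of_neg ha]
    simp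
  · rw [Set.indicator_of_mem (by simpa using ha), gammaPDF,
      ENNReal.toReal_ofReal (gammaPDFReal_nonneg hp hr a), gammaPDFReal, if_pos ha.le,
      Real.rpow_add ha, Real.rpow_natCast, Real.rpow_one, neg_mul]
    ring

/-! ### The Poisson equation in the open half plane -/

/-- If `zw` were real and at most `-1`, then `w = (zw) z⁻¹` would have negative real part. -/
theorem one_add_mul_mem_slitPlane {z w : ℂ} (hz : 0 < z.re) (hw : 0 ≤ w.re) :
    1 + z * w ∈ Complex.slitPlane := by
  rw [Complex.mem_slitPlane_iff]
  by_contra hc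
  push Not at hc
  obtain ⟨h1, h2⟩ := hc
  have hz0 : z ≠ 0 := by rintro rfl; simp at hz
  simp only [Complex.add_re, Complex.one_re, Complex.add_im, Complex.one_im, zero_add] at h1 h2
  have h3 : z * w = ((z * w).re : ℂ) := Complex.ext (by simp) (by simp [h2])
  have h4 : w = ((z * w).re : ℂ) * z⁻¹ := by
    rw [← h3]; field_simp
  have h5 : w.re = (z * w).re * z⁻¹.re := by
    conv_lhs => rw [h4]
    rw [Complex.re_ofReal_mul]
  have h6 : 0 < z⁻¹.re := by
    rw [Complex.inv_re]
    exact div_pos hz (Complex.normSq_pos.2 hz0)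
  nlinarith

theorem Complex.norm_log_le (y : ℂ) : ‖Complex.log y‖ ≤ |Real.log ‖y‖| + Real.pi := by
  refine (Complex.norm_le_abs_re_add_abs_im _).trans ?_
  rw [Complex.log_re, Complex.log_im]
  gcongr
  exact Complex.abs_arg_le_pi y

/-- The logarithm cannot be very negative: `|1 + zw| = |z| |z⁻¹ + w| ≥ |z| Re z⁻¹ = Re z / |z|`. -/
theorem norm_log_one_add_mul_le {z w : ℂ} (hz : 0 < z.re) (hw : 0 ≤ w.re) :
    ‖Complex.log (1 + z * w)‖ ≤ |Real.log (z.re / ‖z‖)| + Real.pi + ‖z‖ * ‖w‖ := by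
  have hz0 : z ≠ 0 := by rintro rfl; simp at hz
  have hn : 0 < ‖z‖ := norm_pos_iff.2 hz0
  have h1 : z.re / ‖z‖ ≤ ‖1 + z * w‖ := by
    have e : 1 + z * w = z * (z⁻¹ + w) := by field_simp
    rw [e, norm_mul]
    have h2 : z⁻¹.re = z.re / ‖z‖ ^ 2 := by rw [Complex.inv_re, Complex.normSq_eq_norm_sq]
    have h3 : z⁻¹.re ≤ ‖z⁻¹ + w‖ := by
      refine le_trans ?_ ((le_abs_self _).trans (Complex.abs_re_le_norm _))
      rw [Complex.add_re]; linarith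
    calc z.re / ‖z‖ = ‖z‖ * (z.re / ‖z‖ ^ 2) := by field_simp
      _ ≤ _ := by rw [← h2]; gcongr
  have h0 : 0 < z.re / ‖z‖ := by positivity
  have h2 : ‖1 + z * w‖ ≤ 1 + ‖z‖ * ‖w‖ := by
    refine (norm_add_le _ _).trans ?_
    rw [norm_one, norm_mul]
  have h3 := Real.log_le_log h0 h1
  have h4 := (Real.log_le_log (h0.trans_le h1) h2).trans
    (Real.log_le_sub_one_of_pos (by positivity))
  have h5 : |Real.log ‖1 + z * w‖| ≤ |Real.log (z.re / ‖z‖)| + ‖z‖ * ‖w‖ := by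
    have h6 := neg_abs_le (Real.log (z.re / ‖z‖))
    have h7 := abs_nonneg (Real.log (z.re / ‖z‖))
    have h8 : 0 ≤ ‖z‖ * ‖w‖ := by positivity
    rw [abs_le]
    constructor <;> linarith
  linarith [Complex.norm_log_le (1 + z * w)]

/-- The integral of `log (1 + u z)` against the generalised inverse Gaussian density. -/
noncomputable def logInt (p : ℝ) (z : ℂ) : ℂ → ℂ :=
  coshLaplace fun t => Complex.log (1 + z * Complex.exp t) * Complex.exp (p * t)

theorem norm_cexp_ofReal (t : ℝ) : ‖Complex.exp t‖ = Real.exp t := by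
  rw [← Complex.ofReal_exp, Complex.norm_real, Real.norm_of_nonneg (Real.exp_pos _).le]

theorem cexp_ofReal_re_pos (t : ℝ) : 0 < (Complex.exp t).re := by
  rw [← Complex.ofReal_exp, Complex.ofReal_re]; exact Real.exp_pos _

theorem expBounded_log {z : ℂ} (hz : 0 < z.re) :
    ExpBounded fun t => Complex.log (1 + z * Complex.exp t) := by
  refine ⟨|Real.log (z.re / ‖z‖)| + Real.pi + ‖z‖, 1, fun t => ?_⟩
  refine (norm_log_one_add_mul_le hz (cexp_ofReal_re_pos t).le).trans ?_
  rw [norm_cexp_ofReal, one_mul]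
  have h1 : Real.exp t ≤ Real.exp |t| := Real.exp_le_exp.2 (le_abs_self t)
  have h2 : 1 ≤ Real.exp |t| := Real.one_le_exp (abs_nonneg t)
  have h3 : 0 ≤ |Real.log (z.re / ‖z‖)| + Real.pi := by positivity
  have h4 := mul_le_mul_of_nonneg_left h1 (norm_nonneg z)
  nlinarith

/-- The algebraic source of the Poisson equation: `z (1 + (w + z⁻¹) e^t) = e^t (1 + z (w +
e^{-t}))`. On the left both factors have positive real part, so their arguments add without crossing
the branch cut. -/
theorem log_add_log_one_add {z w : ℂ} {t : ℝ} (hz : 0 < z.re) (hw : 0 ≤ w.re) :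
    Complex.log z + Complex.log (1 + (w + z⁻¹) * Complex.exp t) =
      t + Complex.log (1 + z * (w + Complex.exp (-t))) := by
  have hz0 : z ≠ 0 := by rintro rfl; simp at hz
  have h1 : 0 < (1 + (w + z⁻¹) * Complex.exp t).re := by
    rw [← Complex.ofReal_exp, Complex.add_re, Complex.re_mul_ofReal, Complex.add_re, Complex.inv_re]
    have h2 : 0 ≤ z.re / Complex.normSq z := div_nonneg hz.le (Complex.normSq_nonneg z)
    have h3 : 0 ≤ (w.re + z.re / Complex.normSq z) * Real.exp t := by positivity
    simp only [Complex.one_re]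
    linarith
  have h0 : 1 + (w + z⁻¹) * Complex.exp t ≠ 0 := by
    intro h; rw [h] at h1; simp at h1
  have hw' : 0 ≤ (w + Complex.exp (-t)).re := by
    have := cexp_ofReal_re_pos (-t)
    push_cast at this
    rw [Complex.add_re]; linarith
  have h2 : 1 + z * (w + Complex.exp (-t)) ≠ 0 :=
    Complex.slitPlane_ne_zero (one_add_mul_mem_slitPlane hz hw')
  have e1 : z * (1 + (w + z⁻¹) * Complex.exp t) =
      (Real.exp t : ℂ) * (1 + z * (w + Complex.exp (-t))) := by
    rw [Complex.ofReal_exp, Complex.exp_neg]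
    have := Complex.exp_ne_zero t
    field_simp
    ring
  rw [← Complex.log_mul hz0 h0, e1, Complex.log_ofReal_mul (Real.exp_pos t) h2, Real.log_exp]
  have a1 := Complex.abs_arg_lt_pi_div_two_iff.2 (Or.inl hz)
  have a2 := Complex.abs_arg_lt_pi_div_two_iff.2 (Or.inl h1)
  rw [abs_lt] at a1 a2
  constructor <;> linarith [a1.1, a1.2, a2.1, a2.2]

/-- The integrand whose average over the gamma law is computed in the Poisson equation. -/
noncomputable def gammaLogIntegrand (p r : ℝ) (z x : ℂ) (y : ℝ × ℝ) : ℂ :=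
  Complex.log (1 + z * ((y.1 : ℂ) * r / x + Complex.exp (-y.2))) * Complex.exp (p * y.2) *
    Complex.exp (-2 * x * Complex.cosh y.2)

theorem measurable_gammaLogIntegrand (p r : ℝ) (z x : ℂ) :
    Measurable (gammaLogIntegrand p r z x) := by
  unfold gammaLogIntegrand
  fun_prop

theorem re_mul_div_nonneg {a r : ℝ} (ha : 0 ≤ a) (hr : 0 ≤ r) {x : ℂ} (hx : 0 ≤ x.re) :
    0 ≤ ((a : ℂ) * r / x).re := by
  rw [div_eq_mul_inv, ← Complex.ofReal_mul, Complex.re_ofReal_mul, Complex.inv_re]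
  have := Complex.normSq_nonneg x
  positivity

theorem re_exp_neg_pos (t : ℝ) : 0 < (Complex.exp (-t)).re := by
  have := cexp_ofReal_re_pos (-t)
  push_cast at this
  exact this

theorem norm_gammaLogIntegrand_le {p r m : ℝ} (hr : 0 < r) {z : ℂ} (hz : 0 < z.re) (hm : 0 < m)
    {x : ℂ} (hx : m ≤ x.re) {y : ℝ × ℝ} (hy : 0 ≤ y.1) :
    ‖gammaLogIntegrand p r z x y‖ ≤ (|Real.log (z.re / ‖z‖)| + Real.pi + ‖z‖ * (r / m) * y.1 + ‖z‖) *
      (Real.exp ((|p| + 1) * |y.2|) * Real.exp (-2 * m * Real.cosh y.2)) := by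
  have hxr : 0 < x.re := hm.trans_le hx
  have hw : 0 ≤ ((y.1 : ℂ) * r / x + Complex.exp (-y.2)).re := by
    rw [Complex.add_re]
    linarith [re_mul_div_nonneg hy hr.le hxr.le, re_exp_neg_pos y.2]
  have hxn : m ≤ ‖x‖ := hx.trans ((le_abs_self _).trans (Complex.abs_re_le_norm _))
  have h1 : ‖(y.1 : ℂ) * r / x + Complex.exp (-y.2)‖ ≤ r / m * y.1 + Real.exp |y.2| := by
    refine (norm_add_le _ _).trans (add_le_add ?_ ?_)
    · rw [norm_div, norm_mul, Complex.norm_real, Complex.norm_real, Real.norm_of_nonneg hy,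
        Real.norm_of_nonneg hr.le, div_mul_eq_mul_div, mul_comm r]
      gcongr
    · rw [← Complex.ofReal_neg, norm_cexp_ofReal]
      exact Real.exp_le_exp.2 (neg_le_abs _)
  have h2 := (norm_log_one_add_mul_le hz hw).trans
    (add_le_add_right (mul_le_mul_of_nonneg_left h1 (norm_nonneg z)) _)
  have h3 : 1 ≤ Real.exp |y.2| := Real.one_le_exp (abs_nonneg _)
  have hA : 0 ≤ |Real.log (z.re / ‖z‖)| + Real.pi := by positivity
  have hB : 0 ≤ ‖z‖ * (r / m) * y.1 := by positivity
  have h4 : |Real.log (z.re / ‖z‖)| + Real.pi + ‖z‖ * (r / m * y.1 + Real.exp |y.2|) ≤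
      (|Real.log (z.re / ‖z‖)| + Real.pi + ‖z‖ * (r / m) * y.1 + ‖z‖) * Real.exp |y.2| := by
    nlinarith [norm_nonneg z]
  have h5 : ‖Complex.exp (p * y.2)‖ ≤ Real.exp (|p| * |y.2|) := by
    rw [← Complex.ofReal_mul, norm_cexp_ofReal, ← abs_mul]
    exact Real.exp_le_exp.2 (le_abs_self _)
  have h6 : Real.exp (-2 * x.re * Real.cosh y.2) ≤ Real.exp (-2 * m * Real.cosh y.2) := by
    refine Real.exp_le_exp.2 ?_
    nlinarith [Real.one_le_cosh y.2]
  rw [gammaLogIntegrand, norm_mul, norm_mul, norm_exp_neg_two_mul_cosh]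
  have h7 : 0 ≤ (|Real.log (z.re / ‖z‖)| + Real.pi + ‖z‖ * (r / m) * y.1 + ‖z‖) := by positivity
  calc _ ≤ ((|Real.log (z.re / ‖z‖)| + Real.pi + ‖z‖ * (r / m) * y.1 + ‖z‖) * Real.exp |y.2|) *
        Real.exp (|p| * |y.2|) * Real.exp (-2 * m * Real.cosh y.2) := by
        gcongr
        exact h2.trans h4
    _ = _ := by rw [add_mul |p|, Real.exp_add, one_mul]; ring

/-- The summand `‖(0 : ℂ)‖` is zero and is removed at each use; all constants are carried by `A`. -/
theorem integrable_gammaLog_bound {p r m : ℝ} (hp : 0 < p) (hr : 0 < r) (hm : 0 < m) (A B : ℝ) :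
    Integrable (fun y : ℝ × ℝ => (A + B * y.1 + ‖(0 : ℂ)‖) *
      (Real.exp ((|p| + 1) * |y.2|) * Real.exp (-2 * m * Real.cosh y.2)))
      ((gammaMeasure p r).prod volume) := by
  have hP := isProbabilityMeasure_gammaMeasure hp hr
  refine Integrable.mul_prod (f := fun a : ℝ => A + B * a + ‖(0 : ℂ)‖) ?_
    (integrable_exp_mul_abs_sub_cosh (|p| + 1) hm)
  have := integrable_pow_gammaMeasure hp hr 1
  simp only [pow_one] at this
  exact ((integrable_const A).add (this.const_mul B)).add (integrable_const _)

theorem ae_prod_gammaMeasure_pos {p r : ℝ} (hp : 0 < p) (hr : 0 < r) :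
    ∀ᵐ y ∂((gammaMeasure p r).prod (volume : Measure ℝ)), 0 < y.1 := by
  have hP := isProbabilityMeasure_gammaMeasure hp hr
  exact Measure.quasiMeasurePreserving_fst.ae (ae_gammaMeasure_pos p r)

theorem integrable_gammaLogIntegrand {p r : ℝ} (hp : 0 < p) (hr : 0 < r) {z : ℂ} (hz : 0 < z.re)
    {x : ℂ} (hx : 0 < x.re) :
    Integrable (gammaLogIntegrand p r z x) ((gammaMeasure p r).prod volume) := by
  refine (integrable_gammaLog_bound hp hr hx (|Real.log (z.re / ‖z‖)| + Real.pi + ‖z‖)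
    (‖z‖ * (r / x.re))).mono' (measurable_gammaLogIntegrand p r z x).aestronglyMeasurable ?_
  filter_upwards [ae_prod_gammaMeasure_pos hp hr] with y hy
  refine (norm_gammaLogIntegrand_le hr hz hx le_rfl hy.le).trans_eq ?_
  rw [norm_zero]; ring

/-- For real `x` this is the invariance of the generalised inverse Gaussian law applied to `w ↦ log
(1 + zw)`; both sides are holomorphic in `x`. -/
theorem integral_gammaLogIntegrand {p r : ℝ} (hp : 0 < p) (hr : 0 < r) {z : ℂ} (hz : 0 < z.re)
    {x : ℂ} (hx : 0 < x.re) :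
    ∫ y, gammaLogIntegrand p r z x y ∂((gammaMeasure p r).prod volume) = logInt p z x := by
  refine eqOn_rightHalfPlane (f := fun x => ∫ y, gammaLogIntegrand p r z x y
    ∂((gammaMeasure p r).prod volume)) ?_ (differentiableOn_coshLaplace
    ((expBounded_log hz).mul (expBounded_exp p)) (by fun_prop)) (fun x hx => ?_) hx
  · refine differentiableOn_integral_of_locally_dominated isOpen_rightHalfPlane ?_
      (fun x _ => (measurable_gammaLogIntegrand p r z x).aestronglyMeasurable) ?_
    · filter_upwards [ae_prod_gammaMeasure_pos hp hr] with y hy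
      unfold gammaLogIntegrand
      refine ((DifferentiableOn.clog ?_ ?_).mul (by fun_prop)).mul (by fun_prop)
      · refine DifferentiableOn.const_add _ (DifferentiableOn.const_mul (DifferentiableOn.add_const _
          (DifferentiableOn.div (by fun_prop) (by fun_prop) ?_)) _)
        rintro x hx rfl
        simp [mem_rightHalfPlane] at hx
      · intro x hx
        refine one_add_mul_mem_slitPlane hz ?_
        rw [Complex.add_re]
        linarith [re_mul_div_nonneg hy.le hr.le (le_of_lt hx), re_exp_neg_pos y.2]
    · intro x₀ hx₀
      have hx₀' : 0 < x₀.re := hx₀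
      refine ⟨x₀.re / 2, _, by linarith, integrable_gammaLog_bound hp hr (m := x₀.re / 2)
        (by linarith) (|Real.log (z.re / ‖z‖)| + Real.pi + ‖z‖) (‖z‖ * (r / (x₀.re / 2))), ?_⟩
      filter_upwards [ae_prod_gammaMeasure_pos hp hr] with y hy x hx
      have h1 : x₀.re / 2 ≤ x.re := by
        rw [mem_ball_iff_norm] at hx
        have := (abs_le.1 (Complex.abs_re_le_norm (x - x₀))).1
        simp at this
        linarith
      refine (norm_gammaLogIntegrand_le hr hz (by linarith) h1 hy.le).trans_eq ?_
      rw [norm_zero]; ring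
  · have h := integral_gamma_gig hp hr hx (f := fun w => Complex.log (1 + z * w)) (by fun_prop)
    refine Eq.trans ?_ (h.trans ?_)
    · refine integral_congr_ae (Eventually.of_forall fun y => ?_)
      simp only [gammaLogIntegrand, gigDensity]
      push_cast
      ring_nf
    · simp only [coshLaplace]
      refine integral_congr_ae (Eventually.of_forall fun t => ?_)
      simp only [gigDensity]
      push_cast
      ring_nf

theorem logInt_add_inv {p : ℝ} {z w x : ℂ} (hz : 0 < z.re) (hw : 0 ≤ w.re) (hx : 0 < x.re)
    (hi : Integrable fun t : ℝ => Complex.log (1 + z * (w + Complex.exp (-t))) *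
      Complex.exp (p * t) * Complex.exp (-2 * x * Complex.cosh t)) :
    logInt p (w + z⁻¹) x = besselLogInt p x - Complex.log z * besselInt p x +
      ∫ t : ℝ, Complex.log (1 + z * (w + Complex.exp (-t))) *
        Complex.exp (p * t) * Complex.exp (-2 * x * Complex.cosh t) := by
  have i1 := (expBounded_ofReal.mul (expBounded_exp p)).integrable (by fun_prop) hx
  have i2 := ((expBounded_exp p).integrable (by fun_prop) hx).const_mul (Complex.log z)
  rw [logInt, besselLogInt, besselInt, coshLaplace, coshLaplace, coshLaplace,
    ← integral_const_mul, ← integral_sub i1 i2]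
  refine Eq.trans ?_ (integral_add (i1.sub i2) hi)
  refine integral_congr_ae (Eventually.of_forall fun t => ?_)
  simp only
  have := log_add_log_one_add (t := t) hz hw
  linear_combination (Complex.exp (p * t) * Complex.exp (-2 * x * Complex.cosh t)) * this

/-- Integrate the identity `log_add_log_one_add` against the complex weight in `t`, then over `a`.
The double integral on the right collapses by invariance. After division by `besselInt p x` and
taking real parts, this is the Poisson equation. -/
theorem integral_logInt_gammaMeasure {p r : ℝ} (hp : 0 < p) (hr : 0 < r) {z : ℂ} (hz : 0 < z.re)
    {x : ℂ} (hx : 0 < x.re) :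
    ∫ a : ℝ, logInt p (a * r / x + z⁻¹) x ∂gammaMeasure p r =
      besselLogInt p x - Complex.log z * besselInt p x + logInt p z x := by
  have hP := isProbabilityMeasure_gammaMeasure hp hr
  have hI := integrable_gammaLogIntegrand hp hr hz hx
  have h1 : ∀ᵐ a : ℝ ∂gammaMeasure p r, logInt p ((a : ℂ) * r / x + z⁻¹) x =
      besselLogInt p x - Complex.log z * besselInt p x +
        ∫ t : ℝ, gammaLogIntegrand p r z x (a, t) := by
    filter_upwards [ae_gammaMeasure_pos p r, hI.prod_right_ae] with a ha hia
    exact logInt_add_inv hz (re_mul_div_nonneg ha.le hr.le hx.le) hx hia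
  rw [integral_congr_ae h1, integral_add (integrable_const _) hI.integral_prod_left,
    ← integral_prod _ hI, integral_gammaLogIntegrand hp hr hz hx]
  simp

/-! ### Extension to the closed half plane -/

/-- This function and the next two are chosen so that `e^t φ(e^t)` is the integrand folded under `t
↦ -t`; the shift by `-1` in the exponents is the Jacobian `dt = du / u`. -/
noncomputable def besselRay (p : ℝ) (u : ℂ) : ℂ := u ^ ((p - 1 : ℝ) : ℂ) + u ^ ((-p - 1 : ℝ) : ℂ)

noncomputable def besselLogRay (p : ℝ) (u : ℂ) : ℂ :=
  Complex.log u * (u ^ ((p - 1 : ℝ) : ℂ) - u ^ ((-p - 1 : ℝ) : ℂ))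

noncomputable def logRay (p : ℝ) (z u : ℂ) : ℂ :=
  Complex.log (1 + z * u) * u ^ ((p - 1 : ℝ) : ℂ) +
    Complex.log (1 + z * u⁻¹) * u ^ ((-p - 1 : ℝ) : ℂ)

/-- The extension of `besselInt` to the closed half plane. -/
noncomputable def besselExt (p : ℝ) : ℂ → ℂ := rayIntegral (besselRay p)

/-- The extension of `besselLogInt` to the closed half plane. -/
noncomputable def besselLogExt (p : ℝ) : ℂ → ℂ := rayIntegral (besselLogRay p)

/-- The extension of `logInt` to the closed half plane. -/
noncomputable def logExt (p : ℝ) (z : ℂ) : ℂ → ℂ := rayIntegral (logRay p z)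

theorem norm_cpow_ofReal_le {u : ℂ} (hu : 1 ≤ u.re) {q : ℝ} {N : ℕ} (hq : q ≤ N) :
    ‖u ^ (q : ℂ)‖ ≤ ‖u‖ ^ N := by
  have h1 := one_le_norm_of_one_le_re hu
  rw [Complex.norm_cpow_real, ← Real.rpow_natCast]
  exact Real.rpow_le_rpow_of_exponent_le h1 hq

theorem norm_log_le_of_one_le_re {u : ℂ} (hu : 1 ≤ u.re) : ‖Complex.log u‖ ≤ 5 * ‖u‖ := by
  have h1 := one_le_norm_of_one_le_re hu
  have h2 := Complex.norm_log_le u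
  rw [abs_of_nonneg (Real.log_nonneg h1)] at h2
  have h3 := Real.log_le_sub_one_of_pos (by linarith : 0 < ‖u‖)
  linarith [Real.pi_le_four]

theorem inv_re_nonneg {u : ℂ} (hu : 0 ≤ u.re) : 0 ≤ u⁻¹.re := by
  rw [Complex.inv_re]; exact div_nonneg hu (Complex.normSq_nonneg u)

theorem norm_log_sub_log_le {z y : ℂ} {b : ℝ} (hb : 0 < b) (h1 : 1 + ‖z‖ ≤ b * ‖y‖)
    (h2 : ‖y‖ ≤ b * (1 + ‖z‖)) :
    ‖Complex.log y - Real.log (1 + ‖z‖)‖ ≤ Real.log b + Real.pi := by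
  have hz : 0 < 1 + ‖z‖ := by positivity
  have hy : 0 < ‖y‖ := by
    by_contra h
    have : ‖y‖ = 0 := le_antisymm (not_lt.1 h) (norm_nonneg _)
    rw [this] at h1; linarith
  refine (Complex.norm_le_abs_re_add_abs_im _).trans ?_
  rw [Complex.sub_re, Complex.sub_im, Complex.log_re, Complex.log_im, Complex.ofReal_re,
    Complex.ofReal_im, sub_zero]
  refine add_le_add ?_ (Complex.abs_arg_le_pi y)
  have e1 := Real.log_le_log hz h1
  have e2 := Real.log_le_log hy h2
  rw [Real.log_mul hb.ne' hy.ne'] at e1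
  rw [Real.log_mul hb.ne' hz.ne'] at e2
  rw [abs_le]
  constructor <;> linarith

/-- The bound is uniform in `z`. From `Re u ≥ 1` and `Re z > 0` one gets `|u| |1 + zu| ≥ 1` and `|1
+ zu| ≥ |z|`, so `|1 + zu|` and `1 + |z|` agree up to the factor `2|u|`. -/
theorem norm_log_one_add_mul_sub_le {z u : ℂ} (hz : 0 < z.re) (hu : 1 ≤ u.re) :
    ‖Complex.log (1 + z * u) - Real.log (1 + ‖z‖)‖ ≤ 10 * ‖u‖ := by
  have h1 := one_le_norm_of_one_le_re hu
  have hz0 : z ≠ 0 := by rintro rfl; simp at hz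
  have hu0 : u ≠ 0 := norm_pos_iff.1 (by linarith)
  have a1 : 1 ≤ ‖u‖ * ‖1 + z * u‖ := by
    have e : 1 + z * u = u * (u⁻¹ + z) := by field_simp
    have e2 : u⁻¹.re = u.re / ‖u‖ ^ 2 := by rw [Complex.inv_re, Complex.normSq_eq_norm_sq]
    have e3 : 1 / ‖u‖ ^ 2 ≤ ‖u⁻¹ + z‖ := by
      refine le_trans ?_ ((le_abs_self _).trans (Complex.abs_re_le_norm _))
      rw [Complex.add_re, e2]
      have : 1 / ‖u‖ ^ 2 ≤ u.re / ‖u‖ ^ 2 := by gcongr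
      linarith
    rw [e, norm_mul, ← mul_assoc, ← sq]
    have := mul_le_mul_of_nonneg_left e3 (sq_nonneg ‖u‖)
    rwa [mul_one_div_cancel (by positivity)] at this
  have a2 : ‖z‖ ≤ ‖1 + z * u‖ := by
    have e : 1 + z * u = z * (z⁻¹ + u) := by field_simp
    have e3 : 1 ≤ ‖z⁻¹ + u‖ := by
      refine le_trans ?_ ((le_abs_self _).trans (Complex.abs_re_le_norm _))
      rw [Complex.add_re]
      linarith [inv_re_nonneg hz.le]
    rw [e, norm_mul]
    exact le_mul_of_one_le_right (norm_nonneg z) e3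
  have a3 : ‖1 + z * u‖ ≤ 1 + ‖z‖ * ‖u‖ := by
    refine (norm_add_le _ _).trans ?_
    rw [norm_one, norm_mul]
  have a4 : ‖1 + z * u‖ ≤ ‖u‖ * ‖1 + z * u‖ := le_mul_of_one_le_left (norm_nonneg _) h1
  refine (norm_log_sub_log_le (b := 2 * ‖u‖) (by linarith) ?_ ?_).trans ?_
  · nlinarith
  · nlinarith [norm_nonneg z]
  · have := Real.log_le_sub_one_of_pos (by linarith : 0 < 2 * ‖u‖)
    linarith [Real.pi_le_four]

theorem norm_log_one_add_mul_inv_sub_le {z u : ℂ} (hz : 0 < z.re) (hu : 1 ≤ u.re) :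
    ‖Complex.log (1 + z * u⁻¹) - Real.log (1 + ‖z‖)‖ ≤ 10 * ‖u‖ := by
  have h1 := one_le_norm_of_one_le_re hu
  have hu0 : u ≠ 0 := norm_pos_iff.1 (by linarith)
  have a0 : ‖u‖ * ‖1 + z * u⁻¹‖ = ‖u + z‖ := by
    rw [← norm_mul]; congr 1; field_simp
  have a1 : 1 ≤ ‖u + z‖ := by
    refine le_trans ?_ ((le_abs_self _).trans (Complex.abs_re_le_norm _))
    rw [Complex.add_re]; linarith
  have a2 : ‖z‖ ≤ ‖u + z‖ + ‖u‖ := by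
    have := norm_sub_le (u + z) u
    simpa using this
  have a3 : ‖1 + z * u⁻¹‖ ≤ 1 + ‖z‖ := by
    refine (norm_add_le _ _).trans ?_
    rw [norm_one, norm_mul, norm_inv]
    gcongr
    exact mul_le_of_le_one_right (norm_nonneg z) (inv_le_one_of_one_le₀ h1)
  -- Here `1 + |z| ≤ 1 + |u + z| + |u| ≤ 3 |u| |u + z|`, and `|u + z| = |u| |1 + z u⁻¹|` supplies
  -- the second power of `|u|`.
  refine (norm_log_sub_log_le (b := 3 * ‖u‖ ^ 2) (by positivity) ?_ ?_).trans ?_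
  · have : 3 * ‖u‖ ^ 2 * ‖1 + z * u⁻¹‖ = 3 * ‖u‖ * ‖u + z‖ := by rw [← a0]; ring
    rw [this]
    nlinarith
  · have : 1 ≤ 3 * ‖u‖ ^ 2 := by nlinarith
    have h0 : 0 ≤ 1 + ‖z‖ := by positivity
    nlinarith
  · have e1 : Real.log (3 * ‖u‖ ^ 2) = Real.log 3 + 2 * Real.log ‖u‖ := by
      rw [Real.log_mul (by norm_num) (by positivity), Real.log_pow]; norm_num
    have e2 := Real.log_le_sub_one_of_pos (by linarith : 0 < ‖u‖)
    have e3 := Real.log_le_sub_one_of_pos (by norm_num : (0 : ℝ) < 3)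
    linarith [Real.pi_le_four]

theorem norm_besselRay_le {p : ℝ} (hp : 0 < p) {u : ℂ} (hu : 1 ≤ u.re) :
    ‖besselRay p u‖ ≤ 2 * ‖u‖ ^ ⌈p⌉₊ := by
  have h1 := norm_cpow_ofReal_le hu (q := p - 1) (N := ⌈p⌉₊) (by linarith [Nat.le_ceil p])
  have h2 := norm_cpow_ofReal_le hu (q := -p - 1) (N := ⌈p⌉₊)
    (by linarith [(Nat.cast_nonneg ⌈p⌉₊ : (0 : ℝ) ≤ _)])
  rw [besselRay]
  linarith [norm_add_le (u ^ ((p - 1 : ℝ) : ℂ)) (u ^ ((-p - 1 : ℝ) : ℂ))]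

theorem norm_besselLogRay_le {p : ℝ} (hp : 0 < p) {u : ℂ} (hu : 1 ≤ u.re) :
    ‖besselLogRay p u‖ ≤ 10 * ‖u‖ ^ (⌈p⌉₊ + 1) := by
  have h1 := norm_cpow_ofReal_le hu (q := p - 1) (N := ⌈p⌉₊) (by linarith [Nat.le_ceil p])
  have h2 := norm_cpow_ofReal_le hu (q := -p - 1) (N := ⌈p⌉₊)
    (by linarith [(Nat.cast_nonneg ⌈p⌉₊ : (0 : ℝ) ≤ _)])
  have h3 := norm_sub_le (u ^ ((p - 1 : ℝ) : ℂ)) (u ^ ((-p - 1 : ℝ) : ℂ))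
  rw [besselLogRay, norm_mul]
  calc _ ≤ (5 * ‖u‖) * (‖u‖ ^ ⌈p⌉₊ + ‖u‖ ^ ⌈p⌉₊) := by
        gcongr
        · exact norm_log_le_of_one_le_re hu
        · linarith
    _ = _ := by ring

theorem norm_logRay_sub_le {p : ℝ} (hp : 0 < p) {z u : ℂ} (hz : 0 < z.re) (hu : 1 ≤ u.re) :
    ‖logRay p z u - Real.log (1 + ‖z‖) * besselRay p u‖ ≤ 20 * ‖u‖ ^ (⌈p⌉₊ + 1) := by
  have h1 := norm_cpow_ofReal_le hu (q := p - 1) (N := ⌈p⌉₊) (by linarith [Nat.le_ceil p])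
  have h2 := norm_cpow_ofReal_le hu (q := -p - 1) (N := ⌈p⌉₊)
    (by linarith [(Nat.cast_nonneg ⌈p⌉₊ : (0 : ℝ) ≤ _)])
  have e : logRay p z u - Real.log (1 + ‖z‖) * besselRay p u =
      (Complex.log (1 + z * u) - Real.log (1 + ‖z‖)) * u ^ ((p - 1 : ℝ) : ℂ) +
      (Complex.log (1 + z * u⁻¹) - Real.log (1 + ‖z‖)) * u ^ ((-p - 1 : ℝ) : ℂ) := by
    rw [logRay, besselRay]; ring
  rw [e]
  refine (norm_add_le _ _).trans ?_
  rw [norm_mul, norm_mul]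
  calc _ ≤ 10 * ‖u‖ * ‖u‖ ^ ⌈p⌉₊ + 10 * ‖u‖ * ‖u‖ ^ ⌈p⌉₊ := by
        gcongr
        · exact norm_log_one_add_mul_sub_le hz hu
        · exact norm_log_one_add_mul_inv_sub_le hz hu
    _ = _ := by ring

theorem norm_logRay_le {p : ℝ} (hp : 0 < p) {z u : ℂ} (hz : 0 < z.re) (hu : 1 ≤ u.re) :
    ‖logRay p z u‖ ≤ (20 + 2 * Real.log (1 + ‖z‖)) * ‖u‖ ^ (⌈p⌉₊ + 1) := by
  have h1 := norm_logRay_sub_le hp hz hu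
  have h2 := norm_besselRay_le hp hu
  have h3 : 0 ≤ Real.log (1 + ‖z‖) := Real.log_nonneg (by linarith [norm_nonneg z])
  have h4 : ‖(Real.log (1 + ‖z‖) : ℂ) * besselRay p u‖ ≤
      Real.log (1 + ‖z‖) * (2 * ‖u‖ ^ (⌈p⌉₊ + 1)) := by
    rw [norm_mul, Complex.norm_real, Real.norm_of_nonneg h3]
    gcongr
    refine h2.trans ?_
    gcongr
    · exact one_le_norm_of_one_le_re hu
    · omega
  have h5 := norm_add_le (logRay p z u - Real.log (1 + ‖z‖) * besselRay p u)
    (Real.log (1 + ‖z‖) * besselRay p u)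
  rw [sub_add_cancel] at h5
  linarith

theorem differentiableOn_cpow_rightHalfPlane (q : ℂ) :
    DifferentiableOn ℂ (fun u : ℂ => u ^ q) rightHalfPlane := fun _ hu =>
  (differentiableAt_id.cpow_const (Or.inl hu)).differentiableWithinAt

theorem ne_zero_of_mem_rightHalfPlane {x : ℂ} (hx : x ∈ rightHalfPlane) : x ≠ 0 := by
  rintro rfl
  simp [mem_rightHalfPlane] at hx

theorem differentiableOn_besselRay (p : ℝ) : DifferentiableOn ℂ (besselRay p) rightHalfPlane :=
  (differentiableOn_cpow_rightHalfPlane _).add (differentiableOn_cpow_rightHalfPlane _)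

theorem differentiableOn_besselLogRay (p : ℝ) :
    DifferentiableOn ℂ (besselLogRay p) rightHalfPlane :=
  (differentiableOn_id.clog fun _ hu => Or.inl hu).mul
    ((differentiableOn_cpow_rightHalfPlane _).sub (differentiableOn_cpow_rightHalfPlane _))

theorem differentiableOn_logRay (p : ℝ) {z : ℂ} (hz : 0 < z.re) :
    DifferentiableOn ℂ (logRay p z) rightHalfPlane := by
  refine DifferentiableOn.add (DifferentiableOn.mul (DifferentiableOn.clog (by fun_prop) ?_)
    (differentiableOn_cpow_rightHalfPlane _)) (DifferentiableOn.mul (DifferentiableOn.clog ?_ ?_)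
    (differentiableOn_cpow_rightHalfPlane _))
  · exact fun u hu => one_add_mul_mem_slitPlane hz (le_of_lt hu)
  · exact (differentiableOn_const _).add ((differentiableOn_const _).mul
      (differentiableOn_inv.mono fun u hu => ne_zero_of_mem_rightHalfPlane hu))
  · exact fun u hu => one_add_mul_mem_slitPlane hz (inv_re_nonneg (le_of_lt hu))

theorem cexp_cpow_ofReal (t q : ℝ) : Complex.exp t ^ (q : ℂ) = Complex.exp (q * t) := by
  rw [Complex.cpow_def_of_ne_zero (Complex.exp_ne_zero _), ← Complex.ofReal_exp,
    ← Complex.ofReal_log (Real.exp_pos t).le, Real.log_exp, mul_comm]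

theorem log_cexp_ofReal (t : ℝ) : Complex.log (Complex.exp t) = t := by
  rw [← Complex.ofReal_exp, ← Complex.ofReal_log (Real.exp_pos t).le, Real.log_exp]

theorem besselInt_eq_ext {p : ℝ} (hp : 0 < p) {x : ℂ} (hx : 0 < x.re) :
    besselInt p x = besselExt p x := by
  refine coshLaplace_eq_rayIntegral (expBounded_exp p) (by fun_prop)
    (differentiableOn_besselRay p) (fun u hu => norm_besselRay_le hp hu) (fun t _ => ?_) hx
  rw [besselRay, cexp_cpow_ofReal, cexp_cpow_ofReal, mul_add, ← Complex.exp_add, ← Complex.exp_add]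
  push_cast
  congr 2 <;> ring

theorem besselLogInt_eq_ext {p : ℝ} (hp : 0 < p) {x : ℂ} (hx : 0 < x.re) :
    besselLogInt p x = besselLogExt p x := by
  refine coshLaplace_eq_rayIntegral (expBounded_ofReal.mul (expBounded_exp p)) (by fun_prop)
    (differentiableOn_besselLogRay p) (fun u hu => norm_besselLogRay_le hp hu) (fun t _ => ?_) hx
  have e1 : Complex.exp (p * t) = Complex.exp t * Complex.exp ((p - 1 : ℝ) * t) := by
    rw [← Complex.exp_add]; push_cast; ring_nf
  have e2 : Complex.exp (p * (-t : ℝ)) = Complex.exp t * Complex.exp ((-p - 1 : ℝ) * t) := by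
    rw [← Complex.exp_add]; push_cast; ring_nf
  rw [besselLogRay, cexp_cpow_ofReal, cexp_cpow_ofReal, log_cexp_ofReal, e1, e2]
  push_cast
  ring

theorem logInt_eq_ext {p : ℝ} (hp : 0 < p) {z x : ℂ} (hz : 0 < z.re) (hx : 0 < x.re) :
    logInt p z x = logExt p z x := by
  refine coshLaplace_eq_rayIntegral ((expBounded_log hz).mul (expBounded_exp p)) (by fun_prop)
    (differentiableOn_logRay p hz) (fun u hu => norm_logRay_le hp hz hu) (fun t _ => ?_) hx
  have e1 : Complex.exp (p * t) = Complex.exp t * Complex.exp ((p - 1 : ℝ) * t) := by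
    rw [← Complex.exp_add]; push_cast; ring_nf
  have e2 : Complex.exp (p * (-t : ℝ)) = Complex.exp t * Complex.exp ((-p - 1 : ℝ) * t) := by
    rw [← Complex.exp_add]; push_cast; ring_nf
  rw [logRay, cexp_cpow_ofReal, cexp_cpow_ofReal, e1, e2, Complex.ofReal_neg, Complex.exp_neg]
  ring

theorem rightHalfPlane_superset {u : ℂ} (hu : 1 ≤ u.re) : u ∈ rightHalfPlane := by
  rw [mem_rightHalfPlane]; linarith

theorem DifferentiableOn.continuousOn_one_le_re {φ : ℂ → ℂ}
    (h : DifferentiableOn ℂ φ rightHalfPlane) : ContinuousOn φ {u | 1 ≤ u.re} :=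
  h.continuousOn.mono fun _ hu => rightHalfPlane_superset hu

theorem tendsto_comp_ray {ι : Type*} {l : Filter ι} {x : ι → ℂ} {x₀ : ℂ} (hx : Tendsto x l (𝓝 x₀))
    (hx₀ : x₀ ≠ 0) (r : ℝ) : Tendsto (fun i => 1 + (r : ℂ) / x i) l (𝓝 (1 + (r : ℂ) / x₀)) :=
  tendsto_const_nhds.add (tendsto_const_nhds.div hx hx₀)

theorem tendsto_rayIntegral_fixed {φ : ℂ → ℂ} (hd : DifferentiableOn ℂ φ rightHalfPlane)
    {C : ℝ} {N : ℕ} (hφ : ∀ u : ℂ, 1 ≤ u.re → ‖φ u‖ ≤ C * ‖u‖ ^ N) {ι : Type*} {l : Filter ι}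
    [l.IsCountablyGenerated] {x : ι → ℂ} {x₀ : ℂ} (hx : Tendsto x l (𝓝 x₀)) (hx₀ : x₀ ≠ 0)
    (hre : ∀ᶠ i in l, 0 ≤ (x i).re) (hre₀ : 0 ≤ x₀.re) :
    Tendsto (fun i => rayIntegral φ (x i)) l (𝓝 (rayIntegral φ x₀)) := by
  refine tendsto_rayIntegral hx hx₀ hre (Eventually.of_forall fun _ => hφ)
    (Eventually.of_forall fun _ => hd.continuousOn_one_le_re) hre₀ fun r hr => ?_
  have hm := rightHalfPlane_superset (one_le_re_one_add_div hre₀ hr.le)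
  exact ((hd.continuousOn.continuousAt (isOpen_rightHalfPlane.mem_nhds hm)).tendsto).comp
    (tendsto_comp_ray hx hx₀ r)

theorem tendsto_logExt {p : ℝ} (hp : 0 < p) {ι : Type*} {l : Filter ι}
    [l.IsCountablyGenerated] {x z : ι → ℂ} {x₀ z₀ : ℂ} (hx : Tendsto x l (𝓝 x₀)) (hx₀ : x₀ ≠ 0)
    (hre : ∀ᶠ i in l, 0 ≤ (x i).re) (hre₀ : 0 ≤ x₀.re) (hz : Tendsto z l (𝓝 z₀))
    (hz₀ : 0 < z₀.re) : Tendsto (fun i => logExt p (z i) (x i)) l (𝓝 (logExt p z₀ x₀)) := by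
  have hzre : ∀ᶠ i in l, 0 < (z i).re := hz (isOpen_rightHalfPlane.mem_nhds hz₀)
  have hzn : ∀ᶠ i in l, ‖z i‖ ≤ ‖z₀‖ + 1 := hz.norm.eventually (eventually_le_nhds (by linarith))
  refine tendsto_rayIntegral (C := 20 + 2 * Real.log (1 + (‖z₀‖ + 1))) (N := ⌈p⌉₊ + 1) hx hx₀ hre
    ?_ ?_ hre₀ fun r hr => ?_
  · filter_upwards [hzre, hzn] with i h1 h2 u hu
    refine (norm_logRay_le hp h1 hu).trans ?_
    gcongr
  · filter_upwards [hzre] with i h1 using (differentiableOn_logRay p h1).continuousOn_one_le_re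
  · have h1 := one_le_re_one_add_div hre₀ hr.le
    have h2 := tendsto_comp_ray hx hx₀ r
    have hm := rightHalfPlane_superset h1
    have hs : 1 + (r : ℂ) / x₀ ∈ Complex.slitPlane := Or.inl hm
    have h3 : ∀ q : ℂ, Tendsto (fun i => (1 + (r : ℂ) / x i) ^ q) l (𝓝 ((1 + (r : ℂ) / x₀) ^ q)) :=
      fun q => h2.cpow tendsto_const_nhds hs
    unfold logRay
    refine ((Tendsto.clog (tendsto_const_nhds.add (hz.mul h2)) ?_).mul (h3 _)).add
      ((Tendsto.clog (tendsto_const_nhds.add (hz.mul (h2.inv₀ ?_))) ?_).mul (h3 _))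
    · exact one_add_mul_mem_slitPlane hz₀ (by linarith)
    · exact ne_zero_of_mem_rightHalfPlane hm
    · exact one_add_mul_mem_slitPlane hz₀ (inv_re_nonneg (by linarith))

/-- The right side does not depend on `z`. This is what makes the solution of the Poisson equation
differ from `log (1 + ‖z‖)` by a bounded amount. -/
theorem norm_logExt_sub_le {p : ℝ} (hp : 0 < p) {z x : ℂ} (hz : 0 < z.re) (hx : 0 ≤ x.re)
    (hx0 : x ≠ 0) : ‖logExt p z x - Real.log (1 + ‖z‖) * besselExt p x‖ ≤
      20 * rayWeight x (⌈p⌉₊ + 1) := by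
  have i1 := integrableOn_rayIntegrand (differentiableOn_logRay p hz).continuousOn_one_le_re
    (fun u hu => norm_logRay_le hp hz hu) hx hx0
  have i2 := (integrableOn_rayIntegrand (differentiableOn_besselRay p).continuousOn_one_le_re
    (fun u hu => norm_besselRay_le hp hu) hx hx0).const_mul (Real.log (1 + ‖z‖) : ℂ)
  have h := norm_rayIntegral_le (φ := fun u => logRay p z u - Real.log (1 + ‖z‖) * besselRay p u)
    (fun u hu => norm_logRay_sub_le hp hz hu) hx hx0
  have e : rayIntegral (fun u => logRay p z u - Real.log (1 + ‖z‖) * besselRay p u) x =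
      logExt p z x - Real.log (1 + ‖z‖) * besselExt p x := by
    rw [logExt, besselExt, rayIntegral, rayIntegral, rayIntegral, ← integral_const_mul,
      ← integral_sub i1 i2]
    refine integral_congr_ae (Eventually.of_forall fun r => ?_)
    simp only [rayIntegrand]
    ring
  rwa [e] at h

/-! ### Nonvanishing of the Bessel integral, and the Poisson equation on the closed half plane. -/

theorem besselInt_ofReal (p y : ℝ) :
    besselInt p y = ((∫ t : ℝ, gigDensity p y t : ℝ) : ℂ) := by
  rw [← integral_complex_ofReal]
  simp only [besselInt, coshLaplace, gigDensity]
  refine integral_congr_ae (Eventually.of_forall fun t => ?_)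
  push_cast
  rfl

theorem integrable_gigDensity (p : ℝ) {y : ℝ} (hy : 0 < y) : Integrable (gigDensity p y) := by
  refine ((expBounded_exp p).integrable (by fun_prop) (x := y) (by simpa using hy)).re.congr
    (Eventually.of_forall fun t => ?_)
  have : Complex.exp (p * t) * Complex.exp (-2 * y * Complex.cosh t) =
      ((gigDensity p y t : ℝ) : ℂ) := by
    rw [gigDensity]; push_cast; rfl
  simp only [this]
  exact Complex.ofReal_re _

theorem besselInt_ofReal_ne_zero (p : ℝ) {y : ℝ} (hy : 0 < y) : besselInt p y ≠ 0 := by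
  rw [besselInt_ofReal]
  have : 0 < ∫ t : ℝ, gigDensity p y t := by
    rw [integral_pos_iff_support_of_nonneg (fun t => (gigDensity_pos p y t).le)
      (integrable_gigDensity p hy)]
    have : Function.support (gigDensity p y) = Set.univ :=
      Set.eq_univ_of_forall fun t => (gigDensity_pos p y t).ne'
    simp [this]
  exact_mod_cast this.ne'

theorem exists_seq_rightHalfPlane {x : ℂ} (hx : 0 ≤ x.re) :
    ∃ u : ℕ → ℂ, Tendsto u atTop (𝓝 x) ∧ ∀ n, 0 < (u n).re := by
  refine ⟨fun n => x + ((1 / ((n : ℝ) + 1) : ℝ) : ℂ), ?_, fun n => ?_⟩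
  · have := ((Complex.continuous_ofReal.tendsto 0).comp
      (tendsto_one_div_add_atTop_nhds_zero_nat (𝕜 := ℝ))).const_add x
    simpa using this
  · have : (0 : ℝ) < 1 / ((n : ℝ) + 1) := by positivity
    rw [Complex.add_re, Complex.ofReal_re]
    linarith

/-- The lower bound `norm_besselInt_norm_le` passes to the limit along points `u n` of the open half
plane: its left side tends to the value at `‖x‖ > 0`, which is not zero. -/
theorem besselExt_ne_zero {p : ℝ} (hp : 0 < p) {x : ℂ} (hx : 0 ≤ x.re) (hx0 : x ≠ 0) :
    besselExt p x ≠ 0 := by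
  obtain ⟨u, hu, hure⟩ := exists_seq_rightHalfPlane hx
  have h1 := (tendsto_rayIntegral_fixed (differentiableOn_besselRay p)
    (fun u hu => norm_besselRay_le hp hu) hu hx0 (Eventually.of_forall fun n => (hure n).le) hx).norm
  have hn : 0 < ‖x‖ := norm_pos_iff.2 hx0
  have h2 : Tendsto (fun n => ‖besselInt p ‖u n‖‖) atTop (𝓝 ‖besselInt p ‖x‖‖) := by
    have hc := ((differentiableOn_coshLaplace (expBounded_exp p) (by fun_prop)).continuousOn
      |>.continuousAt (isOpen_rightHalfPlane.mem_nhds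
        (show (‖x‖ : ℂ) ∈ rightHalfPlane by simpa [mem_rightHalfPlane] using hx0))).tendsto
    exact (hc.comp ((Complex.continuous_ofReal.tendsto _).comp hu.norm)).norm
  have h3 := le_of_tendsto_of_tendsto' h2 h1 fun n => by
    have := norm_besselInt_norm_le p (hure n)
    rwa [besselInt_eq_ext hp (hure n)] at this
  have h4 := norm_pos_iff.2 (besselInt_ofReal_ne_zero p hn)
  exact norm_pos_iff.1 (h4.trans_le h3)

/-- Take the limit of the Poisson equation along points of the open half plane; the growth in `a` is
at most linear, uniformly along the sequence. -/
theorem integral_logExt_gammaMeasure {p r : ℝ} (hp : 0 < p) (hr : 0 < r) {z : ℂ} (hz : 0 < z.re)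
    {x : ℂ} (hx : 0 ≤ x.re) (hx0 : x ≠ 0) :
    ∫ a : ℝ, logExt p (a * r / x + z⁻¹) x ∂gammaMeasure p r =
      besselLogExt p x - Complex.log z * besselExt p x + logExt p z x := by
  have hP := isProbabilityMeasure_gammaMeasure hp hr
  obtain ⟨u, hu, hure⟩ := exists_seq_rightHalfPlane hx
  have hure' : ∀ᶠ n in atTop, 0 ≤ (u n).re := Eventually.of_forall fun n => (hure n).le
  have hzi : 0 < z⁻¹.re := by
    rw [Complex.inv_re]
    exact div_pos hz (Complex.normSq_pos.2 (by rintro rfl; simp at hz))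
  have hre : ∀ {a : ℝ} {y : ℂ}, 0 < a → 0 ≤ y.re → 0 < ((a : ℂ) * r / y + z⁻¹).re := by
    intro a y ha hy
    rw [Complex.add_re]
    linarith [re_mul_div_nonneg ha.le hr.le hy]
  have hn : 0 < ‖x‖ := norm_pos_iff.2 hx0
  have hun : ∀ᶠ n in atTop, ‖x‖ / 2 ≤ ‖u n‖ := hu.norm.eventually (eventually_ge_nhds (by linarith))
  have hun' : ∀ᶠ n in atTop, ‖u n‖ ≤ 2 * ‖x‖ := hu.norm.eventually (eventually_le_nhds (by linarith))
  set N := ⌈p⌉₊ + 1 with hN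
  -- One constant dominating `rayWeight (u n) N` as long as `‖u n‖` stays between `‖x‖ / 2` and `2
  -- ‖x‖`.
  set W : ℝ := ∫ ρ in Set.Ioi (0 : ℝ), 1 * ((‖x‖ / 2)⁻¹ * Real.exp (2 * ‖x‖)) *
    ((1 + ρ / (‖x‖ / 2)) ^ N * Real.exp (-ρ)) with hW
  have hWb : ∀ᶠ n in atTop, rayWeight (u n) N ≤ W := by
    filter_upwards [hun, hun'] with n h1 h2
    refine setIntegral_mono_on (integrableOn_ray_bound (norm_pos_iff.1 (by linarith)) N)
      ((integrableOn_one_add_mul_pow_mul_exp (by linarith) N).const_mul _) measurableSet_Ioi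
      fun ρ hρ => ?_
    have := ray_bound_mono (N := N) zero_le_one (le_of_lt hρ) (by linarith : 0 < ‖x‖ / 2) h1 h2
    rwa [one_mul] at this
  have T1 : Tendsto (fun n => ∫ a : ℝ, logExt p (a * r / u n + z⁻¹) (u n) ∂gammaMeasure p r) atTop
      (𝓝 (∫ a : ℝ, logExt p (a * r / x + z⁻¹) x ∂gammaMeasure p r)) := by
    refine tendsto_integral_filter_of_dominated_convergence
      (fun a => (20 + 2 * (a * (r / (‖x‖ / 2)) + ‖z⁻¹‖)) * W) ?_ ?_ ?_ ?_
    · refine Eventually.of_forall fun n => ?_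
      -- Measurability in `a` comes from Fubini: up to a constant the function is a partial integral
      -- of `gammaLogIntegrand`.
      have hm : AEStronglyMeasurable (fun a : ℝ => logInt p ((a : ℂ) * r / u n + z⁻¹) (u n))
          (gammaMeasure p r) := by
        have hI := (integrable_gammaLogIntegrand hp hr hz (hure n))
        refine ((hI.integral_prod_left.aestronglyMeasurable).const_add
          (besselLogInt p (u n) - Complex.log z * besselInt p (u n))).congr ?_
        filter_upwards [ae_gammaMeasure_pos p r, hI.prod_right_ae] with a ha hia
        exact (logInt_add_inv hz (re_mul_div_nonneg ha.le hr.le (hure n).le) (hure n) hia).symm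
      refine hm.congr ?_
      filter_upwards [ae_gammaMeasure_pos p r] with a ha
      exact logInt_eq_ext hp (hre ha (hure n).le) (hure n)
    · filter_upwards [hWb, hun] with n hn1 hn2
      filter_upwards [ae_gammaMeasure_pos p r] with a ha
      have hz' := hre ha (hure n).le
      have hun0 : u n ≠ 0 := ne_zero_of_mem_rightHalfPlane (hure n)
      have b1 := norm_rayIntegral_le (fun w hw => norm_logRay_le hp hz' hw) (hure n).le hun0
      have hnn : ‖(a : ℂ) * r / u n + z⁻¹‖ ≤ a * (r / (‖x‖ / 2)) + ‖z⁻¹‖ := by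
        refine (norm_add_le _ _).trans (add_le_add ?_ le_rfl)
        rw [norm_div, norm_mul, Complex.norm_real, Complex.norm_real, Real.norm_of_nonneg ha.le,
          Real.norm_of_nonneg hr.le, mul_div_assoc]
        gcongr
      have hlog : Real.log (1 + ‖(a : ℂ) * r / u n + z⁻¹‖) ≤ a * (r / (‖x‖ / 2)) + ‖z⁻¹‖ := by
        have := Real.log_le_sub_one_of_pos
          (by positivity : 0 < 1 + ‖(a : ℂ) * r / u n + z⁻¹‖)
        linarith
      have hlog0 : 0 ≤ Real.log (1 + ‖(a : ℂ) * r / u n + z⁻¹‖) :=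
        Real.log_nonneg (by linarith [norm_nonneg ((a : ℂ) * r / u n + z⁻¹)])
      refine b1.trans ?_
      refine mul_le_mul (by linarith) hn1 ?_ (by positivity)
      exact setIntegral_nonneg measurableSet_Ioi fun ρ hρ => by
        have : 0 < ρ := hρ
        positivity
    · have := integrable_pow_gammaMeasure hp hr 1
      simp only [pow_one] at this
      exact ((integrable_const 20).add (((this.mul_const _).add (integrable_const _)).const_mul 2)).mul_const W
    · filter_upwards [ae_gammaMeasure_pos p r] with a ha
      exact tendsto_logExt hp hu hx0 hure' hx
        ((tendsto_const_nhds.div hu hx0).add tendsto_const_nhds) (hre ha hx)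
  have T2 := tendsto_rayIntegral_fixed (differentiableOn_besselLogRay p)
    (fun u hu => norm_besselLogRay_le hp hu) hu hx0 hure' hx
  have T3 := tendsto_rayIntegral_fixed (differentiableOn_besselRay p)
    (fun u hu => norm_besselRay_le hp hu) hu hx0 hure' hx
  have T4 := tendsto_logExt hp hu hx0 hure' hx (tendsto_const_nhds (x := z)) hz
  refine tendsto_nhds_unique T1 (((T2.sub (T3.const_mul (Complex.log z))).add T4).congr fun n => ?_)
  have h := integral_logInt_gammaMeasure hp hr hz (hure n)
  rw [besselLogInt_eq_ext hp (hure n), besselInt_eq_ext hp (hure n),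
    logInt_eq_ext hp hz (hure n)] at h
  rw [besselLogExt, besselExt] at h
  rw [← h]
  refine integral_congr_ae ?_
  filter_upwards [ae_gammaMeasure_pos p r] with a ha
  exact logInt_eq_ext hp (hre ha (hure n).le) (hure n)

/-! ### A law of large numbers for centred additive functionals -/

/-- The orbit of `z₀` under the random maps `step · (a n)`. -/
def randomOrbit {E : Type*} (step : E → ℝ → E) (z₀ : E) (a : ℕ → ℝ) : ℕ → E
  | 0 => z₀
  | n + 1 => step (randomOrbit step z₀ a n) (a n)

theorem randomOrbit_congr {E : Type*} (step : E → ℝ → E) (z₀ : E) {a b : ℕ → ℝ} {n : ℕ}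
    (h : ∀ k < n, a k = b k) : randomOrbit step z₀ a n = randomOrbit step z₀ b n := by
  induction n with
  | zero => rfl
  | succ n ih =>
    simp only [randomOrbit]
    rw [ih fun k hk => h k (by omega), h n (by omega)]

theorem measurable_randomOrbit {E : Type*} [MeasurableSpace E] {step : E → ℝ → E}
    (hstep : Measurable (Function.uncurry step)) (z₀ : E) (n : ℕ) :
    Measurable fun a => randomOrbit step z₀ a n := by
  induction n with
  | zero => exact measurable_const
  | succ n ih => exact hstep.comp (ih.prodMk (measurable_pi_apply n))

/-- The additive functional of the random orbit with increments `D`. -/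
def orbitSum {E : Type*} (step : E → ℝ → E) (D : E → ℝ → ℝ) (z₀ : E) (a : ℕ → ℝ) (n : ℕ) : ℝ :=
  ∑ k ∈ Finset.range n, D (randomOrbit step z₀ a k) (a k)

theorem orbitSum_congr {E : Type*} (step : E → ℝ → E) (D : E → ℝ → ℝ) (z₀ : E) {a b : ℕ → ℝ}
    {n : ℕ} (h : ∀ k < n, a k = b k) : orbitSum step D z₀ a n = orbitSum step D z₀ b n := by
  refine Finset.sum_congr rfl fun k hk => ?_
  have hk : k < n := Finset.mem_range.1 hk
  rw [randomOrbit_congr step z₀ fun j hj => h j (by omega), h k hk]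

theorem measurable_orbitSum {E : Type*} [MeasurableSpace E] {step : E → ℝ → E}
    (hstep : Measurable (Function.uncurry step)) {D : E → ℝ → ℝ}
    (hD : Measurable (Function.uncurry D)) (z₀ : E) (n : ℕ) :
    Measurable fun a => orbitSum step D z₀ a n :=
  Finset.measurable_sum _ fun k _ =>
    hD.comp ((measurable_randomOrbit hstep z₀ k).prodMk (measurable_pi_apply k))

/-- Such a `V` factors through the first `n` coordinates, via extension of a finite sequence by
zeros; the value used for the extension is immaterial. -/
theorem indepFun_of_congr {γ : Measure ℝ} [IsProbabilityMeasure γ] {F : Type*} [MeasurableSpace F]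
    {V : (ℕ → ℝ) → F} (hV : Measurable V) {n : ℕ}
    (h : ∀ a b : ℕ → ℝ, (∀ k < n, a k = b k) → V a = V b) :
    IndepFun V (fun a => a n) (Measure.infinitePi fun _ : ℕ => γ) := by
  have hi := iIndepFun_infinitePi (P := fun _ : ℕ => γ) (X := fun _ x => x) (fun _ => measurable_id)
  have hf := hi.indepFun_finset (Finset.range n) {n} (by simp) (fun i => measurable_pi_apply i)
  set ext : (Finset.range n → ℝ) → ℕ → ℝ := fun v i => if h : i ∈ Finset.range n then v ⟨i, h⟩ else 0
    with hext
  have hem : Measurable ext := by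
    refine measurable_pi_lambda _ fun i => ?_
    by_cases h : i ∈ Finset.range n
    · simp only [hext, h, dite_true]; exact measurable_pi_apply _
    · simp only [hext, h, dite_false]; exact measurable_const
  have hpm : Measurable fun v : ({n} : Finset ℕ) → ℝ => v ⟨n, by simp⟩ := measurable_pi_apply _
  have h2 := hf.comp (hV.comp hem) hpm
  convert h2 using 1
  · funext a
    refine h _ _ fun k hk => ?_
    simp [hext, hk]
  · rfl

/-- The sum and orbit up to time `n` are independent of `a n`, so each step costs at most one factor
`B`, uniformly in the current position. No martingale theory is involved. -/
theorem lintegral_exp_orbitSum_le {E : Type*} [MeasurableSpace E] {γ : Measure ℝ}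
    [IsProbabilityMeasure γ] {step : E → ℝ → E} (hstep : Measurable (Function.uncurry step))
    {D : E → ℝ → ℝ} (hD : Measurable (Function.uncurry D)) {δ : ℝ} {B : ENNReal}
    (hB : ∀ z, ∫⁻ a, ENNReal.ofReal (Real.exp (δ * D z a)) ∂γ ≤ B) (z₀ : E) (n : ℕ) :
    ∫⁻ a, ENNReal.ofReal (Real.exp (δ * orbitSum step D z₀ a n))
      ∂(Measure.infinitePi fun _ : ℕ => γ) ≤ B ^ n := by
  set P := Measure.infinitePi fun _ : ℕ => γ with hP
  induction n with
  | zero => simp [orbitSum]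
  | succ n ih =>
    set V : (ℕ → ℝ) → ℝ × E := fun a => (orbitSum step D z₀ a n, randomOrbit step z₀ a n) with hV
    have hVm : Measurable V :=
      (measurable_orbitSum hstep hD z₀ n).prodMk (measurable_randomOrbit hstep z₀ n)
    have hind : IndepFun V (fun a => a n) P := indepFun_of_congr hVm fun a b h => by
      simp only [hV]
      rw [orbitSum_congr step D z₀ h, randomOrbit_congr step z₀ h]
    have hmap := (indepFun_iff_map_prod_eq_prod_map_map hVm.aemeasurable
      (measurable_pi_apply n).aemeasurable).1 hind
    have hn : P.map (fun a => a n) = γ := Measure.infinitePi_map_eval (μ := fun _ : ℕ => γ) n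
    rw [hn] at hmap
    set G : (ℝ × E) × ℝ → ENNReal := fun w => ENNReal.ofReal (Real.exp (δ * w.1.1)) *
      ENNReal.ofReal (Real.exp (δ * D w.1.2 w.2)) with hG
    have m1 : Measurable fun w : (ℝ × E) × ℝ => D w.1.2 w.2 :=
      hD.comp ((measurable_snd.comp measurable_fst).prodMk measurable_snd)
    have hGm : Measurable G := by
      have m2 : Measurable fun w : (ℝ × E) × ℝ => ENNReal.ofReal (Real.exp (δ * w.1.1)) := by
        fun_prop
      exact m2.mul ((m1.const_mul δ).exp).ennreal_ofReal
    have e1 : ∀ a, ENNReal.ofReal (Real.exp (δ * orbitSum step D z₀ a (n + 1))) = G (V a, a n) := by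
      intro a
      simp only [hG, hV]
      rw [orbitSum, Finset.sum_range_succ, mul_add, Real.exp_add,
        ENNReal.ofReal_mul (Real.exp_pos _).le]
      rfl
    simp only [e1]
    rw [← lintegral_map (f := G) (g := fun a => (V a, a n)) hGm
      (hVm.prodMk (measurable_pi_apply n)), hmap, lintegral_prod _ hGm.aemeasurable]
    have hVp : IsProbabilityMeasure P := by rw [hP]; infer_instance
    calc ∫⁻ v, ∫⁻ a, G (v, a) ∂γ ∂P.map V
        ≤ ∫⁻ v, ENNReal.ofReal (Real.exp (δ * v.1)) * B ∂P.map V := by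
          refine lintegral_mono fun v => ?_
          simp only [hG]
          rw [lintegral_const_mul]
          · gcongr
            exact hB v.2
          · exact (((m1.comp (measurable_const.prodMk measurable_id)).const_mul δ).exp).ennreal_ofReal
      _ = (∫⁻ a, ENNReal.ofReal (Real.exp (δ * orbitSum step D z₀ a n)) ∂P) * B := by
          rw [lintegral_mul_const _ (by fun_prop), lintegral_map (by fun_prop) hVm]
      _ ≤ B ^ n * B := by gcongr
      _ = B ^ (n + 1) := (pow_succ _ _).symm

/-- Chernoff's bound gives geometrically small probabilities, and Borel–Cantelli concludes. -/
theorem ae_eventually_orbitSum_le {E : Type*} [MeasurableSpace E] {γ : Measure ℝ}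
    [IsProbabilityMeasure γ] {step : E → ℝ → E} (hstep : Measurable (Function.uncurry step))
    {D : E → ℝ → ℝ} (hD : Measurable (Function.uncurry D)) {C : ℝ} (hC0 : 0 ≤ C)
    (hC : ∀ z, ∀ δ : ℝ, 0 < δ → δ ≤ 1 →
      ∫⁻ a, ENNReal.ofReal (Real.exp (δ * D z a)) ∂γ ≤ ENNReal.ofReal (1 + C * δ ^ 2))
    (z₀ : E) {ε : ℝ} (hε : 0 < ε) :
    ∀ᵐ a ∂(Measure.infinitePi fun _ : ℕ => γ),
      ∀ᶠ n : ℕ in atTop, orbitSum step D z₀ a n ≤ n * ε := by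
  set P := Measure.infinitePi fun _ : ℕ => γ with hP
  -- With `C δ ≤ ε / 2` one has `1 + C δ² ≤ 1 + δ ε / 2 ≤ e^{δε/2}`, leaving the ratio `q =
  -- e^{-δε/2}` after division by `e^{δε}`.
  set δ : ℝ := min 1 (ε / (2 * (C + 1))) with hδ
  have hδ0 : 0 < δ := lt_min one_pos (by positivity)
  have hδ1 : δ ≤ 1 := min_le_left _ _
  have hδ2 : C * δ ≤ ε / 2 := by
    have h1 : δ ≤ ε / (2 * (C + 1)) := min_le_right _ _
    rw [le_div_iff₀ (by positivity)] at h1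
    nlinarith
  set q : ℝ := Real.exp (-(δ * ε / 2)) with hq
  have hq1 : q < 1 := by
    rw [hq, Real.exp_lt_one_iff]
    have : 0 < δ * ε := by positivity
    linarith
  have hbound : ∀ n : ℕ, P {a | ¬ orbitSum step D z₀ a n ≤ n * ε} ≤ ENNReal.ofReal q ^ n := by
    intro n
    have h1 := lintegral_exp_orbitSum_le (γ := γ) hstep hD (fun z => hC z δ hδ0 hδ1) z₀ n
    have hm : Measurable fun a => ENNReal.ofReal (Real.exp (δ * orbitSum step D z₀ a n)) :=
      ((measurable_orbitSum hstep hD z₀ n).const_mul δ).exp.ennreal_ofReal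
    have h2 := meas_ge_le_lintegral_div (μ := P) hm.aemeasurable
      (ε := ENNReal.ofReal (Real.exp (δ * (n * ε)))) (by simp [Real.exp_pos]) (by simp)
    refine (measure_mono ?_).trans (h2.trans ?_)
    · intro a ha
      have ha : n * ε < orbitSum step D z₀ a n := not_le.1 ha
      exact ENNReal.ofReal_le_ofReal (Real.exp_le_exp.2 (by gcongr))
    · rw [ENNReal.div_le_iff (by simp [Real.exp_pos]) (by simp)]
      refine h1.trans ?_
      rw [← ENNReal.ofReal_pow (by positivity), ← ENNReal.ofReal_pow (by positivity),
        ← ENNReal.ofReal_mul (by positivity)]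
      refine ENNReal.ofReal_le_ofReal ?_
      have h3 : Real.exp (δ * (n * ε)) = Real.exp (δ * ε) ^ n := by
        rw [← Real.exp_nat_mul]; ring_nf
      rw [h3, ← mul_pow, hq, ← Real.exp_add]
      refine pow_le_pow_left₀ (by positivity) ?_ n
      have h4 := Real.add_one_le_exp (-(δ * ε / 2) + δ * ε)
      nlinarith
  refine ae_eventually_notMem (μ := P) (s := fun n => {a | ¬ orbitSum step D z₀ a n ≤ n * ε}) ?_
    |>.mono fun a ha => ha.mono fun n hn => by simpa using hn
  refine ne_top_of_le_ne_top ?_ (ENNReal.tsum_le_tsum hbound)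
  rw [ENNReal.tsum_geometric]
  refine ENNReal.inv_ne_top.2 (tsub_pos_of_lt ?_).ne'
  rw [← ENNReal.ofReal_one]
  exact (ENNReal.ofReal_lt_ofReal_iff one_pos).2 hq1

theorem Real.exp_sub_one_sub_self_le (y : ℝ) : Real.exp y - 1 - y ≤ y ^ 2 * Real.exp |y| := by
  have h1 : 1 ≤ Real.exp |y| := Real.one_le_exp (abs_nonneg y)
  rcases le_or_gt |y| 1 with h | h
  · have := (abs_le.1 (Real.abs_exp_sub_one_sub_id_le h)).2
    nlinarith [sq_nonneg y]
  · rcases le_or_gt 0 y with hy | hy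
    · rw [abs_of_nonneg hy] at h ⊢
      have : Real.exp y ≤ y ^ 2 * Real.exp y := le_mul_of_one_le_left (Real.exp_pos y).le (by nlinarith)
      linarith
    · rw [abs_of_neg hy] at h
      have : Real.exp y ≤ 1 := Real.exp_le_one_iff.2 hy.le
      nlinarith [sq_nonneg y]

/-- Centring removes the linear term, and the rest is at most `δ² X² e^{|X|} ≤ 2 δ² e^{2|X|}`. As
`|X|` grows only like `log (1 + a)`, two moments of `a` suffice. -/
theorem lintegral_exp_le_of_centred {γ : Measure ℝ} [IsProbabilityMeasure γ] {X : ℝ → ℝ}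
    (hX : Integrable X γ) (h0 : ∫ a, X a ∂γ = 0) {K : ℝ}
    (hK : ∀ᵐ a ∂γ, 0 ≤ a ∧ |X a| ≤ K + Real.log (1 + a))
    (hi : Integrable (fun a : ℝ => (1 + a) ^ 2) γ) {δ : ℝ} (hδ0 : 0 < δ) (hδ1 : δ ≤ 1) :
    ∫⁻ a, ENNReal.ofReal (Real.exp (δ * X a)) ∂γ ≤
      ENNReal.ofReal (1 + (2 * Real.exp (2 * K) * ∫ a, (1 + a) ^ 2 ∂γ) * δ ^ 2) := by
  set g : ℝ → ℝ := fun a => 1 + δ * X a + δ ^ 2 * (2 * Real.exp (2 * K) * (1 + a) ^ 2) with hg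
  have hle : ∀ᵐ a ∂γ, Real.exp (δ * X a) ≤ g a := by
    filter_upwards [hK] with a ⟨ha, hXa⟩
    have h1 := Real.exp_sub_one_sub_self_le (δ * X a)
    have h2 : Real.exp |δ * X a| ≤ Real.exp |X a| := by
      rw [abs_mul, abs_of_pos hδ0]
      exact Real.exp_le_exp.2 (mul_le_of_le_one_left (abs_nonneg _) hδ1)
    have h3 : X a ^ 2 ≤ 2 * Real.exp |X a| := by
      have := Real.quadratic_le_exp_of_nonneg (abs_nonneg (X a))
      rw [sq_abs] at this
      linarith [abs_nonneg (X a)]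
    have h4 : Real.exp |X a| ≤ Real.exp K * (1 + a) := by
      refine (Real.exp_le_exp.2 hXa).trans_eq ?_
      rw [Real.exp_add, Real.exp_log (by linarith)]
    have h5 : X a ^ 2 * Real.exp |X a| ≤ 2 * (Real.exp (2 * K) * (1 + a) ^ 2) := by
      have e : Real.exp (2 * K) = Real.exp K ^ 2 := by rw [← Real.exp_nat_mul]; norm_num
      calc X a ^ 2 * Real.exp |X a| ≤ 2 * Real.exp |X a| * Real.exp |X a| := by gcongr
        _ = 2 * (Real.exp |X a|) ^ 2 := by ring
        _ ≤ 2 * (Real.exp K * (1 + a)) ^ 2 := by gcongr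
        _ = _ := by rw [e]; ring
    have h6 : (δ * X a) ^ 2 * Real.exp |δ * X a| ≤ δ ^ 2 * (X a ^ 2 * Real.exp |X a|) := by
      rw [mul_pow, mul_assoc]
      gcongr
    have h7 : δ ^ 2 * (X a ^ 2 * Real.exp |X a|) ≤ δ ^ 2 * (2 * (Real.exp (2 * K) * (1 + a) ^ 2)) := by
      gcongr
    simp only [hg]
    linarith
  have i1 : Integrable (fun a => 1 + δ * X a) γ := (integrable_const _).add (hX.const_mul δ)
  have i2 : Integrable (fun a : ℝ => δ ^ 2 * (2 * Real.exp (2 * K) * (1 + a) ^ 2)) γ :=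
    (hi.const_mul _).const_mul _
  have hint : ∫ a, g a ∂γ = 1 + (2 * Real.exp (2 * K) * ∫ a, (1 + a) ^ 2 ∂γ) * δ ^ 2 := by
    simp only [hg]
    rw [integral_add i1 i2, integral_add (integrable_const _) (hX.const_mul δ), integral_const_mul,
      integral_const_mul, integral_const_mul, h0]
    simp
    ring
  have ig : Integrable g γ := i1.add i2
  rw [← hint, ofReal_integral_eq_lintegral_ofReal ig]
  · refine lintegral_mono_ae ?_
    filter_upwards [hle] with a ha using ENNReal.ofReal_le_ofReal ha
  · filter_upwards [hle] with a ha using (Real.exp_pos _).le.trans ha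

/-! ### Norms of the matrix products -/

theorem norm_entry_le_euclideanOpNorm (M : Matrix (Fin 2) (Fin 2) ℂ) (i j : Fin 2) :
    ‖M i j‖ ≤ euclideanOpNorm M := by
  have h1 := (Matrix.toEuclideanCLM (n := Fin 2) (𝕜 := ℂ) M).le_opNorm
    (EuclideanSpace.single j (1 : ℂ))
  have h2 := PiLp.norm_apply_le (Matrix.toEuclideanCLM (n := Fin 2) (𝕜 := ℂ) M
    (EuclideanSpace.single j (1 : ℂ))) i
  rw [PiLp.norm_single, norm_one, mul_one] at h1
  refine le_trans (le_of_eq ?_) (h2.trans h1)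
  congr 1
  rw [Matrix.ofLp_toEuclideanCLM]
  simp

theorem euclideanOpNorm_le_sum (M : Matrix (Fin 2) (Fin 2) ℂ) :
    euclideanOpNorm M ≤ ∑ j, ∑ i, ‖M i j‖ := by
  refine ContinuousLinearMap.opNorm_le_bound _ (by positivity) fun v => ?_
  have h1 : ‖Matrix.toEuclideanCLM (n := Fin 2) (𝕜 := ℂ) M v‖ ≤
      ∑ i, ‖Matrix.toEuclideanCLM (n := Fin 2) (𝕜 := ℂ) M v i‖ := by
    rw [EuclideanSpace.norm_eq]
    refine Real.sqrt_le_iff.2 ⟨by positivity, ?_⟩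
    simp only [Fin.sum_univ_two]
    nlinarith [norm_nonneg (Matrix.toEuclideanCLM (n := Fin 2) (𝕜 := ℂ) M v 0),
      norm_nonneg (Matrix.toEuclideanCLM (n := Fin 2) (𝕜 := ℂ) M v 1)]
  refine h1.trans ?_
  rw [Finset.sum_comm, Finset.sum_mul]
  refine Finset.sum_le_sum fun i _ => ?_
  rw [Matrix.ofLp_toEuclideanCLM, Matrix.mulVec, dotProduct, Finset.sum_mul]
  refine (norm_sum_le _ _).trans (Finset.sum_le_sum fun j _ => ?_)
  rw [norm_mul]
  gcongr
  exact PiLp.norm_apply_le v j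

theorem rayMatrix_mulVec (α a : ℝ) (x y : ℂ) :
    (rayMatrix α a).mulVec ![x, y] = ![y, x + a * Complex.exp (Complex.I * α) * y] := by
  ext i
  fin_cases i <;> simp [rayMatrix, Matrix.mulVec, dotProduct, Fin.sum_univ_two]

theorem rayMatrix_transpose (α a : ℝ) : (rayMatrix α a).transpose = rayMatrix α a := by
  ext i j
  fin_cases i <;> fin_cases j <;> simp [rayMatrix]

/-- The map induced by `rayMatrix` on ratios of coordinates. -/
noncomputable def rayStep (α : ℝ) (z : ℂ) (a : ℝ) : ℂ := a * Complex.exp (Complex.I * α) + z⁻¹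

theorem measurable_rayStep (α : ℝ) : Measurable (Function.uncurry (rayStep α)) := by
  unfold Function.uncurry rayStep
  fun_prop

theorem re_mul_exp_nonneg {α : ℝ} (hα : α ∈ Set.Icc (-(Real.pi / 2)) (Real.pi / 2)) {a : ℝ}
    (ha : 0 ≤ a) : 0 ≤ ((a : ℂ) * Complex.exp (Complex.I * α)).re := by
  rw [Complex.re_ofReal_mul, mul_comm Complex.I, Complex.exp_ofReal_mul_I_re]
  exact mul_nonneg ha (Real.cos_nonneg_of_mem_Icc hα)

theorem inv_re_pos {z : ℂ} (hz : 0 < z.re) : 0 < z⁻¹.re := by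
  rw [Complex.inv_re]
  exact div_pos hz (Complex.normSq_pos.2 (by rintro rfl; simp at hz))

theorem rayStep_re_pos {α : ℝ} (hα : α ∈ Set.Icc (-(Real.pi / 2)) (Real.pi / 2)) {a : ℝ}
    (ha : 0 ≤ a) {z : ℂ} (hz : 0 < z.re) : 0 < (rayStep α z a).re := by
  rw [rayStep, Complex.add_re]
  linarith [re_mul_exp_nonneg hα ha, inv_re_pos hz]

theorem randomOrbit_rayStep_re_pos {α : ℝ} (hα : α ∈ Set.Icc (-(Real.pi / 2)) (Real.pi / 2))
    {a : ℕ → ℝ} (ha : ∀ n, 0 < a n) {z : ℂ} (hz : 0 < z.re) (n : ℕ) :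
    0 < (randomOrbit (rayStep α) z a n).re := by
  induction n with
  | zero => exact hz
  | succ n ih => exact rayStep_re_pos hα (ha n).le ih

/-- The coordinates of the vector obtained by applying the transposed product. -/
theorem exists_mulVec_rayProduct {α : ℝ} (hα : α ∈ Set.Icc (-(Real.pi / 2)) (Real.pi / 2))
    {a : ℕ → ℝ} (ha : ∀ n, 0 < a n) {z : ℂ} (hz : 0 < z.re) (n : ℕ) :
    ∃ x : ℂ, x ≠ 0 ∧
      (rayProduct α a n).transpose.mulVec ![1, z] = ![x, randomOrbit (rayStep α) z a n * x] ∧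
      Real.log ‖x‖ = ∑ k ∈ Finset.range n, Real.log ‖randomOrbit (rayStep α) z a k‖ := by
  induction n with
  | zero => exact ⟨1, one_ne_zero, by simp [rayProduct, randomOrbit], by simp⟩
  | succ n ih =>
    obtain ⟨x, hx0, hx, hlog⟩ := ih
    have hZ := ne_zero_of_mem_rightHalfPlane (randomOrbit_rayStep_re_pos hα ha hz n)
    refine ⟨randomOrbit (rayStep α) z a n * x, mul_ne_zero hZ hx0, ?_, ?_⟩
    · rw [rayProduct, Matrix.transpose_mul, rayMatrix_transpose, ← Matrix.mulVec_mulVec, hx,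
        rayMatrix_mulVec]
      congr 2
      simp only [randomOrbit, rayStep]
      field_simp
      ring
    · rw [Finset.sum_range_succ, ← hlog, norm_mul,
        Real.log_mul (norm_ne_zero_iff.2 hZ) (norm_ne_zero_iff.2 hx0), add_comm]

/-! ### The Lyapunov exponent from a solution of the Poisson equation -/

/-- The increment of the centred additive functional attached to `H`. -/
noncomputable def rayIncrement (α lam : ℝ) (H : ℂ → ℝ) (z : ℂ) (a : ℝ) : ℝ :=
  if 0 < z.re then Real.log ‖z‖ + H (rayStep α z a) - H z - lam else 0

theorem measurable_rayIncrement (α lam : ℝ) {H : ℂ → ℝ} (hH : Measurable H) :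
    Measurable (Function.uncurry (rayIncrement α lam H)) := by
  unfold Function.uncurry rayIncrement
  refine Measurable.ite ?_ ?_ measurable_const
  · exact measurableSet_lt measurable_const (Complex.measurable_re.comp measurable_fst)
  · exact ((Measurable.add (by fun_prop) (hH.comp (measurable_rayStep α))).sub
      (hH.comp measurable_fst)).sub_const _

/-- Because `|z| |rayStep α z a| = |1 + a e^{iα} z|`, the quantities `|z| (1 + |rayStep α z a|)` and
`1 + |z|` agree up to the factor `1 + a` in either direction. This controls the increments. -/
theorem abs_log_norm_rayStep_le {α a : ℝ} (ha : 0 ≤ a) {z : ℂ} (hz : 0 < z.re) :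
    |Real.log ‖z‖ + Real.log (1 + ‖rayStep α z a‖) - Real.log (1 + ‖z‖)| ≤ Real.log (1 + a) := by
  have hz0 : z ≠ 0 := ne_zero_of_mem_rightHalfPlane hz
  have hn : 0 < ‖z‖ := norm_pos_iff.2 hz0
  have he : ‖Complex.exp (Complex.I * α)‖ = 1 := by
    rw [mul_comm, Complex.norm_exp_ofReal_mul_I]
  have e1 : ‖z‖ * ‖rayStep α z a‖ = ‖1 + a * Complex.exp (Complex.I * α) * z‖ := by
    rw [← norm_mul, rayStep]
    congr 1
    field_simp
    ring
  have e2 : ‖(a : ℂ) * Complex.exp (Complex.I * α) * z‖ = a * ‖z‖ := by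
    rw [norm_mul, norm_mul, he, Complex.norm_real, Real.norm_of_nonneg ha, mul_one]
  have u1 : ‖z‖ * ‖rayStep α z a‖ ≤ 1 + a * ‖z‖ := by
    rw [e1, ← e2]
    simpa using norm_add_le 1 ((a : ℂ) * Complex.exp (Complex.I * α) * z)
  have u2 : 1 ≤ ‖z‖ * ‖rayStep α z a‖ + a * ‖z‖ := by
    rw [e1, ← e2]
    simpa using norm_sub_le (1 + (a : ℂ) * Complex.exp (Complex.I * α) * z)
      ((a : ℂ) * Complex.exp (Complex.I * α) * z)
  have hs : 0 < 1 + ‖rayStep α z a‖ := by positivity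
  have hz1 : 0 < 1 + ‖z‖ := by positivity
  have ha1 : 0 < 1 + a := by positivity
  rw [← Real.log_mul hn.ne' hs.ne', abs_le]
  constructor
  · have := Real.log_le_log hz1 (show 1 + ‖z‖ ≤ (1 + a) * (‖z‖ * (1 + ‖rayStep α z a‖)) by
      have : 0 ≤ a * (‖z‖ * ‖rayStep α z a‖) := by positivity
      nlinarith)
    rw [Real.log_mul ha1.ne' (by positivity)] at this
    linarith
  · have := Real.log_le_log (mul_pos hn hs)
      (show ‖z‖ * (1 + ‖rayStep α z a‖) ≤ (1 + a) * (1 + ‖z‖) by nlinarith)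
    rw [Real.log_mul ha1.ne' hz1.ne'] at this
    linarith

/-- The one-sided bound is applied to the increments and to their negatives. The increment vanishes
off the half plane, so centring and domination hold for every `z`, as `ae_eventually_orbitSum_le`
demands. -/
theorem tendsto_orbitSum_div {p r α lam : ℝ} (hp : 0 < p) (hr : 0 < r)
    (hα : α ∈ Set.Icc (-(Real.pi / 2)) (Real.pi / 2)) {H : ℂ → ℝ} (hH : Measurable H) {C : ℝ}
    (hC : ∀ z : ℂ, 0 < z.re → |H z - Real.log (1 + ‖z‖)| ≤ C)
    (hP : ∀ z : ℂ, 0 < z.re →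
      ∫ a, H (rayStep α z a) ∂gammaMeasure p r = H z + lam - Real.log ‖z‖) (z₀ : ℂ) :
    ∀ᵐ a ∂(Measure.infinitePi fun _ : ℕ => gammaMeasure p r),
      Tendsto (fun n : ℕ => orbitSum (rayStep α) (rayIncrement α lam H) z₀ a n / n) atTop (𝓝 0) := by
  have hprob := isProbabilityMeasure_gammaMeasure hp hr
  have hC0 : 0 ≤ C := (abs_nonneg _).trans (hC 1 (by simp))
  have hi2 : Integrable (fun a : ℝ => (1 + a) ^ 2) (gammaMeasure p r) := by
    have i1 := integrable_pow_gammaMeasure hp hr 1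
    have i2 := integrable_pow_gammaMeasure hp hr 2
    refine (((integrable_const 1).add (i1.const_mul 2)).add i2).congr
      (Eventually.of_forall fun a => ?_)
    simp only [Pi.add_apply]
    ring
  set K : ℝ := 2 * C + |lam| with hK
  have hD := measurable_rayIncrement α lam hH
  have hbd : ∀ z, ∀ᵐ a ∂gammaMeasure p r,
      0 ≤ a ∧ |rayIncrement α lam H z a| ≤ K + Real.log (1 + a) := by
    intro z
    filter_upwards [ae_gammaMeasure_pos p r] with a ha
    refine ⟨ha.le, ?_⟩
    have hl : 0 ≤ Real.log (1 + a) := Real.log_nonneg (by linarith)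
    rw [rayIncrement]
    split_ifs with hz
    · have h1 := abs_le.1 (hC z hz)
      have h2 := abs_le.1 (hC _ (rayStep_re_pos hα ha.le hz))
      have h3 := abs_le.1 (abs_log_norm_rayStep_le (α := α) ha.le hz)
      have h4 := neg_abs_le lam
      have h5 := le_abs_self lam
      rw [abs_le]
      constructor <;> linarith [h1.1, h1.2, h2.1, h2.2, h3.1, h3.2]
    · rw [abs_zero]; positivity
  have hmeas : ∀ z, Measurable (rayIncrement α lam H z) := fun z =>
    hD.comp (measurable_const.prodMk measurable_id)
  have hil : Integrable (fun a : ℝ => K + Real.log (1 + a)) (gammaMeasure p r) := by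
    refine (hi2.add (integrable_const |K|)).mono'
      ((Real.measurable_log.comp (measurable_id.const_add 1)).const_add K).aestronglyMeasurable ?_
    filter_upwards [ae_gammaMeasure_pos p r] with a ha
    have h1 := Real.log_le_sub_one_of_pos (show 0 < 1 + a by linarith)
    have h2 : 0 ≤ Real.log (1 + a) := Real.log_nonneg (by linarith)
    rw [Real.norm_eq_abs]
    refine (abs_add_le _ _).trans ?_
    rw [abs_of_nonneg h2]
    simp only [Pi.add_apply]
    nlinarith
  have hint : ∀ z, Integrable (rayIncrement α lam H z) (gammaMeasure p r) := fun z =>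
    hil.mono' (hmeas z).aestronglyMeasurable ((hbd z).mono fun a ha => ha.2)
  have hmean : ∀ z, ∫ a, rayIncrement α lam H z a ∂gammaMeasure p r = 0 := by
    intro z
    by_cases hz : 0 < z.re
    · have hHi : Integrable (fun a => H (rayStep α z a)) (gammaMeasure p r) := by
        refine ((hint z).add (integrable_const (H z + lam - Real.log ‖z‖))).congr
          (Eventually.of_forall fun a => ?_)
        simp only [Pi.add_apply, rayIncrement, if_pos hz]
        ring
      have e : ∀ a, rayIncrement α lam H z a =
          H (rayStep α z a) - (H z + lam - Real.log ‖z‖) := by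
        intro a
        simp only [rayIncrement, if_pos hz]
        ring
      simp only [e]
      rw [integral_sub hHi (integrable_const _), hP z hz]
      simp
    · simp [rayIncrement, hz]
  set B : ℝ := 2 * Real.exp (2 * K) * ∫ a, (1 + a) ^ 2 ∂gammaMeasure p r with hB
  have hB0 : 0 ≤ B := by
    have : 0 ≤ ∫ a, (1 + a) ^ 2 ∂gammaMeasure p r := integral_nonneg fun a => sq_nonneg _
    positivity
  have up : ∀ ε : ℝ, 0 < ε → ∀ᵐ a ∂(Measure.infinitePi fun _ : ℕ => gammaMeasure p r),
      ∀ᶠ n : ℕ in atTop, orbitSum (rayStep α) (rayIncrement α lam H) z₀ a n ≤ n * ε := fun ε hε =>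
    ae_eventually_orbitSum_le (measurable_rayStep α) hD hB0
      (fun z δ h0 h1 => lintegral_exp_le_of_centred (hint z) (hmean z) (hbd z) hi2 h0 h1) z₀ hε
  have hDn : Measurable (Function.uncurry fun z a => -rayIncrement α lam H z a) := hD.neg
  have lo : ∀ ε : ℝ, 0 < ε → ∀ᵐ a ∂(Measure.infinitePi fun _ : ℕ => gammaMeasure p r),
      ∀ᶠ n : ℕ in atTop, orbitSum (rayStep α) (fun z a => -rayIncrement α lam H z a) z₀ a n ≤ n * ε :=
    fun ε hε => ae_eventually_orbitSum_le (measurable_rayStep α) hDn hB0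
      (fun z δ h0 h1 => lintegral_exp_le_of_centred (hint z).neg
        (by rw [integral_neg', hmean, neg_zero])
        ((hbd z).mono fun a ha => ⟨ha.1, by simpa using ha.2⟩) hi2 h0 h1) z₀ hε
  have hall : ∀ᵐ a ∂(Measure.infinitePi fun _ : ℕ => gammaMeasure p r), ∀ m : ℕ,
      ∀ᶠ n : ℕ in atTop, |orbitSum (rayStep α) (rayIncrement α lam H) z₀ a n| ≤
        n * (1 / ((m : ℝ) + 1)) := by
    rw [ae_all_iff]
    intro m
    filter_upwards [up _ (by positivity : 0 < 1 / ((m : ℝ) + 1)),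
      lo _ (by positivity : 0 < 1 / ((m : ℝ) + 1))] with a h1 h2
    filter_upwards [h1, h2] with n h3 h4
    rw [orbitSum, Finset.sum_neg_distrib] at h4
    rw [abs_le]
    exact ⟨by rw [orbitSum]; linarith, h3⟩
  filter_upwards [hall] with a ha
  rw [Metric.tendsto_atTop']
  intro ε hε
  obtain ⟨m, hm⟩ := exists_nat_one_div_lt hε
  obtain ⟨N, hN⟩ := eventually_atTop.1 (ha m)
  refine ⟨N, fun n hn => ?_⟩
  have hn0 : 0 < (n : ℝ) := by exact_mod_cast (by omega : 0 < n)
  rw [Real.dist_eq, sub_zero, abs_div, abs_of_pos hn0, div_lt_iff₀ hn0]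
  refine (hN n hn.le).trans_lt ?_
  rw [mul_comm]
  gcongr

/-- The values of `H` telescope along the orbit, leaving `log |x_n| + H(Z_n) - H(z) - nλ = o(n)`.
Replacing `H(Z_n)` by `log (1 + |Z_n|)` gives the growth of the `ℓ¹` norm `|x_n| (1 + |Z_n|)` of one
transported vector. The starting vectors `(1, 1)` and `(1, 2)` form a basis, so together they
control the operator norm. -/
theorem isLyapunovExponent_of_poisson {p s α lam : ℝ} (hp : 0 < p) (hs : 0 < s)
    (hα : α ∈ Set.Icc (-(Real.pi / 2)) (Real.pi / 2)) {H : ℂ → ℝ} (hH : Measurable H) {C : ℝ}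
    (hC : ∀ z : ℂ, 0 < z.re → |H z - Real.log (1 + ‖z‖)| ≤ C)
    (hP : ∀ z : ℂ, 0 < z.re →
      ∫ a, H (rayStep α z a) ∂gammaMeasure p s⁻¹ = H z + lam - Real.log ‖z‖) :
    IsLyapunovExponent p s α lam := by
  have hr : 0 < s⁻¹ := inv_pos.2 hs
  have hprob := isProbabilityMeasure_gammaMeasure hp hr
  have hpos : ∀ᵐ a ∂(Measure.infinitePi fun _ : ℕ => gammaMeasure p s⁻¹), ∀ n, 0 < a n := by
    rw [ae_all_iff]
    intro n
    exact (measurePreserving_eval_infinitePi (fun _ : ℕ => gammaMeasure p s⁻¹) n).quasiMeasurePreserving.ae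
      (ae_gammaMeasure_pos p s⁻¹)
  rw [IsLyapunovExponent, gammaSequenceLaw]
  filter_upwards [hpos, tendsto_orbitSum_div hp hr hα hH hC hP 1,
    tendsto_orbitSum_div hp hr hα hH hC hP 2] with a ha h1 h2
  have key : ∀ z : ℂ, 0 < z.re → Tendsto (fun n : ℕ =>
      orbitSum (rayStep α) (rayIncrement α lam H) z a n / n) atTop (𝓝 0) →
      ∃ q : ℕ → ℝ, (∀ n, 0 < q n) ∧ Tendsto (fun n : ℕ => 1 / (n : ℝ) * Real.log (q n)) atTop (𝓝 lam) ∧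
        ∀ n, q n = ‖((rayProduct α a n).transpose.mulVec ![1, z]) 0‖ +
          ‖((rayProduct α a n).transpose.mulVec ![1, z]) 1‖ := by
    intro z hz hT
    choose x hx0 hx hlog using exists_mulVec_rayProduct hα ha hz
    refine ⟨fun n => ‖x n‖ * (1 + ‖randomOrbit (rayStep α) z a n‖), fun n => ?_, ?_, fun n => ?_⟩
    · have := norm_pos_iff.2 (hx0 n)
      positivity
    · have hS : ∀ n : ℕ, orbitSum (rayStep α) (rayIncrement α lam H) z a n =
          Real.log ‖x n‖ + H (randomOrbit (rayStep α) z a n) - H z - n * lam := by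
        intro n
        rw [hlog]
        clear hlog hx hx0 x
        induction n with
        | zero => simp [orbitSum, randomOrbit]
        | succ n ih =>
          have hz' := randomOrbit_rayStep_re_pos hα ha hz n
          rw [orbitSum, Finset.sum_range_succ, Finset.sum_range_succ, ← orbitSum, ih, rayIncrement,
            if_pos hz']
          simp only [randomOrbit]
          push_cast
          ring
      have hb : ∀ n : ℕ, |Real.log (‖x n‖ * (1 + ‖randomOrbit (rayStep α) z a n‖)) -
          orbitSum (rayStep α) (rayIncrement α lam H) z a n - n * lam| ≤ C + |H z| := by
        intro n
        have h3 := abs_le.1 (hC _ (randomOrbit_rayStep_re_pos hα ha hz n))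
        rw [hS, Real.log_mul (norm_ne_zero_iff.2 (hx0 n)) (by positivity)]
        have h4 := neg_abs_le (H z)
        have h5 := le_abs_self (H z)
        rw [abs_le]
        constructor <;> linarith [h3.1, h3.2]
      have hb2 : Tendsto (fun n : ℕ => (Real.log (‖x n‖ * (1 + ‖randomOrbit (rayStep α) z a n‖)) -
          orbitSum (rayStep α) (rayIncrement α lam H) z a n - n * lam) * (1 / (n : ℝ)))
          atTop (𝓝 0) := by
        refine bdd_le_mul_tendsto_zero' (C + |H z|) (Eventually.of_forall fun n => ?_)
          tendsto_one_div_atTop_nhds_zero_nat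
        exact hb n
      have := (hb2.add hT).add_const lam
      simp only [add_zero, zero_add] at this
      refine this.congr' ?_
      filter_upwards [eventually_gt_atTop 0] with n hn
      have hn0 : (n : ℝ) ≠ 0 := by exact_mod_cast hn.ne'
      field_simp
      ring
    · rw [hx]
      simp only [Matrix.cons_val_zero, Matrix.cons_val_one]
      rw [norm_mul]
      ring
  obtain ⟨q₁, hq₁, hT₁, he₁⟩ := key 1 (by simp) h1
  obtain ⟨q₂, hq₂, hT₂, he₂⟩ := key 2 (by simp) h2
  have hlow : ∀ n, q₁ n ≤ 6 * euclideanOpNorm (rayProduct α a n) := by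
    intro n
    rw [he₁]
    have h00 := norm_entry_le_euclideanOpNorm (rayProduct α a n) 0 0
    have h01 := norm_entry_le_euclideanOpNorm (rayProduct α a n) 0 1
    have h10 := norm_entry_le_euclideanOpNorm (rayProduct α a n) 1 0
    have h11 := norm_entry_le_euclideanOpNorm (rayProduct α a n) 1 1
    simp only [Matrix.mulVec, dotProduct, Fin.sum_univ_two, Matrix.transpose_apply,
      Matrix.cons_val_zero, Matrix.cons_val_one, mul_one]
    have t0 := norm_add_le (rayProduct α a n 0 0) (rayProduct α a n 1 0)
    have t1 := norm_add_le (rayProduct α a n 0 1) (rayProduct α a n 1 1)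
    have h0 := norm_nonneg (rayProduct α a n 0 0)
    linarith
  have hup : ∀ n, euclideanOpNorm (rayProduct α a n) ≤ 5 * max (q₁ n) (q₂ n) := by
    intro n
    refine (euclideanOpNorm_le_sum _).trans ?_
    have m1 := le_max_left (q₁ n) (q₂ n)
    have m2 := le_max_right (q₁ n) (q₂ n)
    have e1 := he₁ n
    have e2 := he₂ n
    simp only [Matrix.mulVec, dotProduct, Fin.sum_univ_two, Matrix.transpose_apply,
      Matrix.cons_val_zero, Matrix.cons_val_one, mul_one] at e1 e2 ⊢
    -- Recovering a column from its images: `u = 2(u + v) - (u + 2v)` and `v = (u + 2v) - (u + v)`.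
    -- The coefficients `3 + 2` give the constant `5`.
    have col : ∀ u v : ℂ, ‖u‖ + ‖v‖ ≤ 3 * ‖u + v‖ + 2 * ‖u + v * 2‖ := by
      intro u v
      have c1 : ‖u‖ ≤ 2 * ‖u + v‖ + ‖u + v * 2‖ := by
        have : u = 2 * (u + v) - (u + v * 2) := by ring
        calc ‖u‖ = ‖2 * (u + v) - (u + v * 2)‖ := by rw [← this]
          _ ≤ ‖2 * (u + v)‖ + ‖u + v * 2‖ := norm_sub_le _ _
          _ = _ := by rw [norm_mul]; norm_num
      have c2 : ‖v‖ ≤ ‖u + v * 2‖ + ‖u + v‖ := by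
        have : v = (u + v * 2) - (u + v) := by ring
        calc ‖v‖ = ‖(u + v * 2) - (u + v)‖ := by rw [← this]
          _ ≤ _ := norm_sub_le _ _
      linarith
    have c0 := col (rayProduct α a n 0 0) (rayProduct α a n 1 0)
    have c1 := col (rayProduct α a n 0 1) (rayProduct α a n 1 1)
    linarith
  have hc : ∀ c : ℝ, Tendsto (fun n : ℕ => 1 / (n : ℝ) * c) atTop (𝓝 0) := fun c => by
    simpa using tendsto_one_div_atTop_nhds_zero_nat.mul_const c
  have hM : ∀ n, 0 < euclideanOpNorm (rayProduct α a n) := fun n => by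
    have := hlow n
    linarith [hq₁ n]
  have hL := hT₁.sub (hc (Real.log 6))
  have hU := (hT₁.max hT₂).add (hc (Real.log 5))
  rw [sub_zero] at hL
  rw [add_zero, max_self] at hU
  refine tendsto_of_tendsto_of_tendsto_of_le_of_le hL hU (fun n => ?_) fun n => ?_
  · have := Real.log_le_log (hq₁ n) (hlow n)
    rw [Real.log_mul (by norm_num) (hM n).ne'] at this
    simp only
    rw [← mul_sub]
    exact mul_le_mul_of_nonneg_left (by linarith) (by positivity)
  · have hm : 0 < max (q₁ n) (q₂ n) := lt_max_of_lt_left (hq₁ n)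
    have := Real.log_le_log (hM n) (hup n)
    rw [Real.log_mul (by norm_num) hm.ne'] at this
    have hmx : Real.log (max (q₁ n) (q₂ n)) ≤ max (Real.log (q₁ n)) (Real.log (q₂ n)) := by
      rcases max_choice (q₁ n) (q₂ n) with h | h <;> rw [h]
      · exact le_max_left _ _
      · exact le_max_right _ _
    have hn0 : 0 ≤ 1 / (n : ℝ) := by positivity
    simp only
    rw [← mul_max_of_nonneg _ _ hn0, ← mul_add]
    exact mul_le_mul_of_nonneg_left (by linarith) hn0

/-- The Lyapunov exponent in terms of Bessel integrals. -/
theorem isLyapunovExponent_bessel {p s α : ℝ} (hp : 0 < p) (hs : 0 < s)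
    (hα : α ∈ Set.Icc (-(Real.pi / 2)) (Real.pi / 2)) {x : ℂ}
    (hx : x = (s⁻¹ : ℝ) * Complex.exp (-(Complex.I * α))) :
    IsLyapunovExponent p s α (besselLogExt p x / besselExt p x).re := by
  have hr : 0 < s⁻¹ := inv_pos.2 hs
  have hprob := isProbabilityMeasure_gammaMeasure hp hr
  have hx0 : x ≠ 0 := by
    rw [hx]
    exact mul_ne_zero (by exact_mod_cast hr.ne') (Complex.exp_ne_zero _)
  have hxre : 0 ≤ x.re := by
    rw [hx, Complex.re_ofReal_mul, show -(Complex.I * (α : ℂ)) = ((-α : ℝ) : ℂ) * Complex.I by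
      push_cast; ring, Complex.exp_ofReal_mul_I_re, Real.cos_neg]
    exact mul_nonneg hr.le (Real.cos_nonneg_of_mem_Icc hα)
  have hk := besselExt_ne_zero hp hxre hx0
  have hkn : 0 < ‖besselExt p x‖ := norm_pos_iff.2 hk
  set h : ℂ → ℝ := fun z => (logExt p z x / besselExt p x).re with hh
  have hcont : ContinuousOn h rightHalfPlane := by
    intro z hz
    have := tendsto_logExt (l := 𝓝[rightHalfPlane] z) hp (tendsto_const_nhds (x := x)) hx0
      (Eventually.of_forall fun _ => hxre) hxre (tendsto_id.mono_left nhdsWithin_le_nhds) hz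
    exact (Complex.continuous_re.tendsto _).comp (this.div_const _)
  have hbound : ∀ z : ℂ, 0 < z.re →
      |h z - Real.log (1 + ‖z‖)| ≤ 20 * rayWeight x (⌈p⌉₊ + 1) / ‖besselExt p x‖ := by
    intro z hz
    have h1 := norm_logExt_sub_le hp hz hxre hx0
    have e : h z - Real.log (1 + ‖z‖) =
        ((logExt p z x - Real.log (1 + ‖z‖) * besselExt p x) / besselExt p x).re := by
      rw [sub_div, mul_div_assoc, div_self hk, mul_one, Complex.sub_re, Complex.ofReal_re]
    rw [e]
    refine (Complex.abs_re_le_norm _).trans ?_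
    rw [norm_div]
    gcongr
  -- The rate `s⁻¹` is the modulus of `x`, so the rescaling `s⁻¹ / x` is exactly the phase `e^{iα}`.
  have hstep : ∀ (z : ℂ) (a : ℝ), rayStep α z a = (a : ℂ) * (s⁻¹ : ℝ) / x + z⁻¹ := by
    intro z a
    rw [rayStep, hx, Complex.exp_neg]
    have e0 := Complex.exp_ne_zero (Complex.I * α)
    have e1 : ((s⁻¹ : ℝ) : ℂ) ≠ 0 := by exact_mod_cast hr.ne'
    generalize ((s⁻¹ : ℝ) : ℂ) = c at e1
    field_simp
  -- Continuity of `h` is known only on the half plane, whereas `isLyapunovExponent_of_poisson` asks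
  -- for a globally measurable function.
  have hmeas : Measurable (rightHalfPlane.indicator h) := by
    classical
    rw [← Set.piecewise_eq_indicator]
    exact hcont.measurable_piecewise continuousOn_const isOpen_rightHalfPlane.measurableSet
  have hind : ∀ z : ℂ, 0 < z.re → rightHalfPlane.indicator h z = h z := fun z hz =>
    Set.indicator_of_mem (show z ∈ rightHalfPlane from hz) h
  refine isLyapunovExponent_of_poisson hp hs hα (H := rightHalfPlane.indicator h) hmeas
    (C := 20 * rayWeight x (⌈p⌉₊ + 1) / ‖besselExt p x‖) (fun z hz => ?_) fun z hz => ?_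
  · rw [hind z hz]; exact hbound z hz
  · have hz0 : z ≠ 0 := ne_zero_of_mem_rightHalfPlane hz
    have hi := integral_logExt_gammaMeasure hp hr hz hxre hx0
    have e1 : ∫ a, rightHalfPlane.indicator h (rayStep α z a) ∂gammaMeasure p s⁻¹ =
        ∫ a : ℝ, (logExt p (a * (s⁻¹ : ℝ) / x + z⁻¹) x / besselExt p x).re ∂gammaMeasure p s⁻¹ := by
      refine integral_congr_ae ?_
      filter_upwards [ae_gammaMeasure_pos p s⁻¹] with a ha
      rw [hind _ (rayStep_re_pos hα ha.le hz), hh, hstep]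
    have hint : Integrable (fun a : ℝ => logExt p (a * (s⁻¹ : ℝ) / x + z⁻¹) x / besselExt p x)
        (gammaMeasure p s⁻¹) := by
      have hre : ∀ {a : ℝ}, 0 < a → 0 < ((a : ℂ) * (s⁻¹ : ℝ) / x + z⁻¹).re := fun {a} ha => by
        rw [← hstep]
        exact rayStep_re_pos hα ha.le hz
      have hlc : ContinuousOn (fun a : ℝ => logExt p (a * (s⁻¹ : ℝ) / x + z⁻¹) x) (Set.Ioi 0) := by
        intro a ha
        have hza : Tendsto (fun b : ℝ => (b : ℂ) * (s⁻¹ : ℝ) / x + z⁻¹) (𝓝[Set.Ioi 0] a)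
            (𝓝 ((a : ℂ) * (s⁻¹ : ℝ) / x + z⁻¹)) :=
          ((by fun_prop : Continuous fun b : ℝ => (b : ℂ) * (s⁻¹ : ℝ) / x + z⁻¹).tendsto a).mono_left
            nhdsWithin_le_nhds
        exact tendsto_logExt hp (tendsto_const_nhds (x := x)) hx0
          (Eventually.of_forall fun _ => hxre) hxre hza (hre ha)
      have hms : AEStronglyMeasurable (fun a : ℝ => logExt p (a * (s⁻¹ : ℝ) / x + z⁻¹) x)
          (gammaMeasure p s⁻¹) := by
        rw [← Measure.restrict_eq_self_of_ae_mem (ae_gammaMeasure_pos p s⁻¹)]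
        exact hlc.aestronglyMeasurable measurableSet_Ioi
      have hid := integrable_pow_gammaMeasure hp hr 1
      simp only [pow_one] at hid
      refine Integrable.div_const (Integrable.mono' (((integrable_const 20).add
        (((hid.mul_const (s⁻¹ / ‖x‖)).add (integrable_const ‖z⁻¹‖)).const_mul 2)).mul_const
          (rayWeight x (⌈p⌉₊ + 1))) hms ?_) _
      filter_upwards [ae_gammaMeasure_pos p s⁻¹] with a ha
      refine (norm_rayIntegral_le (fun w hw => norm_logRay_le hp (hre ha) hw) hxre hx0).trans ?_
      have hw : 0 ≤ rayWeight x (⌈p⌉₊ + 1) :=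
        setIntegral_nonneg measurableSet_Ioi fun ρ hρ => by
          have : 0 < ρ := hρ
          positivity
      refine mul_le_mul_of_nonneg_right ?_ hw
      have hnn : ‖(a : ℂ) * (s⁻¹ : ℝ) / x + z⁻¹‖ ≤ a * (s⁻¹ / ‖x‖) + ‖z⁻¹‖ := by
        refine (norm_add_le _ _).trans (add_le_add (le_of_eq ?_) le_rfl)
        rw [norm_div, norm_mul, Complex.norm_real, Complex.norm_real, Real.norm_of_nonneg ha.le,
          Real.norm_of_nonneg hr.le, mul_div_assoc]
      have := Real.log_le_sub_one_of_pos
        (by positivity : 0 < 1 + ‖(a : ℂ) * (s⁻¹ : ℝ) / x + z⁻¹‖)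
      simp only [Pi.add_apply]
      linarith
    have e2 := integral_re hint
    simp only [RCLike.re_to_complex] at e2
    rw [e1, e2, integral_div, hi, hind z hz, hh]
    simp only
    rw [add_div, sub_div, mul_div_assoc, div_self hk, mul_one, Complex.add_re, Complex.sub_re,
      Complex.log_re]
    ring

/-! ### Orders of growth at the origin of the half plane -/

/-- The comparison function `‖x‖ ^ c * (1 - log ‖x‖) ^ n`. -/
noncomputable def powLog (c : ℝ) (n : ℕ) (x : ℂ) : ℝ := ‖x‖ ^ c * (1 - Real.log ‖x‖) ^ n

/-- The filter of neighbourhoods of `0` in the open right half plane. -/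
noncomputable def halfNhds : Filter ℂ := 𝓝[rightHalfPlane] 0

instance : halfNhds.IsCountablyGenerated := by unfold halfNhds; infer_instance

theorem eventually_halfNhds {P : ℂ → Prop} :
    (∀ᶠ x in halfNhds, P x) ↔ ∃ δ > 0, ∀ x ∈ rightHalfPlane, ‖x‖ < δ → P x := by
  rw [halfNhds, eventually_nhdsWithin_iff, Metric.eventually_nhds_iff]
  simp only [dist_zero_right]
  exact ⟨fun ⟨δ, h, H⟩ => ⟨δ, h, fun x hx hn => H hn hx⟩,
    fun ⟨δ, h, H⟩ => ⟨δ, h, fun x hn hx => H x hx hn⟩⟩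

theorem eventually_mem_halfNhds : ∀ᶠ x in halfNhds, x ∈ rightHalfPlane ∧ ‖x‖ < 1 :=
  eventually_halfNhds.2 ⟨1, one_pos, fun _ hx hn => ⟨hx, hn⟩⟩

theorem ofReal_mul_mem_rightHalfPlane {t : ℝ} (ht : 0 < t) {x : ℂ} (hx : x ∈ rightHalfPlane) :
    (t : ℂ) * x ∈ rightHalfPlane := by
  rw [mem_rightHalfPlane, Complex.re_ofReal_mul]
  exact mul_pos ht hx

theorem norm_ofReal_mul {t : ℝ} (ht : 0 ≤ t) (x : ℂ) : ‖(t : ℂ) * x‖ = t * ‖x‖ := by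
  rw [norm_mul, Complex.norm_real, Real.norm_of_nonneg ht]

theorem tendsto_ofReal_mul_halfNhds {x : ℂ} (hx : x ∈ rightHalfPlane) :
    Tendsto (fun t : ℝ => (t : ℂ) * x) (𝓝[>] 0) halfNhds := by
  refine tendsto_nhdsWithin_iff.2 ⟨?_, ?_⟩
  · have : Tendsto (fun t : ℝ => (t : ℂ) * x) (𝓝 0) (𝓝 (((0 : ℝ) : ℂ) * x)) :=
      (by fun_prop : Continuous fun t : ℝ => (t : ℂ) * x).tendsto 0
    rw [Complex.ofReal_zero, zero_mul] at this
    exact this.mono_left nhdsWithin_le_nhds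
  · filter_upwards [self_mem_nhdsWithin] with t ht
    exact ofReal_mul_mem_rightHalfPlane ht hx

theorem one_le_one_sub_log {r : ℝ} (h1 : r ≤ 1) (h0 : 0 ≤ r) : 1 ≤ 1 - Real.log r := by
  linarith [Real.log_nonpos h0 h1]

theorem powLog_nonneg {x : ℂ} (hx : ‖x‖ < 1) (c : ℝ) (n : ℕ) : 0 ≤ powLog c n x := by
  have := one_le_one_sub_log hx.le (norm_nonneg x)
  unfold powLog
  positivity

theorem powLog_mul {x : ℂ} (hx : x ≠ 0) (c d : ℝ) (n m : ℕ) :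
    powLog c n x * powLog d m x = powLog (c + d) (n + m) x := by
  unfold powLog
  rw [Real.rpow_add (norm_pos_iff.2 hx), pow_add]
  ring

theorem Asymptotics.IsBigO.mul_powLog {F G : ℂ → ℂ} {c d e : ℝ} {n m k : ℕ}
    (hF : F =O[halfNhds] powLog c n) (hG : G =O[halfNhds] powLog d m)
    (he : c + d = e := by ring) (hk : n + m = k := by rfl) :
    (fun x => F x * G x) =O[halfNhds] powLog e k := by
  subst he hk
  refine (hF.mul hG).congr' EventuallyEq.rfl ?_
  filter_upwards [eventually_mem_halfNhds] with x hx
  exact powLog_mul (ne_zero_of_mem_rightHalfPlane hx.1) c d n m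

theorem powLog_isBigO_of_le {c d : ℝ} {n m : ℕ} (hc : d ≤ c) (hn : n ≤ m) :
    powLog c n =O[halfNhds] powLog d m := by
  refine IsBigO.of_bound 1 ?_
  filter_upwards [eventually_mem_halfNhds] with x hx
  have h1 := one_le_one_sub_log hx.2.le (norm_nonneg x)
  rw [Real.norm_of_nonneg (powLog_nonneg hx.2 _ _), Real.norm_of_nonneg (powLog_nonneg hx.2 _ _),
    one_mul]
  unfold powLog
  have h2 := Real.rpow_le_rpow_of_exponent_ge
    (norm_pos_iff.2 (ne_zero_of_mem_rightHalfPlane hx.1)) hx.2.le hc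
  have h3 := pow_le_pow_right₀ h1 hn
  gcongr

/-- Split `r ^ c` into `n + 1` equal powers: each of the `n` logarithmic factors absorbs one and one
is left over. -/
theorem tendsto_rpow_mul_const_sub_log_pow {c : ℝ} (hc : 0 < c) (A : ℝ) (n : ℕ) :
    Tendsto (fun r : ℝ => r ^ c * (A - Real.log r) ^ n) (𝓝[>] 0) (𝓝 0) := by
  have hd : 0 < c / (n + 1) := by positivity
  have h1 := tendsto_log_mul_rpow_nhdsGT_zero hd
  have h0 : Tendsto (fun r : ℝ => r ^ (c / (n + 1))) (𝓝[>] 0) (𝓝 0) := by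
    have := (Real.continuousAt_rpow_const 0 (c / (n + 1)) (Or.inr hd.le)).tendsto
    rw [Real.zero_rpow hd.ne'] at this
    exact this.mono_left nhdsWithin_le_nhds
  have h2 := h0.mul (((h0.const_mul A).sub h1).pow n)
  rw [zero_mul] at h2
  refine h2.congr' ?_
  filter_upwards [self_mem_nhdsWithin] with r hr
  have e : r ^ c = r ^ (c / (n + 1)) * (r ^ (c / (n + 1))) ^ n := by
    rw [← pow_succ', ← Real.rpow_mul_natCast (le_of_lt hr)]
    congr 1
    push_cast
    field_simp
  rw [e, mul_assoc, ← mul_pow]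
  congr 2
  ring

theorem tendsto_norm_halfNhds : Tendsto (fun x : ℂ => ‖x‖) halfNhds (𝓝[>] 0) := by
  refine tendsto_nhdsWithin_iff.2 ⟨?_, ?_⟩
  · have : Tendsto (fun x : ℂ => ‖x‖) (𝓝 0) (𝓝 0) := by
      simpa using (continuous_norm (E := ℂ)).tendsto 0
    exact this.mono_left nhdsWithin_le_nhds
  · filter_upwards [eventually_mem_halfNhds] with x hx
    exact norm_pos_iff.2 (ne_zero_of_mem_rightHalfPlane hx.1)

theorem tendsto_powLog {c : ℝ} (hc : 0 < c) (n : ℕ) : Tendsto (powLog c n) halfNhds (𝓝 0) :=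
  (tendsto_rpow_mul_const_sub_log_pow hc 1 n).comp tendsto_norm_halfNhds

theorem powLog_isBigO_of_lt {c d : ℝ} (n m : ℕ) (hc : d < c) :
    powLog c n =O[halfNhds] powLog d m := by
  have h := (tendsto_powLog (sub_pos.2 hc) n).isBigO_one ℝ
  refine (IsBigO.mul h (isBigO_refl (powLog d 0) halfNhds)).congr' ?_ ?_ |>.trans
    (powLog_isBigO_of_le le_rfl (Nat.zero_le m))
  · filter_upwards [eventually_mem_halfNhds] with x hx
    rw [powLog_mul (ne_zero_of_mem_rightHalfPlane hx.1)]
    simp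
  · exact Eventually.of_forall fun x => one_mul _

theorem cpow_isBigO_powLog (q : ℝ) : (fun x : ℂ => x ^ (q : ℂ)) =O[halfNhds] powLog q 0 := by
  refine IsBigO.of_bound 1 (Eventually.of_forall fun x => ?_)
  rw [Complex.norm_cpow_real]
  simp [powLog, abs_of_nonneg (Real.rpow_nonneg (norm_nonneg x) q)]

theorem id_isBigO_powLog : (fun x : ℂ => x) =O[halfNhds] powLog 1 0 := by
  refine (cpow_isBigO_powLog 1).congr_left fun x => by simp

theorem log_isBigO_powLog : Complex.log =O[halfNhds] powLog 0 1 := by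
  refine IsBigO.of_bound 5 ?_
  filter_upwards [eventually_mem_halfNhds] with x hx
  have h1 := one_le_one_sub_log hx.2.le (norm_nonneg x)
  have h2 := Complex.norm_log_le x
  rw [abs_of_nonpos (by linarith)] at h2
  rw [Real.norm_of_nonneg (powLog_nonneg hx.2 _ _)]
  simp only [powLog, Real.rpow_zero, one_mul, pow_one]
  linarith [Real.pi_lt_four]

theorem Filter.Tendsto.isBigO_powLog {F : ℂ → ℂ} {y : ℂ} (h : Tendsto F halfNhds (𝓝 y)) :
    F =O[halfNhds] powLog 0 0 :=
  (h.isBigO_one ℝ).congr_right fun x => by simp [powLog]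

theorem const_isBigO_powLog (y : ℂ) : (fun _ : ℂ => y) =O[halfNhds] powLog 0 0 :=
  (tendsto_const_nhds (x := y)).isBigO_powLog

theorem Asymptotics.IsBigO.tendsto_zero_of_powLog {F : ℂ → ℂ} {c : ℝ} {n : ℕ}
    (h : F =O[halfNhds] powLog c n) (hc : 0 < c) : Tendsto F halfNhds (𝓝 0) :=
  h.trans_tendsto (tendsto_powLog hc n)

/-! ### Integration along rays -/

/-- The mean value inequality on the segment from `t x` to `x`, with a radial primitive as majorant.
-/
theorem norm_sub_le_of_ray {F F' : ℂ → ℂ} {g g' : ℝ → ℝ} {δ : ℝ}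
    (hF : ∀ x ∈ rightHalfPlane, HasDerivAt F (F' x) x)
    (hg : ∀ r, 0 < r → r < δ → HasDerivAt g (g' r) r)
    (hb : ∀ x ∈ rightHalfPlane, ‖x‖ < δ → ‖F' x‖ ≤ g' ‖x‖) {x : ℂ} (hx : x ∈ rightHalfPlane)
    (hxδ : ‖x‖ < δ) {t : ℝ} (ht : 0 < t) (ht1 : t ≤ 1) :
    ‖F x - F (t * x)‖ ≤ g ‖x‖ - g (t * ‖x‖) := by
  have hn : 0 < ‖x‖ := norm_pos_iff.2 (ne_zero_of_mem_rightHalfPlane hx)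
  have hf : ∀ s : ℝ, 0 < s → HasDerivAt (fun s : ℝ => F (s * x) - F (t * x)) (F' (s * x) * x) s := by
    intro s hs
    have h1 : HasDerivAt (fun s : ℝ => (s : ℂ) * x) x s := by
      simpa using (Complex.ofRealCLM.hasDerivAt (x := s)).mul_const x
    exact ((hF _ (ofReal_mul_mem_rightHalfPlane hs hx)).comp s h1).sub_const _
  have hB : ∀ s : ℝ, 0 < s → s ≤ 1 →
      HasDerivAt (fun s : ℝ => g (s * ‖x‖) - g (t * ‖x‖)) (g' (s * ‖x‖) * ‖x‖) s := by
    intro s hs hs1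
    have h1 : HasDerivAt (fun s : ℝ => s * ‖x‖) ‖x‖ s := by
      simpa using (hasDerivAt_id s).mul_const ‖x‖
    exact ((hg (s * ‖x‖) (by positivity) (by nlinarith)).comp s h1).sub_const _
  have := image_norm_le_of_norm_deriv_right_le_deriv_boundary' (a := t) (b := 1)
    (f := fun s : ℝ => F (s * x) - F (t * x)) (f' := fun s => F' (s * x) * x)
    (B := fun s : ℝ => g (s * ‖x‖) - g (t * ‖x‖)) (B' := fun s => g' (s * ‖x‖) * ‖x‖)
    (fun s hs => (hf s (ht.trans_le hs.1)).continuousAt.continuousWithinAt)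
    (fun s hs => (hf s (ht.trans_le hs.1)).hasDerivWithinAt) (by simp)
    (fun s hs => (hB s (ht.trans_le hs.1) hs.2).continuousAt.continuousWithinAt)
    (fun s hs => (hB s (ht.trans_le hs.1) hs.2.le).hasDerivWithinAt)
    (fun s hs => by
      have hs0 : 0 < s := ht.trans_le hs.1
      have h1 := hb _ (ofReal_mul_mem_rightHalfPlane hs0 hx)
        (by rw [norm_ofReal_mul hs0.le]; nlinarith [hs.2])
      rw [norm_ofReal_mul hs0.le] at h1
      rw [norm_mul]
      gcongr) (x := 1) (Set.right_mem_Icc.2 ht1)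
  simpa using this

theorem hasDerivAt_rpow_mul_const_sub_log_pow {c A r : ℝ} (n : ℕ) (hr : 0 < r) :
    HasDerivAt (fun r : ℝ => r ^ c * (A - Real.log r) ^ n)
      (c * r ^ (c - 1) * (A - Real.log r) ^ n +
        r ^ c * (n * (A - Real.log r) ^ (n - 1) * (-r⁻¹))) r := by
  exact (Real.hasDerivAt_rpow_const (Or.inl hr.ne')).mul
    (((Real.hasDerivAt_log hr.ne').const_sub A).pow n)

/-- Integration of a bound for the derivative from the origin. -/
theorem Asymptotics.IsBigO.of_deriv_powLog {F F' : ℂ → ℂ} {c : ℝ} {n : ℕ} (hc : 0 < c)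
    (hF : ∀ x ∈ rightHalfPlane, HasDerivAt F (F' x) x) (h0 : Tendsto F halfNhds (𝓝 0))
    (h : F' =O[halfNhds] powLog (c - 1) n) : F =O[halfNhds] powLog c n := by
  obtain ⟨K, hK0, hK⟩ := h.exists_nonneg
  obtain ⟨δ₀, hδ₀, H⟩ := eventually_halfNhds.1 (hK.bound.and eventually_mem_halfNhds)
  -- For this `A` the derivative of `r^c (A - log r)^n` is `c r^{c-1} (A - log r)^{n-1} (1 - log r)`
  -- when `n ≥ 1`, which dominates `c r^{c-1} (1 - log r)^n`.
  set A : ℝ := 1 + n / c with hA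
  have hA1 : 1 ≤ A := by rw [hA]; linarith [show 0 ≤ (n : ℝ) / c by positivity]
  set δ : ℝ := min δ₀ 1 with hδ
  have hδ0 : 0 < δ := lt_min hδ₀ one_pos
  set g : ℝ → ℝ := fun r => K / c * (r ^ c * (A - Real.log r) ^ n) with hg
  set g' : ℝ → ℝ := fun r => K / c * (c * r ^ (c - 1) * (A - Real.log r) ^ n +
        r ^ c * (n * (A - Real.log r) ^ (n - 1) * (-r⁻¹))) with hg'
  have hgd : ∀ r, 0 < r → r < δ → HasDerivAt g (g' r) r := fun r hr _ =>
    (hasDerivAt_rpow_mul_const_sub_log_pow n hr).const_mul _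
  have hgb : ∀ r, 0 < r → r < δ → K * (r ^ (c - 1) * (1 - Real.log r) ^ n) ≤ g' r := by
    intro r hr hr1
    have h1 := one_le_one_sub_log (hr1.le.trans (min_le_right _ _)) hr.le
    have e : g' r = K * (r ^ (c - 1) *
        ((A - Real.log r) ^ n - n / c * (A - Real.log r) ^ (n - 1))) := by
      simp only [hg', Real.rpow_sub_one hr.ne']
      field_simp
      ring
    rw [e]
    gcongr
    rcases Nat.eq_zero_or_pos n with rfl | hn
    · simp
    · obtain ⟨m, rfl⟩ := Nat.exists_eq_succ_of_ne_zero hn.ne'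
      rw [Nat.succ_sub_one, pow_succ', pow_succ', ← sub_mul]
      have h3 : A - Real.log r - ((m.succ : ℕ) : ℝ) / c = 1 - Real.log r := by rw [hA]; ring
      rw [h3]
      gcongr
  have hbd : ∀ x ∈ rightHalfPlane, ‖x‖ < δ → ‖F' x‖ ≤ g' ‖x‖ := by
    intro x hx hxδ
    obtain ⟨h1, -, h2⟩ := H x hx (hxδ.trans_le (min_le_left _ _))
    rw [Real.norm_of_nonneg (powLog_nonneg h2 _ _)] at h1
    exact h1.trans (hgb _ (norm_pos_iff.2 (ne_zero_of_mem_rightHalfPlane hx)) hxδ)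
  refine IsBigO.of_bound (K / c * A ^ n) (eventually_halfNhds.2 ⟨δ, hδ0, fun x hx hxδ => ?_⟩)
  have hx1 : ‖x‖ < 1 := hxδ.trans_le (min_le_right _ _)
  have hn : 0 < ‖x‖ := norm_pos_iff.2 (ne_zero_of_mem_rightHalfPlane hx)
  have hle : ‖F x‖ ≤ g ‖x‖ := by
    have T1 : Tendsto (fun t : ℝ => ‖F x - F (t * x)‖) (𝓝[>] 0) (𝓝 ‖F x - 0‖) :=
      (tendsto_const_nhds.sub (h0.comp (tendsto_ofReal_mul_halfNhds hx))).norm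
    have T2 : Tendsto (fun t : ℝ => g ‖x‖ - g (t * ‖x‖)) (𝓝[>] 0) (𝓝 (g ‖x‖ - K / c * 0)) := by
      refine tendsto_const_nhds.sub (((tendsto_rpow_mul_const_sub_log_pow hc A n).comp
        (?_ : Tendsto (fun t : ℝ => t * ‖x‖) (𝓝[>] 0) (𝓝[>] 0))).const_mul _)
      refine (tendsto_norm_halfNhds.comp (tendsto_ofReal_mul_halfNhds hx)).congr' ?_
      filter_upwards [self_mem_nhdsWithin] with t ht
      exact norm_ofReal_mul (le_of_lt ht) x
    have := le_of_tendsto_of_tendsto T1 T2 (by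
      filter_upwards [Ioc_mem_nhdsGT one_pos] with t ht
      exact norm_sub_le_of_ray hF hgd hbd hx hxδ ht.1 ht.2)
    simpa using this
  refine hle.trans ?_
  have h1 := one_le_one_sub_log hx1.le hn.le
  rw [Real.norm_of_nonneg (powLog_nonneg hx1 _ _), hg, powLog]
  have h2 : (A - Real.log ‖x‖) ^ n ≤ A ^ n * (1 - Real.log ‖x‖) ^ n := by
    rw [← mul_pow]
    refine pow_le_pow_left₀ (by linarith) ?_ n
    nlinarith
  calc K / c * (‖x‖ ^ c * (A - Real.log ‖x‖) ^ n)
      ≤ K / c * (‖x‖ ^ c * (A ^ n * (1 - Real.log ‖x‖) ^ n)) := by gcongr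
    _ = _ := by ring

/-- Integration of a bound for the derivative from a small half circle towards the origin. -/
theorem exists_norm_le_sub_of_deriv {F F' : ℂ → ℂ} {g g' : ℝ → ℝ} {c : ℝ}
    (hF : ∀ x ∈ rightHalfPlane, HasDerivAt F (F' x) x)
    (hg : ∀ r, 0 < r → HasDerivAt g (g' r) r) (hb : ∀ᶠ x in halfNhds, ‖F' x‖ ≤ g' ‖x‖)
    (hc : F =O[halfNhds] powLog c 0) :
    ∃ C, ∀ᶠ x in halfNhds, ‖F x‖ ≤ C - g ‖x‖ := by
  obtain ⟨K, hK⟩ := hc.bound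
  obtain ⟨δ, hδ, H⟩ := eventually_halfNhds.1 (hb.and hK)
  -- The crude bound `hc` is used only on the half circle of radius `δ / 2`. It is needed there
  -- because the open half circle is not compact, so continuity alone gives no bound.
  refine ⟨K * (δ / 2) ^ c + g (δ / 2), eventually_halfNhds.2 ⟨δ / 2, by positivity, fun x hx hxδ => ?_⟩⟩
  have hn : 0 < ‖x‖ := norm_pos_iff.2 (ne_zero_of_mem_rightHalfPlane hx)
  set t : ℝ := ‖x‖ / (δ / 2) with ht
  have ht0 : 0 < t := by positivity
  set X : ℂ := ((t⁻¹ : ℝ) : ℂ) * x with hX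
  have hXm : X ∈ rightHalfPlane := ofReal_mul_mem_rightHalfPlane (inv_pos.2 ht0) hx
  have hXn : ‖X‖ = δ / 2 := by
    rw [hX, norm_ofReal_mul (inv_pos.2 ht0).le, ht]
    field_simp
  have e1 : (t : ℂ) * X = x := by
    rw [hX, ← mul_assoc, ← Complex.ofReal_mul, mul_inv_cancel₀ ht0.ne', Complex.ofReal_one, one_mul]
  have e2 : t * ‖X‖ = ‖x‖ := by rw [← norm_ofReal_mul ht0.le, e1]
  have h1 := norm_sub_le_of_ray hF (fun r hr _ => hg r hr) (fun x hx h => (H x hx h).1) hXm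
    (by rw [hXn]; linarith) ht0 ((div_le_one (by positivity)).2 hxδ.le)
  rw [e1, e2, hXn] at h1
  have h2 := (H X hXm (by rw [hXn]; linarith)).2
  simp only [powLog, pow_zero, mul_one, hXn, Real.norm_eq_abs] at h2
  rw [abs_of_nonneg (by positivity)] at h2
  have h3 : ‖F x‖ ≤ ‖F X‖ + ‖F X - F x‖ := by
    have := norm_sub_le (F X) (F X - F x)
    rwa [sub_sub_cancel] at this
  linarith

/-! ### Recurrences for the Bessel integrals -/

theorem cexp_mul_cosh (a t : ℝ) : -2 * Complex.cosh t * Complex.exp (a * t) =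
    (-1) * (Complex.exp ((a + 1 : ℝ) * t) + Complex.exp ((a - 1 : ℝ) * t)) := by
  have e1 : Complex.exp ((a + 1 : ℝ) * t) = Complex.exp t * Complex.exp (a * t) := by
    rw [← Complex.exp_add]; push_cast; ring_nf
  have e2 : Complex.exp ((a - 1 : ℝ) * t) = Complex.exp (-t) * Complex.exp (a * t) := by
    rw [← Complex.exp_add]; push_cast; ring_nf
  rw [e1, e2, Complex.cosh]
  ring

theorem cexp_mul_sinh (a t : ℝ) (x : ℂ) : 2 * x * Complex.sinh t * Complex.exp (a * t) =
    x * (Complex.exp ((a + 1 : ℝ) * t) + (-1) * Complex.exp ((a - 1 : ℝ) * t)) := by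
  have e1 : Complex.exp ((a + 1 : ℝ) * t) = Complex.exp t * Complex.exp (a * t) := by
    rw [← Complex.exp_add]; push_cast; ring_nf
  have e2 : Complex.exp ((a - 1 : ℝ) * t) = Complex.exp (-t) * Complex.exp (a * t) := by
    rw [← Complex.exp_add]; push_cast; ring_nf
  rw [e1, e2, Complex.sinh]
  ring

theorem expBounded_ofReal_mul_exp (a : ℝ) : ExpBounded fun t => (t : ℂ) * Complex.exp (a * t) :=
  expBounded_ofReal.mul (expBounded_exp a)

theorem hasDerivAt_besselInt (a : ℝ) {x : ℂ} (hx : 0 < x.re) :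
    HasDerivAt (besselInt a) (-(besselInt (a + 1) x + besselInt (a - 1) x)) x := by
  refine (hasDerivAt_coshLaplace (expBounded_exp a) (by fun_prop) hx).congr_deriv ?_
  simp only [cexp_mul_cosh]
  rw [coshLaplace_const_mul, coshLaplace_add (expBounded_exp _) (expBounded_exp _) (by fun_prop)
    (by fun_prop) hx, neg_one_mul]
  rfl

theorem hasDerivAt_besselLogInt (a : ℝ) {x : ℂ} (hx : 0 < x.re) :
    HasDerivAt (besselLogInt a) (-(besselLogInt (a + 1) x + besselLogInt (a - 1) x)) x := by
  refine (hasDerivAt_coshLaplace (expBounded_ofReal_mul_exp a) (by fun_prop) hx).congr_deriv ?_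
  have e : ∀ t : ℝ, -2 * Complex.cosh t * (t * Complex.exp (a * t)) =
      (-1) * (t * Complex.exp ((a + 1 : ℝ) * t) + t * Complex.exp ((a - 1 : ℝ) * t)) := fun t => by
    linear_combination (t : ℂ) * cexp_mul_cosh a t
  simp only [e]
  rw [coshLaplace_const_mul, coshLaplace_add (expBounded_ofReal_mul_exp _)
    (expBounded_ofReal_mul_exp _) (by fun_prop) (by fun_prop) hx, neg_one_mul]
  rfl

/-- Integration by parts applied to `e^{at}`. -/
theorem besselInt_recurrence (a : ℝ) {x : ℂ} (hx : 0 < x.re) :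
    a * besselInt a x = x * (besselInt (a + 1) x - besselInt (a - 1) x) := by
  have hd : ∀ t : ℝ, HasDerivAt (fun t : ℝ => Complex.exp (a * t)) (a * Complex.exp (a * t)) t := by
    intro t
    have h1 : HasDerivAt (fun t : ℝ => (a : ℂ) * t) a t := by
      simpa using (Complex.ofRealCLM.hasDerivAt (x := t)).const_mul (a : ℂ)
    simpa [mul_comm] using h1.cexp
  have h := coshLaplace_deriv (expBounded_exp a) ((expBounded_const a).mul (expBounded_exp a)) hd
    (by fun_prop) hx
  simp only [cexp_mul_sinh] at h
  rw [coshLaplace_const_mul, coshLaplace_const_mul, coshLaplace_add (expBounded_exp _)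
    ((expBounded_const _).mul (expBounded_exp _)) (by fun_prop) (by fun_prop) hx,
    coshLaplace_const_mul] at h
  simp only [besselInt]
  rw [h]
  ring

/-- Formally the derivative of `besselInt_recurrence` in the order; it is obtained directly by
integrating `t e^{at}` by parts. -/
theorem besselLogInt_recurrence (a : ℝ) {x : ℂ} (hx : 0 < x.re) :
    besselInt a x + a * besselLogInt a x =
      x * (besselLogInt (a + 1) x - besselLogInt (a - 1) x) := by
  have hd : ∀ t : ℝ, HasDerivAt (fun t : ℝ => (t : ℂ) * Complex.exp (a * t))
      (Complex.exp (a * t) + a * (t * Complex.exp (a * t))) t := by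
    intro t
    have h1 : HasDerivAt (fun t : ℝ => (a : ℂ) * t) a t := by
      simpa using (Complex.ofRealCLM.hasDerivAt (x := t)).const_mul (a : ℂ)
    have h2 : HasDerivAt (fun t : ℝ => (t : ℂ)) 1 t := by
      simpa using (hasDerivAt_id t).ofReal_comp
    refine (h2.mul h1.cexp).congr_deriv ?_
    ring
  have h := coshLaplace_deriv (expBounded_ofReal_mul_exp a) ((expBounded_exp a).add
    ((expBounded_const a).mul (expBounded_ofReal_mul_exp a))) hd (by fun_prop) hx
  have e : ∀ t : ℝ, 2 * x * Complex.sinh t * (t * Complex.exp (a * t)) =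
      x * (t * Complex.exp ((a + 1 : ℝ) * t) + (-1) * (t * Complex.exp ((a - 1 : ℝ) * t))) :=
    fun t => by linear_combination (t : ℂ) * cexp_mul_sinh a t x
  simp only [e] at h
  rw [coshLaplace_const_mul, coshLaplace_add (expBounded_exp _)
    ((expBounded_const _).mul (expBounded_ofReal_mul_exp _)) (by fun_prop) (by fun_prop) hx,
    coshLaplace_add (expBounded_ofReal_mul_exp _)
    ((expBounded_const _).mul (expBounded_ofReal_mul_exp _)) (by fun_prop) (by fun_prop) hx,
    coshLaplace_const_mul, coshLaplace_const_mul] at h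
  simp only [besselInt, besselLogInt]
  rw [h]
  ring

theorem besselInt_neg (a : ℝ) (x : ℂ) : besselInt (-a) x = besselInt a x := by
  rw [besselInt, besselInt, ← coshLaplace_comp_neg]
  congr 1
  ext t
  push_cast
  ring_nf

theorem besselLogInt_neg (a : ℝ) (x : ℂ) : besselLogInt (-a) x = -besselLogInt a x := by
  rw [besselLogInt, besselLogInt, ← coshLaplace_comp_neg,
    neg_eq_neg_one_mul (coshLaplace _ x), ← coshLaplace_const_mul]
  congr 1
  ext t
  push_cast
  ring_nf

/-- `x ^ a * besselInt a x`, which has a limit at the origin when `0 < a`. -/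
noncomputable def scaledBessel (a : ℝ) (x : ℂ) : ℂ := x ^ (a : ℂ) * besselInt a x

/-- The derivative of `scaledBessel` with respect to the order. -/
noncomputable def scaledBesselLog (a : ℝ) (x : ℂ) : ℂ :=
  x ^ (a : ℂ) * (besselLogInt a x + Complex.log x * besselInt a x)

theorem cpow_ofReal_sub_one {x : ℂ} (hx : x ≠ 0) (a : ℝ) :
    x ^ ((a - 1 : ℝ) : ℂ) = x ^ (a : ℂ) / x := by
  rw [Complex.ofReal_sub, Complex.ofReal_one, Complex.cpow_sub _ _ hx, Complex.cpow_one]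

theorem hasDerivAt_cpow_ofReal (a : ℝ) {x : ℂ} (hx : 0 < x.re) :
    HasDerivAt (fun x : ℂ => x ^ (a : ℂ)) (a * x ^ ((a - 1 : ℝ) : ℂ)) x := by
  refine ((hasDerivAt_id x).cpow_const (c := (a : ℂ)) (Or.inl hx)).congr_deriv ?_
  simp

/-- The power `x ^ a` is what makes the recurrence cancel the order `a + 1`. The derivative only
involves the lower order, so expansions propagate upwards in `a` by integration. -/
theorem hasDerivAt_scaledBessel (a : ℝ) {x : ℂ} (hx : 0 < x.re) :
    HasDerivAt (scaledBessel a) (-2 * x * scaledBessel (a - 1) x) x := by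
  have hx0 := ne_zero_of_mem_rightHalfPlane hx
  refine ((hasDerivAt_cpow_ofReal a hx).mul (hasDerivAt_besselInt a hx)).congr_deriv ?_
  rw [scaledBessel, cpow_ofReal_sub_one hx0]
  have h := besselInt_recurrence a hx
  field_simp
  linear_combination x ^ (a : ℂ) * h

theorem hasDerivAt_scaledBesselLog (a : ℝ) {x : ℂ} (hx : 0 < x.re) :
    HasDerivAt (scaledBesselLog a) (-2 * x * scaledBesselLog (a - 1) x) x := by
  have hx0 := ne_zero_of_mem_rightHalfPlane hx
  refine ((hasDerivAt_cpow_ofReal a hx).mul ((hasDerivAt_besselLogInt a hx).add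
    ((Complex.hasDerivAt_log (Or.inl hx)).mul (hasDerivAt_besselInt a hx)))).congr_deriv ?_
  rw [scaledBesselLog, cpow_ofReal_sub_one hx0]
  have h := besselInt_recurrence a hx
  have h' := besselLogInt_recurrence a hx
  simp only [Pi.add_apply, Pi.mul_apply]
  field_simp
  linear_combination x ^ (a : ℂ) * h' + x ^ (a : ℂ) * Complex.log x * h

theorem cpow_neg_ofReal_eq {x : ℂ} (hx : x ≠ 0) (a : ℝ) :
    x ^ ((-a : ℝ) : ℂ) = x ^ ((-(2 * a) : ℝ) : ℂ) * x ^ (a : ℂ) := by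
  rw [← Complex.cpow_add _ _ hx]
  congr 1
  push_cast
  ring

/-- Evenness in the order reduces negative indices, where there is no finite limit, to positive ones
at the price of an explicit power. -/
theorem scaledBessel_neg (a : ℝ) {x : ℂ} (hx : x ≠ 0) :
    scaledBessel (-a) x = x ^ ((-(2 * a) : ℝ) : ℂ) * scaledBessel a x := by
  rw [scaledBessel, scaledBessel, besselInt_neg, cpow_neg_ofReal_eq hx]
  ring

theorem scaledBesselLog_neg (a : ℝ) {x : ℂ} (hx : x ≠ 0) :
    scaledBesselLog (-a) x = x ^ ((-(2 * a) : ℝ) : ℂ) *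
      (2 * Complex.log x * scaledBessel a x - scaledBesselLog a x) := by
  rw [scaledBesselLog, scaledBessel, scaledBesselLog, besselInt_neg, besselLogInt_neg,
    cpow_neg_ofReal_eq hx]
  ring

theorem scaledBesselLog_zero (x : ℂ) :
    scaledBesselLog 0 x = Complex.log x * scaledBessel 0 x := by
  have h : besselLogInt 0 x = 0 := by
    have := besselLogInt_neg 0 x
    rw [neg_zero] at this
    exact self_eq_neg.1 this
  rw [scaledBesselLog, scaledBessel, h]
  ring

/-! ### Limits at the origin -/

theorem log_add_log_ray {x : ℂ} (hx : 0 < x.re) {r : ℝ} (hr : 0 < r) :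
    Complex.log x + Complex.log (1 + r / x) = Complex.log (x + r) := by
  have hx0 := ne_zero_of_mem_rightHalfPlane hx
  have hu : 0 < (1 + (r : ℂ) / x).re := by linarith [one_le_re_one_add_div hx.le hr.le]
  have hu0 := ne_zero_of_mem_rightHalfPlane hu
  rw [show x + r = x * (1 + r / x) by field_simp, Complex.log_mul hx0 hu0]
  have h1 := abs_lt.1 (Complex.abs_arg_lt_pi_div_two_iff.2 (Or.inl hx))
  have h2 := abs_lt.1 (Complex.abs_arg_lt_pi_div_two_iff.2 (Or.inl hu))
  constructor <;> linarith

theorem cpow_mul_cpow_ray (q : ℂ) {x : ℂ} (hx : 0 < x.re) {r : ℝ} (hr : 0 < r) :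
    x ^ q * (1 + r / x) ^ q = (x + r) ^ q := by
  have hx0 := ne_zero_of_mem_rightHalfPlane hx
  have hu : 0 < (1 + (r : ℂ) / x).re := by linarith [one_le_re_one_add_div hx.le hr.le]
  have hu0 := ne_zero_of_mem_rightHalfPlane hu
  have hxr : x + r ≠ 0 := ne_zero_of_mem_rightHalfPlane (x := x + r)
    (by rw [mem_rightHalfPlane, Complex.add_re, Complex.ofReal_re]; linarith)
  rw [Complex.cpow_def_of_ne_zero hx0, Complex.cpow_def_of_ne_zero hu0,
    Complex.cpow_def_of_ne_zero hxr, ← Complex.exp_add, ← log_add_log_ray hx hr]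
  ring_nf

/-- The integrand of `scaledBessel` along the ray, without its exponential factor. -/
theorem cpow_mul_besselRay (a : ℝ) {x : ℂ} (hx : 0 < x.re) {r : ℝ} (hr : 0 < r) :
    x ^ (a : ℂ) * (x⁻¹ * besselRay a (1 + r / x)) = (x + r) ^ ((a - 1 : ℝ) : ℂ) *
      (1 + (1 + r / x) ^ ((-(2 * a) : ℝ) : ℂ)) := by
  have hx0 := ne_zero_of_mem_rightHalfPlane hx
  have hu : 0 < (1 + (r : ℂ) / x).re := by linarith [one_le_re_one_add_div hx.le hr.le]
  have hu0 := ne_zero_of_mem_rightHalfPlane hu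
  rw [← cpow_mul_cpow_ray _ hx hr, cpow_ofReal_sub_one hx0, besselRay,
    show ((-a - 1 : ℝ) : ℂ) = ((a - 1 : ℝ) : ℂ) + ((-(2 * a) : ℝ) : ℂ) by push_cast; ring,
    Complex.cpow_add _ _ hu0]
  ring

theorem cpow_mul_besselLogRay (a : ℝ) {x : ℂ} (hx : 0 < x.re) {r : ℝ} (hr : 0 < r) :
    x ^ (a : ℂ) * (x⁻¹ * besselLogRay a (1 + r / x) +
      Complex.log x * (x⁻¹ * besselRay a (1 + r / x))) = (x + r) ^ ((a - 1 : ℝ) : ℂ) *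
      (Complex.log (x + r) * (1 + (1 + r / x) ^ ((-(2 * a) : ℝ) : ℂ)) -
        2 * (Complex.log (1 + r / x) * (1 + r / x) ^ ((-(2 * a) : ℝ) : ℂ))) := by
  have hx0 := ne_zero_of_mem_rightHalfPlane hx
  have hu : 0 < (1 + (r : ℂ) / x).re := by linarith [one_le_re_one_add_div hx.le hr.le]
  have hu0 := ne_zero_of_mem_rightHalfPlane hu
  rw [← cpow_mul_cpow_ray _ hx hr, cpow_ofReal_sub_one hx0, besselRay, besselLogRay,
    ← log_add_log_ray hx hr,
    show ((-a - 1 : ℝ) : ℂ) = ((a - 1 : ℝ) : ℂ) + ((-(2 * a) : ℝ) : ℂ) by push_cast; ring,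
    Complex.cpow_add _ _ hu0]
  ring

/-- Near zero the logarithm costs half of the exponent `a`, near infinity one power of `y`. The
exponent `min (a / 2) 1 - 1` is nonpositive, so `‖x + r‖` can afterwards be replaced by the smaller
`r`. -/
theorem rpow_mul_one_add_abs_log_le {a y : ℝ} (ha : 0 < a) (hy : 0 < y) :
    y ^ (a - 1) * (1 + |Real.log y|) ≤ (1 + 2 / a) * (y ^ (min (a / 2) 1 - 1) + y ^ ⌈a⌉₊) := by
  have h2a : 0 < 2 / a := by positivity
  rcases le_total y 1 with h | h
  · have h1 : 1 + |Real.log y| ≤ (1 + 2 / a) * y ^ (-(a / 2)) := by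
      have e1 : 1 ≤ y ^ (-(a / 2)) :=
        Real.one_le_rpow_of_pos_of_le_one_of_nonpos hy h (by linarith)
      have e2 := Real.log_le_rpow_div (inv_pos.2 hy).le (by positivity : 0 < a / 2)
      rw [Real.log_inv, Real.inv_rpow hy.le, ← Real.rpow_neg hy.le] at e2
      rw [abs_of_nonpos (Real.log_nonpos hy.le h)]
      have e3 : y ^ (-(a / 2)) / (a / 2) = 2 / a * y ^ (-(a / 2)) := by field_simp
      linarith
    calc y ^ (a - 1) * (1 + |Real.log y|) ≤ y ^ (a - 1) * ((1 + 2 / a) * y ^ (-(a / 2))) := by gcongr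
      _ = (1 + 2 / a) * y ^ (a / 2 - 1) := by
        rw [mul_left_comm, ← Real.rpow_add hy]; ring_nf
      _ ≤ (1 + 2 / a) * y ^ (min (a / 2) 1 - 1) := by
        gcongr (1 + 2 / a) * ?_
        exact Real.rpow_le_rpow_of_exponent_ge hy h (by linarith [min_le_left (a / 2) 1])
      _ ≤ _ := by gcongr; linarith [pow_nonneg hy.le ⌈a⌉₊]
  · have h1 : 1 + |Real.log y| ≤ y := by
      rw [abs_of_nonneg (Real.log_nonneg h)]
      linarith [Real.log_le_sub_one_of_pos hy]
    have h3 : 0 ≤ y ^ (min (a / 2) 1 - 1) := by positivity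
    calc y ^ (a - 1) * (1 + |Real.log y|) ≤ y ^ (a - 1) * y := by gcongr
      _ = y ^ a := by rw [← Real.rpow_add_one hy.ne']; ring_nf
      _ ≤ y ^ (⌈a⌉₊ : ℝ) := Real.rpow_le_rpow_of_exponent_le h (Nat.le_ceil a)
      _ = y ^ ⌈a⌉₊ := Real.rpow_natCast y _
      _ ≤ 1 * (y ^ (min (a / 2) 1 - 1) + y ^ ⌈a⌉₊) := by linarith
      _ ≤ _ := by gcongr; linarith

theorem tendsto_div_ray_halfNhds {r : ℝ} (hr : 0 < r) :
    Tendsto (fun x : ℂ => x / (1 + r / x)) halfNhds (𝓝 0) := by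
  refine squeeze_zero_norm' ?_ (tendsto_norm_halfNhds.mono_right nhdsWithin_le_nhds)
  filter_upwards [eventually_mem_halfNhds] with x hx
  rw [norm_div]
  exact div_le_self (norm_nonneg x)
    (one_le_norm_of_one_le_re (one_le_re_one_add_div (le_of_lt hx.1) hr.le))

theorem tendsto_norm_ray_halfNhds {r : ℝ} (hr : 0 < r) :
    Tendsto (fun x : ℂ => ‖1 + (r : ℂ) / x‖) halfNhds atTop := by
  refine tendsto_atTop_mono' (f₁ := fun x => r * ‖x‖⁻¹) _ ?_
    ((tendsto_inv_nhdsGT_zero.comp tendsto_norm_halfNhds).const_mul_atTop hr)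
  filter_upwards [eventually_mem_halfNhds] with x hx
  have hx0 := ne_zero_of_mem_rightHalfPlane hx.1
  have hxr : r ≤ ‖x + r‖ := by
    refine le_trans ?_ (Complex.re_le_norm _)
    rw [Complex.add_re, Complex.ofReal_re]
    linarith [mem_rightHalfPlane.1 hx.1]
  rw [show 1 + (r : ℂ) / x = (x + r) / x by field_simp, norm_div, div_eq_mul_inv]
  gcongr

theorem tendsto_halfNhds_id : Tendsto (fun x : ℂ => x) halfNhds (𝓝 0) :=
  tendsto_id.mono_left nhdsWithin_le_nhds

theorem tendsto_ray_cpow {q r : ℝ} (hq : 0 < q) (hr : 0 < r) :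
    Tendsto (fun x : ℂ => (1 + (r : ℂ) / x) ^ ((-q : ℝ) : ℂ)) halfNhds (𝓝 0) := by
  rw [tendsto_zero_iff_norm_tendsto_zero]
  simp only [Complex.norm_cpow_real]
  exact (tendsto_rpow_neg_atTop hq).comp (tendsto_norm_ray_halfNhds hr)

theorem norm_log_mul_cpow_le {q : ℝ} {u : ℂ} (hu : 1 ≤ u.re) :
    ‖Complex.log u * u ^ ((-q : ℝ) : ℂ)‖ ≤
      Real.log ‖u‖ / ‖u‖ ^ q + Real.pi * ‖u‖ ^ (-q) := by
  have h1 := one_le_norm_of_one_le_re hu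
  have h2 := Complex.norm_log_le u
  rw [abs_of_nonneg (Real.log_nonneg h1)] at h2
  rw [norm_mul, Complex.norm_cpow_real, div_eq_mul_inv, ← Real.rpow_neg (norm_nonneg u), ← add_mul]
  gcongr

theorem tendsto_ray_log_mul_cpow {q r : ℝ} (hq : 0 < q) (hr : 0 < r) :
    Tendsto (fun x : ℂ => Complex.log (1 + r / x) * (1 + (r : ℂ) / x) ^ ((-q : ℝ) : ℂ))
      halfNhds (𝓝 0) := by
  have h : Tendsto (fun v : ℝ => Real.log v / v ^ q + Real.pi * v ^ (-q)) atTop (𝓝 0) := by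
    simpa using (isLittleO_log_rpow_atTop hq).tendsto_div_nhds_zero.add
      ((tendsto_rpow_neg_atTop hq).const_mul Real.pi)
  refine squeeze_zero_norm' ?_ (h.comp (tendsto_norm_ray_halfNhds hr))
  filter_upwards [eventually_mem_halfNhds] with x hx
  exact norm_log_mul_cpow_le (one_le_re_one_add_div (le_of_lt hx.1) hr.le)

/-- Dominated convergence at the origin for integrals along the rays. -/
theorem tendsto_integral_ray {W : ℂ → ℝ → ℂ} {W₀ : ℝ → ℂ} {a K : ℝ} (ha : 0 < a)
    (hK : ∀ x ∈ rightHalfPlane, ∀ r : ℝ, 0 < r →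
      ‖W x r‖ ≤ K * (‖x + r‖ ^ (a - 1) * (1 + |Real.log ‖x + r‖|)))
    (hW : ∀ r : ℝ, 0 < r → Tendsto (fun x => W x r) halfNhds (𝓝 (W₀ r)))
    (hm : ∀ x ∈ rightHalfPlane, AEStronglyMeasurable
      (fun r : ℝ => W x r * Complex.exp (-x - r - x / (1 + r / x))) (volume.restrict (Set.Ioi 0))) :
    Tendsto (fun x => ∫ r in Set.Ioi (0 : ℝ), W x r * Complex.exp (-x - r - x / (1 + r / x)))
      halfNhds (𝓝 (∫ r in Set.Ioi (0 : ℝ), W₀ r * Complex.exp (-r))) := by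
  have hK0 : 0 ≤ K := by
    have := (norm_nonneg _).trans (hK 1 (by simp [mem_rightHalfPlane]) 1 one_pos)
    refine nonneg_of_mul_nonneg_left this ?_
    have : (1 : ℂ) + (1 : ℝ) ≠ 0 := by norm_num
    have := norm_pos_iff.2 this
    positivity
  set b : ℝ := min (a / 2) 1 with hb
  have hb0 : 0 < b := lt_min (by positivity) one_pos
  have hb1 : b ≤ 1 := min_le_right _ _
  refine tendsto_integral_filter_of_dominated_convergence
    (fun r => K * (1 + 2 / a) * Real.exp 1 *
      (Real.exp (-r) * r ^ (b - 1) + (1 + r / 1) ^ ⌈a⌉₊ * Real.exp (-r))) ?_ ?_ ?_ ?_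
  · filter_upwards [eventually_mem_halfNhds] with x hx
    exact hm x hx.1
  · filter_upwards [eventually_mem_halfNhds] with x hx
    refine (ae_restrict_iff' measurableSet_Ioi).2 (Eventually.of_forall fun r hr => ?_)
    have hr0 : 0 < r := hr
    have hxr : r ≤ ‖x + r‖ := by
      refine le_trans ?_ (Complex.re_le_norm _)
      rw [Complex.add_re, Complex.ofReal_re]
      linarith [mem_rightHalfPlane.1 hx.1]
    have hxr' : ‖x + r‖ ≤ 1 + r / 1 := by
      refine (norm_add_le _ _).trans ?_
      rw [Complex.norm_real, Real.norm_of_nonneg hr0.le, div_one]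
      linarith [hx.2]
    have hy : 0 < ‖x + r‖ := hr0.trans_le hxr
    have h1 := rpow_mul_one_add_abs_log_le ha hy
    have h2 : ‖x + r‖ ^ (b - 1) ≤ r ^ (b - 1) :=
      Real.rpow_le_rpow_of_nonpos hr0 hxr (by linarith)
    have h3 : ‖x + r‖ ^ ⌈a⌉₊ ≤ (1 + r / 1) ^ ⌈a⌉₊ := pow_le_pow_left₀ hy.le hxr' _
    have h4 : Real.exp (‖x‖ - r) ≤ Real.exp 1 * Real.exp (-r) := by
      rw [← Real.exp_add]
      exact Real.exp_le_exp.2 (by linarith [hx.2])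
    rw [norm_mul]
    calc ‖W x r‖ * ‖Complex.exp (-x - r - x / (1 + r / x))‖
        ≤ (K * (‖x + r‖ ^ (a - 1) * (1 + |Real.log ‖x + r‖|))) *
          (Real.exp 1 * Real.exp (-r)) :=
          mul_le_mul (hK x hx.1 r hr0) ((norm_exp_ray_le (le_of_lt hx.1) hr0.le).trans h4)
            (norm_nonneg _) (by positivity)
      _ ≤ (K * ((1 + 2 / a) * (r ^ (b - 1) + (1 + r / 1) ^ ⌈a⌉₊))) *
          (Real.exp 1 * Real.exp (-r)) := by
          have h5 := h1.trans (mul_le_mul_of_nonneg_left (add_le_add h2 h3)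
            (by positivity : 0 ≤ 1 + 2 / a))
          gcongr ?_ * _
          exact mul_le_mul_of_nonneg_left h5 hK0
      _ = _ := by ring
  · exact ((Real.GammaIntegral_convergent hb0).add
      (integrableOn_one_add_mul_pow_mul_exp one_pos _)).const_mul _
  · refine (ae_restrict_iff' measurableSet_Ioi).2 (Eventually.of_forall fun r hr => ?_)
    have := (((tendsto_halfNhds_id.neg).sub_const (r : ℂ)).sub (tendsto_div_ray_halfNhds hr))
    rw [neg_zero, sub_zero, zero_sub] at this
    exact (hW r hr).mul ((Complex.continuous_exp.tendsto _).comp this)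

theorem norm_ray_cpow_le_one {q : ℝ} (hq : 0 < q) {u : ℂ} (hu : 1 ≤ u.re) :
    ‖u ^ ((-q : ℝ) : ℂ)‖ ≤ 1 := by
  rw [Complex.norm_cpow_real]
  exact Real.rpow_le_one_of_one_le_of_nonpos (one_le_norm_of_one_le_re hu) (by linarith)

theorem ofReal_mem_slitPlane {r : ℝ} (hr : 0 < r) : (r : ℂ) ∈ Complex.slitPlane :=
  Complex.ofReal_mem_slitPlane.2 hr

theorem tendsto_add_ofReal_halfNhds (r : ℝ) :
    Tendsto (fun x : ℂ => x + r) halfNhds (𝓝 (r : ℂ)) := by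
  simpa using tendsto_halfNhds_id.add_const (r : ℂ)

/-- On the ray the integrand is `(x + r)^{a-1} (1 + (1 + r/x)^{-2a})` times an exponential. The
second term, coming from `t < 0`, dies out since `|1 + r/x| → ∞`, and Euler's integral remains. The
majorant does not depend on the direction of `x`. -/
theorem tendsto_scaledBessel {a : ℝ} (ha : 0 < a) :
    Tendsto (scaledBessel a) halfNhds (𝓝 (Complex.Gamma a)) := by
  have hq : 0 < 2 * a := by positivity
  have e₀ : Complex.Gamma a =
      ∫ r in Set.Ioi (0 : ℝ), (r : ℂ) ^ ((a - 1 : ℝ) : ℂ) * Complex.exp (-r) := by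
    rw [Complex.Gamma_eq_integral (by simpa using ha), Complex.GammaIntegral]
    congr 1 with r
    push_cast
    ring
  rw [e₀]
  refine (tendsto_integral_ray (W := fun x r => (x + r) ^ ((a - 1 : ℝ) : ℂ) *
      (1 + (1 + r / x) ^ ((-(2 * a) : ℝ) : ℂ))) (K := 2) ha (fun x hx r hr => ?_) (fun r hr => ?_)
      fun x hx => ?_).congr' ?_
  · have h1 := norm_ray_cpow_le_one hq (one_le_re_one_add_div (le_of_lt hx) hr.le)
    have h2 := norm_add_le 1 ((1 + (r : ℂ) / x) ^ ((-(2 * a) : ℝ) : ℂ))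
    rw [norm_one] at h2
    rw [norm_mul, Complex.norm_cpow_real, mul_left_comm]
    gcongr
    linarith [abs_nonneg (Real.log ‖x + r‖)]
  · have h1 := (tendsto_add_ofReal_halfNhds r).cpow
      (tendsto_const_nhds (x := ((a - 1 : ℝ) : ℂ))) (ofReal_mem_slitPlane hr)
    simpa using h1.mul ((tendsto_ray_cpow hq hr).const_add 1)
  · refine ((aestronglyMeasurable_rayIntegrand
      (differentiableOn_besselRay a).continuousOn_one_le_re (le_of_lt hx)).const_mul
        (x ^ (a : ℂ))).congr ?_
    refine (ae_restrict_iff' measurableSet_Ioi).2 (Eventually.of_forall fun r hr => ?_)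
    simp only
    rw [← cpow_mul_besselRay a hx hr, rayIntegrand, mul_assoc (x ^ (a : ℂ))]
  · filter_upwards [eventually_mem_halfNhds] with x hx
    rw [scaledBessel, besselInt_eq_ext ha hx.1, besselExt, rayIntegral, ← integral_const_mul]
    refine setIntegral_congr_fun measurableSet_Ioi fun r hr => ?_
    rw [← cpow_mul_besselRay a hx.1 hr, rayIntegrand, mul_assoc (x ^ (a : ℂ))]

theorem hasDerivAt_Gamma_integral {a : ℝ} (ha : 0 < a) :
    HasDerivAt Complex.Gamma (∫ r in Set.Ioi (0 : ℝ),
      (r : ℂ) ^ ((a - 1 : ℝ) : ℂ) * Complex.log r * Complex.exp (-r)) a := by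
  have h := Complex.hasDerivAt_GammaIntegral (s := a) (by simpa using ha)
  have e : (∫ t : ℝ in Set.Ioi 0, (t : ℂ) ^ ((a : ℂ) - 1) * (Real.log t * Real.exp (-t))) =
      ∫ r in Set.Ioi (0 : ℝ), (r : ℂ) ^ ((a - 1 : ℝ) : ℂ) * Complex.log r * Complex.exp (-r) := by
    refine setIntegral_congr_fun measurableSet_Ioi fun r hr => ?_
    rw [Complex.ofReal_log (le_of_lt hr)]
    push_cast
    ring
  rw [e] at h
  refine h.congr_of_eventuallyEq ?_
  filter_upwards [isOpen_rightHalfPlane.mem_nhds (show (a : ℂ) ∈ rightHalfPlane by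
    simpa [mem_rightHalfPlane] using ha)] with s hs
  exact Complex.Gamma_eq_integral hs

theorem tendsto_scaledBesselLog {a : ℝ} (ha : 0 < a) :
    Tendsto (scaledBesselLog a) halfNhds (𝓝 (deriv Complex.Gamma a)) := by
  have hq : 0 < 2 * a := by positivity
  rw [(hasDerivAt_Gamma_integral ha).deriv]
  -- The constant `16 + 1/a` collects `2 (|log| + π)` from the first term and `2 (1/(2a) + π)` from
  -- the second, with `π < 4`.
  refine (tendsto_integral_ray (W := fun x r => (x + r) ^ ((a - 1 : ℝ) : ℂ) *
      (Complex.log (x + r) * (1 + (1 + r / x) ^ ((-(2 * a) : ℝ) : ℂ)) -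
        2 * (Complex.log (1 + r / x) * (1 + r / x) ^ ((-(2 * a) : ℝ) : ℂ))))
      (K := 16 + 1 / a) ha (fun x hx r hr => ?_) (fun r hr => ?_) fun x hx => ?_).congr' ?_
  · have hu := one_le_re_one_add_div (le_of_lt hx) hr.le
    have hu1 := one_le_norm_of_one_le_re hu
    have hun : 0 < ‖1 + (r : ℂ) / x‖ := by linarith
    have h1 := norm_ray_cpow_le_one hq hu
    have h2 := norm_add_le 1 ((1 + (r : ℂ) / x) ^ ((-(2 * a) : ℝ) : ℂ))
    rw [norm_one] at h2
    have h3 := norm_log_mul_cpow_le (q := 2 * a) hu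
    have h4 : Real.log ‖1 + (r : ℂ) / x‖ / ‖1 + (r : ℂ) / x‖ ^ (2 * a) ≤ 1 / (2 * a) := by
      rw [div_le_div_iff₀ (by positivity) hq, one_mul]
      have := Real.log_le_rpow_div hun.le hq
      rwa [le_div_iff₀ hq] at this
    have h5 : ‖1 + (r : ℂ) / x‖ ^ (-(2 * a)) ≤ 1 :=
      Real.rpow_le_one_of_one_le_of_nonpos hu1 (by linarith)
    have h6 := Complex.norm_log_le (x + r)
    have h7 := Real.pi_lt_four
    have h8 : Real.pi * ‖1 + (r : ℂ) / x‖ ^ (-(2 * a)) ≤ Real.pi := by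
      nlinarith [Real.pi_pos]
    have hl := abs_nonneg (Real.log ‖x + r‖)
    have e1 : 1 / (2 * a) = 1 / a / 2 := by field_simp
    have ha' : 0 < 1 / a := by positivity
    rw [norm_mul, Complex.norm_cpow_real, mul_left_comm (16 + 1 / a)]
    refine mul_le_mul_of_nonneg_left ?_ (Real.rpow_nonneg (norm_nonneg (x + r)) (a - 1))
    refine (norm_sub_le _ _).trans ?_
    rw [norm_mul, norm_mul (2 : ℂ), Complex.norm_ofNat]
    have h9 : ‖Complex.log (x + r)‖ * ‖1 + (1 + (r : ℂ) / x) ^ ((-(2 * a) : ℝ) : ℂ)‖ ≤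
        (|Real.log ‖x + r‖| + Real.pi) * 2 :=
      mul_le_mul h6 (by linarith) (norm_nonneg _) (add_nonneg hl Real.pi_pos.le)
    nlinarith [mul_nonneg ha'.le hl]
  · have hs := ofReal_mem_slitPlane hr
    have h1 := (tendsto_add_ofReal_halfNhds r).cpow
      (tendsto_const_nhds (x := ((a - 1 : ℝ) : ℂ))) hs
    have h2 := (tendsto_add_ofReal_halfNhds r).clog hs
    simpa using h1.mul ((h2.mul ((tendsto_ray_cpow hq hr).const_add 1)).sub
      ((tendsto_ray_log_mul_cpow hq hr).const_mul 2))
  · refine (((aestronglyMeasurable_rayIntegrand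
      (differentiableOn_besselLogRay a).continuousOn_one_le_re (le_of_lt hx)).add
        ((aestronglyMeasurable_rayIntegrand (differentiableOn_besselRay a).continuousOn_one_le_re
          (le_of_lt hx)).const_mul (Complex.log x))).const_mul (x ^ (a : ℂ))).congr ?_
    refine (ae_restrict_iff' measurableSet_Ioi).2 (Eventually.of_forall fun r hr => ?_)
    simp only [Pi.add_apply]
    rw [← cpow_mul_besselLogRay a hx hr, rayIntegrand, rayIntegrand]
    ring
  · filter_upwards [eventually_mem_halfNhds] with x hx
    have hx0 := ne_zero_of_mem_rightHalfPlane hx.1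
    rw [scaledBesselLog, besselInt_eq_ext ha hx.1, besselLogInt_eq_ext ha hx.1, besselExt,
      besselLogExt, rayIntegral, rayIntegral, ← integral_const_mul, ← integral_add
      (integrableOn_rayIntegrand (differentiableOn_besselLogRay a).continuousOn_one_le_re
        (fun u hu => norm_besselLogRay_le ha hu) (le_of_lt hx.1) hx0)
      ((integrableOn_rayIntegrand (differentiableOn_besselRay a).continuousOn_one_le_re
        (fun u hu => norm_besselRay_le ha hu) (le_of_lt hx.1) hx0).const_mul _),
      ← integral_const_mul]
    refine setIntegral_congr_fun measurableSet_Ioi fun r hr => ?_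
    rw [← cpow_mul_besselLogRay a hx.1 hr, rayIntegrand, rayIntegrand]
    ring

theorem Gamma_ofReal_ne_zero {a : ℝ} (ha : 0 < a) : Complex.Gamma a ≠ 0 :=
  Complex.Gamma_ne_zero_of_re_pos (by simpa using ha)

theorem deriv_Gamma_eq {a : ℝ} (ha : 0 < a) :
    deriv Complex.Gamma a = Complex.digamma a * Complex.Gamma a := by
  rw [Complex.digamma_def, logDeriv_apply, div_mul_cancel₀ _ (Gamma_ofReal_ne_zero ha)]

theorem digamma_ofReal_sub_one {p : ℝ} (hp : 1 < p) :
    Complex.digamma ((p - 1 : ℝ) : ℂ) = Complex.digamma p - ((p : ℂ) - 1)⁻¹ := by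
  have h := Complex.digamma_apply_add_one ((p - 1 : ℝ) : ℂ) (fun m hm => by
    have := congrArg Complex.re hm
    simp only [Complex.ofReal_re, Complex.neg_re, Complex.natCast_re] at this
    have : (0 : ℝ) ≤ m := m.cast_nonneg
    linarith)
  push_cast at h ⊢
  rw [sub_add_cancel] at h
  rw [h]
  ring

/-! ### Expansions at the origin -/

theorem Asymptotics.IsBigO.of_deriv_neg_two_mul {F G : ℂ → ℂ} {c d : ℝ} {n : ℕ} (hd : 0 < d)
    (hF : ∀ x ∈ rightHalfPlane, HasDerivAt F (-2 * x * G x) x) (h0 : Tendsto F halfNhds (𝓝 0))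
    (h : G =O[halfNhds] powLog c n) (hcd : c + 2 = d := by ring) : F =O[halfNhds] powLog d n := by
  subst hcd
  refine IsBigO.of_deriv_powLog hd hF h0 ?_
  exact (id_isBigO_powLog.const_mul_left (-2)).mul_powLog h (by ring) (by simp)

theorem cpow_mul_isBigO {F : ℂ → ℂ} {c : ℝ} {n : ℕ} (h : F =O[halfNhds] powLog c n) (q : ℝ) :
    (fun x => x ^ (q : ℂ) * F x) =O[halfNhds] powLog (q + c) n :=
  (cpow_isBigO_powLog q).mul_powLog h rfl (by simp)

/-- The combination `scaledBesselLog a - ψ * scaledBessel a`. -/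
noncomputable def scaledDiff (ψ : ℂ) (a : ℝ) (x : ℂ) : ℂ :=
  scaledBesselLog a x - ψ * scaledBessel a x

theorem hasDerivAt_scaledDiff (ψ : ℂ) (a : ℝ) {x : ℂ} (hx : x ∈ rightHalfPlane) :
    HasDerivAt (scaledDiff ψ a) (-2 * x * scaledDiff ψ (a - 1) x) x := by
  refine ((hasDerivAt_scaledBesselLog a hx).sub
    ((hasDerivAt_scaledBessel a hx).const_mul ψ)).congr_deriv ?_
  rw [scaledDiff]
  ring

theorem tendsto_scaledDiff (ψ : ℂ) {a : ℝ} (ha : 0 < a) : Tendsto (scaledDiff ψ a) halfNhds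
    (𝓝 ((Complex.digamma a - ψ) * Complex.Gamma a)) := by
  rw [sub_mul, ← deriv_Gamma_eq ha]
  exact (tendsto_scaledBesselLog ha).sub ((tendsto_scaledBessel ha).const_mul ψ)

theorem tendsto_scaledDiff_digamma {p : ℝ} (hp : 0 < p) :
    Tendsto (scaledDiff (Complex.digamma p) p) halfNhds (𝓝 0) := by
  simpa using tendsto_scaledDiff (Complex.digamma p) hp

theorem scaledDiff_neg (ψ : ℂ) (a : ℝ) {x : ℂ} (hx : x ≠ 0) :
    scaledDiff ψ (-a) x = x ^ ((-(2 * a) : ℝ) : ℂ) *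
      (2 * Complex.log x * scaledBessel a x - scaledBesselLog a x - ψ * scaledBessel a x) := by
  rw [scaledDiff, scaledBesselLog_neg a hx, scaledBessel_neg a hx]
  ring

theorem isBigO_scaledDiff_neg (ψ : ℂ) {a : ℝ} (ha : 0 < a) :
    scaledDiff ψ (-a) =O[halfNhds] powLog (-(2 * a)) 1 := by
  have h1 := (tendsto_scaledBessel ha).isBigO_powLog
  have h2 := (tendsto_scaledBesselLog ha).isBigO_powLog
  have h01 : powLog 0 0 =O[halfNhds] powLog 0 1 := powLog_isBigO_of_le le_rfl zero_le_one
  have h3 : (fun x => 2 * Complex.log x * scaledBessel a x - scaledBesselLog a x -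
      ψ * scaledBessel a x) =O[halfNhds] powLog 0 1 :=
    (((log_isBigO_powLog.const_mul_left 2).mul_powLog h1 (by ring)).sub (h2.trans h01)).sub
      ((h1.const_mul_left ψ).trans h01)
  have h4 := cpow_mul_isBigO h3 (-(2 * a))
  rw [add_zero] at h4
  refine h4.congr' ?_ EventuallyEq.rfl
  filter_upwards [eventually_mem_halfNhds] with x hx
  exact (scaledDiff_neg ψ a (ne_zero_of_mem_rightHalfPlane hx.1)).symm

theorem hasDerivAt_scaledBessel_sub_Gamma (a : ℝ) {x : ℂ} (hx : x ∈ rightHalfPlane) :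
    HasDerivAt (fun x => scaledBessel a x - Complex.Gamma a) (-2 * x * scaledBessel (a - 1) x) x :=
  (hasDerivAt_scaledBessel a hx).sub_const _

theorem tendsto_scaledBessel_sub_Gamma {a : ℝ} (ha : 0 < a) :
    Tendsto (fun x => scaledBessel a x - Complex.Gamma a) halfNhds (𝓝 0) := by
  simpa using (tendsto_scaledBessel ha).sub_const (Complex.Gamma a)

/-- By reflection `S_{a-1} = x^{-2(1-a)} S_{1-a} = O(|x|^{2a-2})`, and integrating `-2x S_{a-1}`
gains two powers. -/
theorem scaledBessel_sub_Gamma_isBigO_of_lt {a : ℝ} (ha : 0 < a) (ha1 : a < 1) :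
    (fun x => scaledBessel a x - Complex.Gamma a) =O[halfNhds] powLog (2 * a) 0 := by
  have h1 := cpow_mul_isBigO (tendsto_scaledBessel (sub_pos.2 ha1)).isBigO_powLog (-(2 * (1 - a)))
  refine IsBigO.of_deriv_neg_two_mul (by positivity)
    (fun x hx => hasDerivAt_scaledBessel_sub_Gamma a hx) (tendsto_scaledBessel_sub_Gamma ha)
    (h1.congr' ?_ EventuallyEq.rfl)
  filter_upwards [eventually_mem_halfNhds] with x hx
  rw [← scaledBessel_neg (1 - a) (ne_zero_of_mem_rightHalfPlane hx.1), neg_sub]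

theorem scaledBessel_sub_Gamma_isBigO_of_one_lt {a : ℝ} (ha : 1 < a) :
    (fun x => scaledBessel a x - Complex.Gamma a) =O[halfNhds] powLog 2 0 :=
  IsBigO.of_deriv_neg_two_mul (c := 0) two_pos
    (fun x hx => hasDerivAt_scaledBessel_sub_Gamma a hx)
    (tendsto_scaledBessel_sub_Gamma (by linarith))
    (tendsto_scaledBessel (sub_pos.2 ha)).isBigO_powLog

theorem scaledBessel_neg_one {x : ℂ} (hx : x ≠ 0) :
    x * scaledBessel (0 - 1) x = scaledBessel 1 x / x := by
  rw [zero_sub, scaledBessel_neg 1 hx, mul_one, Complex.ofReal_neg, Complex.ofReal_ofNat,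
    Complex.cpow_neg, Complex.cpow_ofNat]
  field_simp

theorem inv_isBigO_powLog : (fun x : ℂ => x⁻¹) =O[halfNhds] powLog (-1) 0 :=
  (cpow_isBigO_powLog (-1)).congr_left fun x => by simp [Complex.cpow_neg_one]

/-- From the recurrence at order one, `S_0 = x^{-2} (S_2 - S_1)`. The bound is far from sharp; it
only starts the integration from a half circle. -/
theorem scaledBessel_zero_isBigO_cpow : scaledBessel 0 =O[halfNhds] powLog (-2) 0 := by
  have h := cpow_mul_isBigO ((tendsto_scaledBessel (a := 2) two_pos).sub
    (tendsto_scaledBessel one_pos)).isBigO_powLog (-2)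
  rw [add_zero] at h
  refine h.congr' ?_ EventuallyEq.rfl
  filter_upwards [eventually_mem_halfNhds] with x hx
  have hx0 := ne_zero_of_mem_rightHalfPlane hx.1
  have hr := besselInt_recurrence 1 hx.1
  norm_num at hr
  rw [scaledBessel, scaledBessel, scaledBessel, Complex.ofReal_neg, Complex.ofReal_ofNat,
    Complex.cpow_neg, Complex.cpow_ofNat, Complex.ofReal_one, Complex.cpow_one, Complex.ofReal_zero,
    Complex.cpow_zero, hr]
  field_simp
  ring

/-- The derivative is `-2 S_1 / x = O(1/|x|)`, which integrates to a logarithm. -/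
theorem scaledBessel_zero_isBigO : scaledBessel 0 =O[halfNhds] powLog 0 1 := by
  have h1 : (fun x => -2 * x * scaledBessel (0 - 1) x) =O[halfNhds] powLog (-1) 0 := by
    have h := (inv_isBigO_powLog.const_mul_left (-2)).mul_powLog
      (tendsto_scaledBessel one_pos).isBigO_powLog (e := -1) (by ring)
    refine h.congr' ?_ EventuallyEq.rfl
    filter_upwards [eventually_mem_halfNhds] with x hx
    have := scaledBessel_neg_one (ne_zero_of_mem_rightHalfPlane hx.1)
    rw [mul_assoc (-2) x, this]
    ring
  obtain ⟨K, hK0, hK⟩ := h1.exists_nonneg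
  obtain ⟨C, hC⟩ := exists_norm_le_sub_of_deriv (g := fun r => K * Real.log r)
    (g' := fun r => K * r⁻¹) (fun x hx => hasDerivAt_scaledBessel 0 hx)
    (fun r hr => (Real.hasDerivAt_log hr.ne').const_mul K) (by
      filter_upwards [hK.bound] with x hx
      simpa [powLog, Real.rpow_neg_one] using hx) scaledBessel_zero_isBigO_cpow
  refine IsBigO.of_bound (|C| + K) ?_
  filter_upwards [hC, eventually_mem_halfNhds] with x hx hx1
  have h2 := one_le_one_sub_log hx1.2.le (norm_nonneg x)
  rw [Real.norm_of_nonneg (powLog_nonneg hx1.2 _ _), powLog, Real.rpow_zero, one_mul, pow_one]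
  nlinarith [le_abs_self C, abs_nonneg C]

theorem scaledBessel_one_sub_isBigO :
    (fun x => scaledBessel 1 x - 1) =O[halfNhds] powLog 2 1 := by
  have h : (fun x => scaledBessel 1 x - Complex.Gamma (1 : ℝ)) =O[halfNhds] powLog 2 1 :=
    IsBigO.of_deriv_neg_two_mul (c := 0) two_pos
      (fun x hx => hasDerivAt_scaledBessel_sub_Gamma 1 hx)
      (tendsto_scaledBessel_sub_Gamma one_pos) (by rw [sub_self]; exact scaledBessel_zero_isBigO)
  simpa using h

/-- The derivative is now `-2 (S_1 - 1) / x`, which is bounded because `S_1 - 1 = O(|x|² |log|)`. -/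
theorem scaledBessel_zero_add_isBigO :
    (fun x => scaledBessel 0 x + 2 * Complex.log x) =O[halfNhds] powLog 0 0 := by
  have h1 : (fun x => -2 * x * scaledBessel (0 - 1) x + 2 * x⁻¹) =O[halfNhds] powLog 0 0 := by
    have h := (inv_isBigO_powLog.const_mul_left (-2)).mul_powLog
      scaledBessel_one_sub_isBigO (e := 1) (by ring)
    refine (h.trans (powLog_isBigO_of_lt _ _ one_pos)).congr' ?_ EventuallyEq.rfl
    filter_upwards [eventually_mem_halfNhds] with x hx
    have := scaledBessel_neg_one (ne_zero_of_mem_rightHalfPlane hx.1)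
    rw [mul_assoc (-2) x, this]
    ring
  obtain ⟨K, hK0, hK⟩ := h1.exists_nonneg
  have h2 : (fun x => scaledBessel 0 x + 2 * Complex.log x) =O[halfNhds] powLog (-2) 0 :=
    scaledBessel_zero_isBigO_cpow.add ((log_isBigO_powLog.const_mul_left 2).trans
      (powLog_isBigO_of_lt _ _ (by norm_num)))
  obtain ⟨C, hC⟩ := exists_norm_le_sub_of_deriv (g := fun r => K * r)
    (g' := fun _ => K) (fun x hx => (hasDerivAt_scaledBessel 0 hx).add
      ((Complex.hasDerivAt_log (Or.inl hx)).const_mul 2))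
    (fun r hr => by simpa using (hasDerivAt_id r).const_mul K) (by
      filter_upwards [hK.bound] with x hx
      simpa [powLog] using hx) h2
  refine IsBigO.of_bound C ?_
  filter_upwards [hC] with x hx
  have : 0 ≤ K * ‖x‖ := by positivity
  simpa [powLog] using (hx.trans (by linarith : C - K * ‖x‖ ≤ C))

/-- Division of an expansion by `scaledBessel`. -/
theorem scaledDiff_div_isBigO {p c d e : ℝ} {n m k : ℕ} (hp : 0 < p) {F F₀ : ℂ → ℂ}
    (h : (fun x => F x - F₀ x) =O[halfNhds] powLog c n) (h₀ : F₀ =O[halfNhds] powLog d m)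
    (hΓ : (fun x => scaledBessel p x - Complex.Gamma p) =O[halfNhds] powLog e k)
    (hle : powLog (d + e) (m + k) =O[halfNhds] powLog c n) :
    (fun x => F x / scaledBessel p x - F₀ x / Complex.Gamma p) =O[halfNhds] powLog c n := by
  have hg := Gamma_ofReal_ne_zero hp
  have hi := ((tendsto_scaledBessel hp).inv₀ hg).isBigO_powLog
  have h1 := (h.mul_powLog hi (add_zero _)).sub ((((h₀.mul_powLog hΓ rfl).trans hle).const_mul_left
    (Complex.Gamma p)⁻¹).mul_powLog hi (add_zero _))
  refine h1.congr' ?_ EventuallyEq.rfl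
  filter_upwards [(tendsto_scaledBessel hp).eventually_ne hg] with x hx
  field_simp
  ring

/-- By reflection `D_p' = -2x D_{p-1}` has leading term `-4 Γ(1-p) x^{2p-1} log x`. Its primitive is
`-(2 Γ(1-p)/p) x^{2p} log x` up to `O(|x|^{2p})`, and dividing by `Γ(p)` turns `p Γ(p)` into
`Γ(1+p)`. -/
theorem scaledDiff_div_isBigO_of_lt_one {p : ℝ} (hp : 0 < p) (hp1 : p < 1) :
    (fun x => scaledDiff (Complex.digamma p) p x / scaledBessel p x +
      2 * (Complex.Gamma (1 - p) / Complex.Gamma (1 + p)) *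
        (x ^ ((2 * p : ℝ) : ℂ) * Complex.log x)) =O[halfNhds] powLog (2 * p) 0 := by
  have h2p : 0 < 2 * p := by positivity
  have hb : 0 < 1 - p := sub_pos.2 hp1
  have hp0 : (p : ℂ) ≠ 0 := by exact_mod_cast hp.ne'
  set g : ℂ := Complex.Gamma ((1 - p : ℝ) : ℂ) with hg
  set F₀ : ℂ → ℂ := fun x => -(2 * g / p) * (x ^ ((2 * p : ℝ) : ℂ) * Complex.log x) with hF₀
  have h₀ : F₀ =O[halfNhds] powLog (2 * p) 1 :=
    ((cpow_isBigO_powLog (2 * p)).mul_powLog log_isBigO_powLog (add_zero _)).const_mul_left _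
  have hcube : (fun x : ℂ => x ^ ((2 * p - 1 : ℝ) : ℂ)) =O[halfNhds] powLog (2 * p - 1) 0 :=
    cpow_isBigO_powLog _
  have hlog := log_isBigO_powLog.mul_powLog (scaledBessel_sub_Gamma_isBigO_of_lt hb (by linarith))
    (zero_add (2 * (1 - p)))
  -- What remains of the derivative after factoring out `x^{2p-1}`: the logarithm survives only
  -- multiplied by `S_{1-p} - Γ(1-p)`, and `2g/p` comes from differentiating the logarithm in `F₀`.
  have hsum : (fun x => -4 * (Complex.log x * (scaledBessel (1 - p) x - g)) +
      2 * scaledBesselLog (1 - p) x + 2 * Complex.digamma p * scaledBessel (1 - p) x + 2 * g / p)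
      =O[halfNhds] powLog 0 0 :=
    ((((hlog.trans (powLog_isBigO_of_lt _ 0 (by positivity))).const_mul_left (-4)).add
      ((tendsto_scaledBesselLog hb).isBigO_powLog.const_mul_left 2)).add
      ((tendsto_scaledBessel hb).isBigO_powLog.const_mul_left _)).add (const_isBigO_powLog _)
  have hd : (fun x => scaledDiff (Complex.digamma p) p x - F₀ x) =O[halfNhds] powLog (2 * p) 0 := by
    refine IsBigO.of_deriv_powLog h2p (fun x hx => (hasDerivAt_scaledDiff _ p hx).sub
      (((hasDerivAt_cpow_ofReal (2 * p) hx).mul (Complex.hasDerivAt_log (Or.inl hx))).const_mul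
        (-(2 * g / p)))) ?_ ((hcube.mul_powLog hsum (add_zero _)).congr' ?_ EventuallyEq.rfl)
    · simpa using (tendsto_scaledDiff_digamma hp).sub (h₀.tendsto_zero_of_powLog h2p)
    · filter_upwards [eventually_mem_halfNhds] with x hx
      have hx0 := ne_zero_of_mem_rightHalfPlane hx.1
      rw [show p - 1 = -(1 - p) by ring, scaledDiff_neg _ _ hx0,
        show -(2 * (1 - p)) = 2 * p - 1 - 1 by ring, cpow_ofReal_sub_one hx0 (2 * p - 1),
        cpow_ofReal_sub_one hx0 (2 * p)]
      push_cast
      field_simp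
      ring
  have h := scaledDiff_div_isBigO hp hd h₀ (scaledBessel_sub_Gamma_isBigO_of_lt hp hp1)
    (powLog_isBigO_of_lt _ _ (by linarith))
  refine h.congr_left fun x => ?_
  rw [add_comm (1 : ℂ) p, Complex.Gamma_add_one _ hp0, hF₀, hg]
  have := Gamma_ofReal_ne_zero hp
  push_cast
  field_simp
  ring

/-- Here `D_1' = -2x (log x - ψ(1)) S_0` with `S_0 = -2 log x + O(1)`. The leading term `4x log² x`
integrates to `2x² log² x`. -/
theorem scaledDiff_div_isBigO_one :
    (fun x => scaledDiff (Complex.digamma (1 : ℝ)) 1 x / scaledBessel 1 x -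
      2 * (x ^ 2 * Complex.log x ^ 2)) =O[halfNhds] powLog 2 1 := by
  set F₀ : ℂ → ℂ := fun x => 2 * (x ^ 2 * Complex.log x ^ 2) with hF₀
  have hl2 : (fun x => Complex.log x * Complex.log x) =O[halfNhds] powLog 0 2 :=
    log_isBigO_powLog.mul_powLog log_isBigO_powLog (add_zero _)
  have h₀ : F₀ =O[halfNhds] powLog 2 2 := by
    refine (((cpow_isBigO_powLog 2).mul_powLog hl2 (add_zero _)).const_mul_left 2).congr_left
      fun x => ?_
    rw [hF₀, Complex.ofReal_ofNat, Complex.cpow_ofNat]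
    ring
  have h01 : powLog 0 0 =O[halfNhds] powLog 0 1 := powLog_isBigO_of_le le_rfl zero_le_one
  have hsum : (fun x => -2 * (Complex.log x * (scaledBessel 0 x + 2 * Complex.log x)) +
      2 * Complex.digamma (1 : ℝ) * scaledBessel 0 x - 4 * Complex.log x)
      =O[halfNhds] powLog 0 1 :=
    (((log_isBigO_powLog.mul_powLog scaledBessel_zero_add_isBigO (add_zero _)).const_mul_left
      (-2)).add (scaledBessel_zero_isBigO.const_mul_left _)).sub (log_isBigO_powLog.const_mul_left 4)
  have hd : (fun x => scaledDiff (Complex.digamma (1 : ℝ)) 1 x - F₀ x) =O[halfNhds] powLog 2 1 := by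
    refine IsBigO.of_deriv_powLog two_pos (fun x hx => (hasDerivAt_scaledDiff _ 1 hx).sub
      (((hasDerivAt_pow 2 x).mul ((Complex.hasDerivAt_log (Or.inl hx)).pow 2)).const_mul
        2)) ?_ ((id_isBigO_powLog.mul_powLog hsum (by norm_num)).congr' ?_ EventuallyEq.rfl)
    · simpa using (tendsto_scaledDiff_digamma one_pos).sub (h₀.tendsto_zero_of_powLog two_pos)
    · filter_upwards [eventually_mem_halfNhds] with x hx
      have hx0 := ne_zero_of_mem_rightHalfPlane hx.1
      rw [sub_self, scaledDiff, scaledBesselLog_zero]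
      simp only [Pi.pow_apply]
      field_simp
      ring
  have h := scaledDiff_div_isBigO one_pos hd h₀ (e := 2) (k := 1)
    (by simpa using scaledBessel_one_sub_isBigO) (powLog_isBigO_of_lt _ _ (by norm_num))
  simpa using h

/-- Integrate twice. The value of `D_{p-1}` at the origin is `(ψ(p-1) - ψ(p)) Γ(p-1) =
-Γ(p-1)/(p-1)`, so `D_p` starts with `Γ(p-1)/(p-1) · x²`; division by `Γ(p) = (p-1) Γ(p-1)` gives
the coefficient. The size of `D_{p-2}`, left as a hypothesis, fixes the error. -/
theorem scaledDiff_div_isBigO_of_one_lt {p c : ℝ} {n : ℕ} (hp : 1 < p) (hc : 0 < c) (hc2 : c ≤ 2)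
    (hD : scaledDiff (Complex.digamma p) (p - 2) =O[halfNhds] powLog (c - 2) n) :
    (fun x => scaledDiff (Complex.digamma p) p x / scaledBessel p x -
      1 / ((p : ℂ) - 1) ^ 2 * x ^ 2) =O[halfNhds] powLog (c + 2) n := by
  have hp0 : 0 < p := by linarith
  have hq : 0 < p - 1 := by linarith
  have hqc : (p : ℂ) - 1 ≠ 0 := by exact_mod_cast hq.ne'
  set g : ℂ := Complex.Gamma ((p - 1 : ℝ) : ℂ) / ((p : ℂ) - 1) with hg
  have h1 : (fun x => scaledDiff (Complex.digamma p) (p - 1) x + g) =O[halfNhds] powLog c n := by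
    refine IsBigO.of_deriv_neg_two_mul (G := scaledDiff (Complex.digamma p) (p - 2)) hc
      (fun x hx => ?_) ?_ hD
    · refine ((hasDerivAt_scaledDiff _ (p - 1) hx).add_const g).congr_deriv ?_
      rw [show p - 1 - 1 = p - 2 by ring]
    · have := (tendsto_scaledDiff (Complex.digamma p) hq).add_const g
      rw [digamma_ofReal_sub_one hp] at this
      convert this using 2
      rw [hg]
      ring
  set F₀ : ℂ → ℂ := fun x => g * x ^ 2 with hF₀
  have h₀ : F₀ =O[halfNhds] powLog 2 0 := by
    refine ((cpow_isBigO_powLog 2).const_mul_left g).congr_left fun x => ?_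
    rw [hF₀, Complex.ofReal_ofNat, Complex.cpow_ofNat]
  have hd : (fun x => scaledDiff (Complex.digamma p) p x - F₀ x) =O[halfNhds] powLog (c + 2) n := by
    refine IsBigO.of_deriv_neg_two_mul (by positivity) (fun x hx => ?_) ?_ h1
    · refine ((hasDerivAt_scaledDiff _ p hx).sub ((hasDerivAt_pow 2 x).const_mul g)).congr_deriv ?_
      push_cast
      ring
    · simpa using (tendsto_scaledDiff_digamma hp0).sub (h₀.tendsto_zero_of_powLog two_pos)
  have h := scaledDiff_div_isBigO hp0 hd h₀ (scaledBessel_sub_Gamma_isBigO_of_one_lt hp)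
    (powLog_isBigO_of_le (by linarith) (by simp))
  refine h.congr_left fun x => ?_
  have e : Complex.Gamma p = ((p : ℂ) - 1) * Complex.Gamma ((p - 1 : ℝ) : ℂ) := by
    have := Complex.Gamma_add_one ((p - 1 : ℝ) : ℂ) (by exact_mod_cast hq.ne')
    push_cast at this ⊢
    rwa [sub_add_cancel] at this
  have := Gamma_ofReal_ne_zero hq
  rw [hF₀, hg, e]
  field_simp

/-! ### Passage to the closed half plane and to the parameter `s` -/

/-- The closed right half plane without the origin. -/
def closedHalfPlane : Set ℂ := {x | 0 ≤ x.re ∧ x ≠ 0}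

/-- Both sides are continuous away from the origin, so the bound extends to boundary points with the
same constant. This covers `α = ±π/2`. -/
theorem Asymptotics.IsBigO.closedHalfPlane {F : ℂ → ℂ} {c : ℝ} {n : ℕ}
    (h : F =O[halfNhds] powLog c n) (hF : ContinuousOn F closedHalfPlane) :
    F =O[𝓝[closedHalfPlane] 0] powLog c n := by
  obtain ⟨K, hK⟩ := h.bound
  obtain ⟨δ, hδ, H⟩ := eventually_halfNhds.1 hK
  refine IsBigO.of_bound K ?_
  rw [eventually_nhdsWithin_iff, Metric.eventually_nhds_iff]
  refine ⟨δ, hδ, fun x hxδ hx => ?_⟩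
  rw [dist_zero_right] at hxδ
  obtain ⟨u, hu, hure⟩ := exists_seq_rightHalfPlane hx.1
  have hn : ‖x‖ ≠ 0 := norm_ne_zero_iff.2 hx.2
  have hp : ContinuousAt (fun r : ℝ => r ^ c * (1 - Real.log r) ^ n) ‖x‖ :=
    (Real.continuousAt_rpow_const _ _ (Or.inl hn)).mul
      ((continuousAt_const.sub (Real.continuousAt_log hn)).pow n)
  have T1 : Tendsto (fun k => ‖F (u k)‖) atTop (𝓝 ‖F x‖) := by
    refine ((hF x hx).tendsto.comp (tendsto_nhdsWithin_iff.2 ⟨hu, Eventually.of_forall fun k => ?_⟩)).norm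
    exact ⟨(hure k).le, ne_zero_of_mem_rightHalfPlane (hure k)⟩
  have T2 : Tendsto (fun k => K * ‖powLog c n (u k)‖) atTop (𝓝 (K * ‖powLog c n x‖)) :=
    ((hp.tendsto.comp hu.norm).norm).const_mul K
  refine le_of_tendsto_of_tendsto T1 T2 ?_
  filter_upwards [hu.norm.eventually_lt_const hxδ] with k hk
  exact H _ (hure k) hk

theorem continuousOn_rayIntegral {φ : ℂ → ℂ} (hd : DifferentiableOn ℂ φ rightHalfPlane)
    {C : ℝ} {N : ℕ} (hφ : ∀ u : ℂ, 1 ≤ u.re → ‖φ u‖ ≤ C * ‖u‖ ^ N) :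
    ContinuousOn (rayIntegral φ) closedHalfPlane := fun x hx =>
  tendsto_rayIntegral_fixed (l := 𝓝[closedHalfPlane] x) hd hφ
    (tendsto_id.mono_left nhdsWithin_le_nhds) hx.2
    (eventually_nhdsWithin_of_forall fun _ hy => hy.1) hx.1

/-- The remainder after the logarithm and the digamma term, as a function of `x = exp (-iα) / s`. -/
noncomputable def lyapunovRemainder (p : ℝ) (x : ℂ) : ℂ :=
  besselLogExt p x / besselExt p x + Complex.log x - Complex.digamma p

theorem mem_slitPlane_of_mem_closedHalfPlane {x : ℂ} (hx : x ∈ closedHalfPlane) :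
    x ∈ Complex.slitPlane := by
  rw [Complex.mem_slitPlane_iff]
  rcases hx.1.lt_or_eq with h | h
  · exact Or.inl h
  · exact Or.inr fun h0 => hx.2 (Complex.ext h.symm h0)

theorem continuousOn_lyapunovRemainder {p : ℝ} (hp : 0 < p) :
    ContinuousOn (lyapunovRemainder p) closedHalfPlane :=
  (((continuousOn_rayIntegral (differentiableOn_besselLogRay p)
    fun _ hu => norm_besselLogRay_le hp hu).div (continuousOn_rayIntegral
      (differentiableOn_besselRay p) fun _ hu => norm_besselRay_le hp hu)
      fun _ hx => besselExt_ne_zero hp hx.1 hx.2).add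
        (continuousOn_id.clog fun _ hx => mem_slitPlane_of_mem_closedHalfPlane hx)).sub
          continuousOn_const

theorem scaledDiff_div_eq_lyapunovRemainder {p : ℝ} (hp : 0 < p) {x : ℂ} (hx : x ∈ rightHalfPlane) :
    scaledDiff (Complex.digamma p) p x / scaledBessel p x = lyapunovRemainder p x := by
  have hx0 := ne_zero_of_mem_rightHalfPlane hx
  have h1 := besselExt_ne_zero hp (le_of_lt hx) hx0
  have h2 : x ^ (p : ℂ) ≠ 0 := by simp [Complex.cpow_eq_zero_iff, hx0]
  rw [scaledDiff, scaledBesselLog, scaledBessel, besselInt_eq_ext hp hx, besselLogInt_eq_ext hp hx,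
    lyapunovRemainder]
  field_simp

/-- The point `exp (-iα) / s`. -/
noncomputable def scalePoint (α s : ℝ) : ℂ := (s⁻¹ : ℝ) * Complex.exp (-(Complex.I * α))

theorem scalePoint_eq (α s : ℝ) : scalePoint α s = (s⁻¹ : ℝ) * Complex.exp ((-α : ℝ) * Complex.I) := by
  rw [scalePoint]
  congr 2
  push_cast
  ring

theorem norm_scalePoint (α : ℝ) {s : ℝ} (hs : 0 < s) : ‖scalePoint α s‖ = s⁻¹ := by
  rw [scalePoint_eq, norm_mul, Complex.norm_exp_ofReal_mul_I, mul_one, Complex.norm_real,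
    Real.norm_of_nonneg (inv_pos.2 hs).le]

theorem scalePoint_mem {α s : ℝ} (hα : α ∈ Set.Icc (-(Real.pi / 2)) (Real.pi / 2)) (hs : 0 < s) :
    scalePoint α s ∈ closedHalfPlane := by
  refine ⟨?_, norm_ne_zero_iff.1 ?_⟩
  · rw [scalePoint_eq, Complex.re_ofReal_mul, Complex.exp_ofReal_mul_I_re, Real.cos_neg]
    exact mul_nonneg (inv_pos.2 hs).le (Real.cos_nonneg_of_mem_Icc hα)
  · rw [norm_scalePoint α hs]
    exact (inv_pos.2 hs).ne'

theorem log_scalePoint {α s : ℝ} (hα : α ∈ Set.Icc (-(Real.pi / 2)) (Real.pi / 2)) (hs : 0 < s) :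
    Complex.log (scalePoint α s) = -(Real.log s + α * Complex.I : ℂ) := by
  have him : (((-α : ℝ) : ℂ) * Complex.I).im = -α := by simp
  rw [scalePoint_eq, Complex.log_ofReal_mul (inv_pos.2 hs) (Complex.exp_ne_zero _),
    Complex.log_exp (by rw [him]; linarith [hα.2, Real.pi_pos])
      (by rw [him]; linarith [hα.1, Real.pi_pos]), Real.log_inv]
  push_cast
  ring

theorem tendsto_scalePoint {α : ℝ} (hα : α ∈ Set.Icc (-(Real.pi / 2)) (Real.pi / 2)) :
    Tendsto (scalePoint α) atTop (𝓝[closedHalfPlane] 0) := by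
  refine tendsto_nhdsWithin_iff.2 ⟨?_, (eventually_gt_atTop 0).mono fun s hs => scalePoint_mem hα hs⟩
  rw [tendsto_zero_iff_norm_tendsto_zero]
  exact tendsto_inv_atTop_zero.congr' ((eventually_gt_atTop 0).mono fun s hs =>
    (norm_scalePoint α hs).symm)

theorem powLog_scalePoint_isBigO (α c : ℝ) (n : ℕ) :
    (fun s => powLog c n (scalePoint α s)) =O[atTop] fun s => Real.log s ^ n / s ^ c := by
  refine IsBigO.of_bound (2 ^ n) ?_
  -- Once `log s ≥ 1` the factor `1 + log s` is at most `2 log s`, whence the constant `2 ^ n`.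
  filter_upwards [eventually_gt_atTop 0, Real.tendsto_log_atTop.eventually_ge_atTop 1] with s hs hl
  rw [powLog, norm_scalePoint α hs, Real.log_inv, Real.inv_rpow hs.le, sub_neg_eq_add,
    Real.norm_of_nonneg (by positivity), Real.norm_of_nonneg (by positivity), mul_comm,
    ← div_eq_mul_inv, ← mul_div_assoc, ← mul_pow]
  gcongr
  linarith

theorem re_isBigO_scalePoint {p α c : ℝ} {n : ℕ} (hp : 0 < p)
    (hα : α ∈ Set.Icc (-(Real.pi / 2)) (Real.pi / 2)) {G : ℂ → ℂ} (hG : ContinuousOn G closedHalfPlane)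
    (h : (fun x => scaledDiff (Complex.digamma p) p x / scaledBessel p x - G x)
      =O[halfNhds] powLog c n) :
    (fun s => (lyapunovRemainder p (scalePoint α s)).re - (G (scalePoint α s)).re) =O[atTop]
      fun s => Real.log s ^ n / s ^ c := by
  have h1 : (fun x => lyapunovRemainder p x - G x) =O[halfNhds] powLog c n := by
    refine h.congr' ?_ EventuallyEq.rfl
    filter_upwards [eventually_mem_halfNhds] with x hx
    rw [scaledDiff_div_eq_lyapunovRemainder hp hx.1]
  have h2 := ((h1.closedHalfPlane ((continuousOn_lyapunovRemainder hp).sub hG)).comp_tendsto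
    (tendsto_scalePoint hα)).trans (powLog_scalePoint_isBigO α c n)
  refine (IsBigO.of_bound 1 (Eventually.of_forall fun s => ?_)).trans h2
  rw [Function.comp_apply, ← Complex.sub_re, one_mul]
  exact Complex.abs_re_le_norm _

theorem cpow_scalePoint {α s : ℝ} (hα : α ∈ Set.Icc (-(Real.pi / 2)) (Real.pi / 2)) (hs : 0 < s)
    (q : ℝ) : scalePoint α s ^ (q : ℂ) =
      ((1 / s ^ q : ℝ) : ℂ) * (Real.cos (q * α) - Real.sin (q * α) * Complex.I) := by
  rw [Complex.cpow_def_of_ne_zero (scalePoint_mem hα hs).2, log_scalePoint hα hs,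
    show -(Real.log s + α * Complex.I : ℂ) * q = ((-(q * Real.log s) : ℝ) : ℂ) +
      ((-(q * α) : ℝ) : ℂ) * Complex.I by push_cast; ring, Complex.exp_add, ← Complex.ofReal_exp,
    Complex.exp_mul_I, ← Complex.ofReal_cos, ← Complex.ofReal_sin, Real.cos_neg, Real.sin_neg,
    Real.exp_neg, mul_comm q, Real.exp_mul, Real.exp_log hs, one_div]
  push_cast
  ring

theorem sq_scalePoint {α s : ℝ} (hα : α ∈ Set.Icc (-(Real.pi / 2)) (Real.pi / 2)) (hs : 0 < s) :
    scalePoint α s ^ 2 =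
      ((1 / s ^ 2 : ℝ) : ℂ) * (Real.cos (2 * α) - Real.sin (2 * α) * Complex.I) := by
  have := cpow_scalePoint hα hs 2
  rwa [Complex.ofReal_ofNat, Complex.cpow_ofNat, Real.rpow_ofNat] at this

theorem continuousOn_clog_closedHalfPlane : ContinuousOn Complex.log closedHalfPlane :=
  continuousOn_id.clog fun _ hx => mem_slitPlane_of_mem_closedHalfPlane hx

theorem continuousOn_cpow_closedHalfPlane (q : ℂ) :
    ContinuousOn (fun x : ℂ => x ^ q) closedHalfPlane :=
  continuousOn_id.cpow_const fun _ hx => mem_slitPlane_of_mem_closedHalfPlane hx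

theorem re_ofReal_add_ofReal_mul_I (a b : ℝ) : ((a : ℂ) + (b : ℂ) * Complex.I).re = a := by simp

/-! ### Real parts of the leading terms in the three regimes. -/

theorem remainder_isBigO_of_lt_one {p α : ℝ} (hp : 0 < p) (hp1 : p < 1)
    (hα : α ∈ Set.Icc (-(Real.pi / 2)) (Real.pi / 2)) :
    (fun s : ℝ => (lyapunovRemainder p (scalePoint α s)).re - 2 * Real.cos (2 * p * α) *
      (Real.Gamma (1 - p) / Real.Gamma (1 + p)) * (Real.log s / s ^ (2 * p))) =O[atTop]
        fun s : ℝ => 1 / s ^ (2 * p) := by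
  set k : ℝ := Real.Gamma (1 - p) / Real.Gamma (1 + p) with hk
  have hkc : Complex.Gamma (1 - p) / Complex.Gamma (1 + p) = k := by
    rw [hk]
    push_cast
    rw [← Complex.Gamma_ofReal, ← Complex.Gamma_ofReal]
    push_cast
    rfl
  have h := re_isBigO_scalePoint hp hα (G := fun x =>
    -(2 * (k : ℂ) * (x ^ ((2 * p : ℝ) : ℂ) * Complex.log x)))
    ((continuousOn_const.mul ((continuousOn_cpow_closedHalfPlane _).mul
      continuousOn_clog_closedHalfPlane)).neg)
    ((scaledDiff_div_isBigO_of_lt_one hp hp1).congr_left fun x => by rw [hkc, sub_neg_eq_add])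
  simp only [pow_zero] at h
  -- Since `log x = -(log s + iα)`, the leading term also produces a contribution in `α sin (2pα)`
  -- without `log s`; it belongs to the error.
  have h2 : (fun s : ℝ => -2 * k * (α * Real.sin (2 * p * α)) * (1 / s ^ (2 * p))) =O[atTop]
      fun s : ℝ => 1 / s ^ (2 * p) := (isBigO_refl _ _).const_mul_left _
  refine (h.sub h2).congr' ?_ EventuallyEq.rfl
  filter_upwards [eventually_gt_atTop 0] with s hs
  have e : (-(2 * (k : ℂ) * (scalePoint α s ^ ((2 * p : ℝ) : ℂ) *
      Complex.log (scalePoint α s)))).re =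
      2 * k * (1 / s ^ (2 * p)) * (Real.cos (2 * p * α) * Real.log s + α * Real.sin (2 * p * α)) := by
    rw [cpow_scalePoint hα hs, log_scalePoint hα hs,
      show -(2 * (k : ℂ) * (((1 / s ^ (2 * p) : ℝ) : ℂ) * (Real.cos (2 * p * α) -
        Real.sin (2 * p * α) * Complex.I) * -(Real.log s + α * Complex.I))) =
        ((2 * k * (1 / s ^ (2 * p)) * (Real.cos (2 * p * α) * Real.log s +
          α * Real.sin (2 * p * α)) : ℝ) : ℂ) + ((2 * k * (1 / s ^ (2 * p)) *
          (Real.cos (2 * p * α) * α - Real.sin (2 * p * α) * Real.log s) : ℝ) : ℂ) * Complex.I by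
        push_cast
        linear_combination (-2 * (k : ℂ) * (1 / ((s ^ (2 * p) : ℝ) : ℂ)) *
          Complex.sin (2 * p * α) * α) * Complex.I_sq, re_ofReal_add_ofReal_mul_I]
  rw [e]
  ring

theorem remainder_isBigO_one {α : ℝ} (hα : α ∈ Set.Icc (-(Real.pi / 2)) (Real.pi / 2)) :
    (fun s : ℝ => (lyapunovRemainder 1 (scalePoint α s)).re -
      2 * Real.cos (2 * α) * (Real.log s ^ 2 / s ^ 2)) =O[atTop] fun s : ℝ => Real.log s / s ^ 2 := by
  have h := re_isBigO_scalePoint one_pos hα (G := fun x => 2 * (x ^ 2 * Complex.log x ^ 2))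
    (continuousOn_const.mul ((continuousOn_id.pow 2).mul (continuousOn_clog_closedHalfPlane.pow 2)))
    scaledDiff_div_isBigO_one
  simp only [pow_one, Real.rpow_ofNat] at h
  have hl : (fun s : ℝ => 1 / s ^ 2) =O[atTop] fun s : ℝ => Real.log s / s ^ 2 := by
    refine IsBigO.of_bound 1 ?_
    filter_upwards [eventually_gt_atTop 0, Real.tendsto_log_atTop.eventually_ge_atTop 1] with s hs hl
    rw [Real.norm_of_nonneg (by positivity), Real.norm_of_nonneg (by positivity), one_mul]
    gcongr
  -- The terms of `log² x` containing `α` carry at most one factor `log s` and are absorbed in the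
  -- error.
  have h2 : (fun s : ℝ => -2 * α ^ 2 * Real.cos (2 * α) * (1 / s ^ 2) +
      4 * α * Real.sin (2 * α) * (Real.log s / s ^ 2)) =O[atTop] fun s : ℝ => Real.log s / s ^ 2 :=
    (hl.const_mul_left _).add ((isBigO_refl _ _).const_mul_left _)
  refine (h.add h2).congr' ?_ EventuallyEq.rfl
  filter_upwards [eventually_gt_atTop 0] with s hs
  have e : (2 * (scalePoint α s ^ 2 * Complex.log (scalePoint α s) ^ 2)).re =
      2 * (1 / s ^ 2) * (Real.cos (2 * α) * (Real.log s ^ 2 - α ^ 2) +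
        2 * α * Real.sin (2 * α) * Real.log s) := by
    rw [sq_scalePoint hα hs, log_scalePoint hα hs,
      show 2 * (((1 / s ^ 2 : ℝ) : ℂ) * (Real.cos (2 * α) - Real.sin (2 * α) * Complex.I) *
        (-(Real.log s + α * Complex.I)) ^ 2) = ((2 * (1 / s ^ 2) * (Real.cos (2 * α) *
        (Real.log s ^ 2 - α ^ 2) + 2 * α * Real.sin (2 * α) * Real.log s) : ℝ) : ℂ) +
        ((2 * (1 / s ^ 2) * (Real.cos (2 * α) * (2 * α * Real.log s) - Real.sin (2 * α) *
        (Real.log s ^ 2 - α ^ 2)) : ℝ) : ℂ) * Complex.I by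
        push_cast
        linear_combination (2 * (1 / (s : ℂ) ^ 2) * (Complex.cos (2 * α) * α ^ 2 -
          Complex.sin (2 * α) * (2 * (Real.log s : ℂ) * α + α ^ 2 * Complex.I))) * Complex.I_sq, re_ofReal_add_ofReal_mul_I]
  rw [e]
  ring

theorem remainder_isBigO_of_one_lt {p α c : ℝ} {n : ℕ} (hp : 1 < p) (hc : 0 < c) (hc2 : c ≤ 2)
    (hD : scaledDiff (Complex.digamma p) (p - 2) =O[halfNhds] powLog (c - 2) n)
    (hα : α ∈ Set.Icc (-(Real.pi / 2)) (Real.pi / 2)) :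
    (fun s : ℝ => (lyapunovRemainder p (scalePoint α s)).re -
      Real.cos (2 * α) / (p - 1) ^ 2 * (1 / s ^ 2)) =O[atTop]
        fun s : ℝ => Real.log s ^ n / s ^ (c + 2) := by
  have h := re_isBigO_scalePoint (by linarith) hα (G := fun x => 1 / ((p : ℂ) - 1) ^ 2 * x ^ 2)
    (continuousOn_const.mul (continuousOn_id.pow 2)) (scaledDiff_div_isBigO_of_one_lt hp hc hc2 hD)
  refine h.congr' ?_ EventuallyEq.rfl
  filter_upwards [eventually_gt_atTop 0] with s hs
  have e : (1 / ((p : ℂ) - 1) ^ 2 * scalePoint α s ^ 2).re =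
      Real.cos (2 * α) / (p - 1) ^ 2 * (1 / s ^ 2) := by
    rw [sq_scalePoint hα hs,
      show 1 / ((p : ℂ) - 1) ^ 2 * (((1 / s ^ 2 : ℝ) : ℂ) * (Real.cos (2 * α) -
        Real.sin (2 * α) * Complex.I)) = ((Real.cos (2 * α) / (p - 1) ^ 2 * (1 / s ^ 2) : ℝ) : ℂ) +
        ((-(Real.sin (2 * α) / (p - 1) ^ 2 * (1 / s ^ 2)) : ℝ) : ℂ) * Complex.I by
        push_cast
        ring, re_ofReal_add_ofReal_mul_I]
  rw [e]

theorem remainder_isBigO_errorOrder {p α : ℝ} (hp : 1 < p)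
    (hα : α ∈ Set.Icc (-(Real.pi / 2)) (Real.pi / 2)) :
    (fun s : ℝ => (lyapunovRemainder p (scalePoint α s)).re -
      Real.cos (2 * α) / (p - 1) ^ 2 * (1 / s ^ 2)) =O[atTop] errorOrder p := by
  rcases lt_trichotomy p 2 with h | h | h
  -- The index `p - 2` is negative, so reflection gives `D_{p-2} = O(|x|^{2p-4} |log|)`, that is `c
  -- = 2p - 2` with one logarithm.
  · have hD := isBigO_scaledDiff_neg (Complex.digamma p) (sub_pos.2 h)
    refine (remainder_isBigO_of_one_lt (c := 2 * p - 2) (n := 1) hp (by linarith) (by linarith) ?_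
      hα).congr_right fun s => ?_
    · convert hD using 2 <;> ring
    · rw [errorOrder, if_pos h, pow_one, sub_add_cancel]
  · subst h
    -- At index zero `D_0 = (log x - ψ(2)) S_0`, and each factor contributes one logarithm.
    have hD : scaledDiff (Complex.digamma (2 : ℝ)) (2 - 2) =O[halfNhds] powLog (2 - 2) 2 := by
      rw [sub_self]
      have h1 := (log_isBigO_powLog.sub ((const_isBigO_powLog (Complex.digamma (2 : ℝ))).trans
        (powLog_isBigO_of_le le_rfl zero_le_one))).mul_powLog scaledBessel_zero_isBigO (add_zero 0)
      refine h1.congr_left fun x => ?_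
      rw [scaledDiff, scaledBesselLog_zero]
      ring
    refine (remainder_isBigO_of_one_lt hp two_pos le_rfl hD hα).congr_right fun s => ?_
    rw [errorOrder, if_neg (lt_irrefl _), if_pos rfl, ← Real.rpow_natCast s 4]
    norm_num
  -- The index `p - 2` is positive, so `D_{p-2}` has a finite limit and no logarithm appears.
  · have hD : scaledDiff (Complex.digamma p) (p - 2) =O[halfNhds] powLog (2 - 2) 0 := by
      rw [sub_self]
      exact (tendsto_scaledDiff _ (sub_pos.2 h)).isBigO_powLog
    refine (remainder_isBigO_of_one_lt hp two_pos le_rfl hD hα).congr_right fun s => ?_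
    rw [errorOrder, if_neg (not_lt.2 h.le), if_neg h.ne', ← Real.rpow_natCast s 4]
    norm_num

theorem mainTheorem6 (p α : ℝ) (hp : 0 < p) (hα : α ∈ Set.Icc (-(Real.pi / 2)) (Real.pi / 2)) :
    ∃ lam R : ℝ → ℝ,
      (∀ s : ℝ, 0 < s → IsLyapunovExponent p s α (lam s)) ∧
      (∀ s : ℝ, 0 < s → lam s = Real.log s + realDigamma p + R s) ∧
      (p < 1 →
        (fun s : ℝ => R s - 2 * Real.cos (2 * p * α) * (Real.Gamma (1 - p) / Real.Gamma (1 + p)) *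
            (Real.log s / s ^ (2 * p)))
          =O[atTop] fun s : ℝ => 1 / s ^ (2 * p)) ∧
      (p = 1 →
        (fun s : ℝ => R s - 2 * Real.cos (2 * α) * ((Real.log s) ^ 2 / s ^ 2))
          =O[atTop] fun s : ℝ => Real.log s / s ^ 2) ∧
      (1 < p →
        (fun s : ℝ => R s - Real.cos (2 * α) / (p - 1) ^ 2 * (1 / s ^ 2))
          =O[atTop] fun s : ℝ => errorOrder p s) := by
  refine ⟨fun s => (besselLogExt p (scalePoint α s) / besselExt p (scalePoint α s)).re,
    fun s => (lyapunovRemainder p (scalePoint α s)).re,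
    fun s hs => isLyapunovExponent_bessel hp hs hα rfl, fun s hs => ?_,
    fun h => remainder_isBigO_of_lt_one hp h hα, ?_, fun h => remainder_isBigO_errorOrder h hα⟩
  · simp only [lyapunovRemainder, realDigamma, Complex.sub_re, Complex.add_re, log_scalePoint hα hs]
    simp
  · rintro rfl
    exact remainder_isBigO_one hα
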